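/- **Setting.** Fix a set of positive predicate symbols, each $p$ with a valency $v(p)=(k,m)\in\mathbb N^2$ and arity $k+m$, and negative symbols $\overline p$ with $v(\overline p)=(m,k)$; in an atomic formula the first $v_l$ argument places are *left*, the remaining ones *right*. Variables form an infinite set, which also serves as the set of indices of tensor expressions, and $l,r$ are two special variables. **MLL1** is first order multiplicative linear logic (one-sided sequent calculus, multiset contexts, rules Id for atoms, Cut, $\parr$, $\otimes$, $\forall$ with the usual eigenvariable condition, $\exists$), with $\overline{p(e_1,\dots,e_n)}=\overline p(e_n,\dots,e_1)$, $\overline{A\otimes B}=\overline B\parr\overline A$, $\overline{A\parr B}=\overline B\otimes\overline A$, $\overline{\forall xA}=\exists x\overline A$, $\overline{\exists xA}=\forall x\overline A$. **MILL1** formulas are built from positive symbols by $\otimes$, $A\multimap B=\overline A\parr B$, $\forall$, $\exists$; the MILL1 sequent $A_1,\dots,A_n\vdash B$ is the MLL1 sequent $\vdash B,\overline{A_1},\dots,\overline{A_n}$. **MILL1 grammars.** A MILL1 grammar over an alphabet $T$ is a pair $G=(\mathit{Lex},s)$ with $s$ a binary predicate symbol and $\mathit{Lex}$ a finite set of pairs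 $(w,A)$, where $w\in T^*$ is nonempty and $A$ is a MILL1 formula with one free occurrence of $l$, one free occurrence of $r$ and no other free variables. With $A[x;y]$ for the result of (simultaneously) substituting $x$ for $l$ and $y$ for $r$, $L(G)$ is the set of words $w_1\cdots w_n$ with $(w_1,A_1),\dots,(w_n,A_n)\in\mathit{Lex}$ and $A_1[c_0;c_1],\dots,A_n[c_{n-1};c_n]\vdash s(c_0,c_n)$ derivable in MILL1, where $c_0,\dots,c_n$ are distinct variables. $G$ is *well-formed* if $v(s)=(1,1)$ and, in the formula of every lexical entry, each quantifier binds exactly one left and one right occurrence, each free variable has at most one left and at most one right free occurrence, and $l$, $r$ occur with left and right polarity respectively. **Tensor grammars.** Tensor formulas are built from literals with indices (upper/lower, as many as the two components of the valency) by $\otimes,\parr$ and binding operators $\nabla^\mu_\nu,\triangle^\mu_\nu$ ($\mu\ne\nu$), which bind exactly one lower occurrence of $\mu$ and one upper occurrence of $\nu$, any index having at most one free upper and one free lower occurrence; a *tensor type* moreover has no index that is free both as an upper and as a lower one. Duality reverses the lists of indices, exchanges upper and lower ones and exchanges $\nabla/\triangle$. Tensor terms are commutative products of generators $[w]_i^j$,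 $[w]$ ($w\in T^*$) and tensor variables $X$ with pairwise distinct upper/lower indices, any index having at most one upper and one lower occurrence; $\beta$-equivalence of terms is generated, inside products, by $[u]^j_i[v]^k_j\to[uv]^k_i$, $[w]^i_i\to[w]$, $[\epsilon]\to1$, $[a_1\dots a_n]\to[a_na_1\dots a_{n-1}]$; $\delta^i_j=[\epsilon]^i_j$. In a judgement $t:A$, no index of $t$ is free in $A$ in the same (upper/lower) position, and the indices that are free as upper ones in $t$ or in $A$ are the same as those that are free as lower ones in $t$ or in $A$; it is a *typing judgement* if $A$ is a tensor type. A *context* is a finite set of typing judgements $X:A$ with different variable symbols, where no two variables share an upper index or share a lower index. $\mathbf{ETTC}_{n.d.}$ is the natural deduction system for sequents $\Gamma\vdash t:A$ with the following rules, all expressions in them being well-formed: - axioms $X:A\vdash X:A$; replacing $t$ by a $\beta$-equivalent term; - from $\Gamma\vdash t:A$ infer $\Gamma\vdash\delta^i_jt:A^{[j/i]}$ ($i$ a free upper index of $A$) or $\Gamma\vdash\delta^i_jt:A_{[i/j]}$ ($j$ a free lower index of $A$), and conversely; - from $X:A,\Gamma\vdash tX:B$ infer $\Gamma\vdash t:\overline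 A\parr B$ or $\Gamma\vdash t:B\parr\overline A$; from $\Gamma\vdash t:A$ and $\Theta\vdash s:\overline A\parr B$ or $\Theta\vdash s:B\parr\overline A$ infer $\Gamma,\Theta\vdash ts:B$; - from $\Gamma\vdash t:A$ and $\Theta\vdash s:B$ infer $\Gamma,\Theta\vdash ts:A\otimes B$; from $\Theta\vdash s:A\otimes B$ and $\Gamma,X:A,Y:B\vdash tXY:C$ infer $\Gamma,\Theta\vdash ts:C$; - from $\Gamma\vdash\delta^\mu_\nu t:A$ infer $\Gamma\vdash t:\nabla^\mu_\nu A$, and conversely; from $\Gamma\vdash t:A$ infer $\Gamma\vdash\delta^\nu_\mu t:\triangle^\mu_\nu A$; from $\Gamma\vdash t:\triangle^\mu_\nu A$ and $X:A,\Theta\vdash\delta^\nu_\mu sX:B$ infer $\Gamma,\Theta\vdash st:B$. A *tensor grammar* is a pair $(\mathit{Lex},s)$ with $s$ of valency $(1,1)$ and $\mathit{Lex}$ a finite set of $\alpha$-equivalence classes (classes under renaming of indices) of typing judgements $t:A$ where $t$ is $\beta$-reduced (no index occurs in it twice) and lexical: it has no tensor variables, is $\beta$-equivalent to a $\beta$-reduced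 product of generators $[w]_i^j$, and is not $\beta$-equivalent to any $\delta^i_j\cdot t'$ with $i$ an upper and $j$ a lower free index of $t$. Its language is the set of words $w$ such that $\vdash[w]^i_j:s^j_i$ is derivable in $\mathbf{ETTC}_{n.d.}$ from the axioms $\vdash t:A$ with $t:A$ in one of the classes of $\mathit{Lex}$. **Translation.** $\|A\|$ is obtained from a formula $A$ by turning left occurrences of variables into upper and right occurrences into lower indices, keeping $\otimes,\parr$ and setting $\|\forall xA\|=\nabla^u_v\|A\|^{[v/x]}_{[u/x]}$, $\|\exists xA\|=\triangle^u_v\|A\|^{[v/x]}_{[u/x]}$ for fresh $u,v$ (well-defined up to renaming of bound indices). The *tensor translation* of a well-formed MILL1 grammar $G=(\mathit{Lex},s)$ is the tensor grammar $\widetilde G=(\{[w]^r_l:\|A\|\ \mid\ (w,A)\in\mathit{Lex}\},\,s)$. **Lemma.** For any well-formed MILL1 grammar $G$, its tensor translation $\widetilde G$ generates the same language: $L(G)=L(\widetilde G)$. -/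

import Mathlib

namespace LinGram

universe u v w

/-! ### First order multiplicative linear logic

Formulas are taken up to renaming of bound variables: a bound occurrence is a de Bruijn index,
a free occurrence is a name. -/

/-- A linguistically marked predicate language: the positive predicate symbols, each with its
valency `(vl p, vr p)`. The arity of `p` is `vl p + vr p`. The negative symbol `p̄` has
valency `(vr p, vl p)`. -/
structure Language where
  Pred : Type u
  vl : Pred → ℕ
  vr : Pred → ℕ

/-- What may stand at an argument place below `n` binders: a free name, or a reference to one of
the `n` binders (`0` is the innermost one). -/
abbrev Slot (V : Type v) (n : ℕ) : Type v := V ⊕ Fin n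

/-- Moving a slot below one more binder. -/
def Slot.weaken {V : Type v} {n : ℕ} : Slot V n → Slot V (n + 1) := Sum.map id Fin.succ

/-- Extending a renaming of slots to the scope of one more binder. -/
def Slot.lift {V : Type v} {n m : ℕ} (ρ : Slot V n → Slot V m) : Slot V (n + 1) → Slot V (m + 1)
  | .inl x => Slot.weaken (ρ (.inl x))
  | .inr i => Fin.cases (.inr 0) (fun k => Slot.weaken (ρ (.inr k))) i

/-- Replacing the references to the innermost binder by the name `x`. -/
def Slot.inst {V : Type v} {n : ℕ} (x : V) : Slot V (n + 1) → Slot V n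
  | .inl y => .inl y
  | .inr i => Fin.cases (.inl x) .inr i

/-- Renaming the free names. -/
def Slot.map {V : Type v} {n : ℕ} (f : V → V) : Slot V n → Slot V n := Sum.map f id

/-- MLL1 formulas below `n` quantifiers; the formulas proper are those with `n = 0`.
`pos p e` is `p(e₁,…)` and `neg p e` is `p̄(e₁,…)`. -/
inductive Fm (L : Language.{u}) (V : Type v) : ℕ → Type (max u v)
  | pos {n : ℕ} (p : L.Pred) (e : Fin (L.vl p + L.vr p) → Slot V n) : Fm L V n
  | neg {n : ℕ} (p : L.Pred) (e : Fin (L.vr p + L.vl p) → Slot V n) : Fm L V n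
  | tensor {n : ℕ} (A B : Fm L V n) : Fm L V n
  | par {n : ℕ} (A B : Fm L V n) : Fm L V n
  | all {n : ℕ} (A : Fm L V (n + 1)) : Fm L V n
  | ex {n : ℕ} (A : Fm L V (n + 1)) : Fm L V n

namespace Fm

variable {L : Language.{u}} {V : Type v}

/-- Linear negation; it reverses argument lists and flips the factors. -/
def dual : {n : ℕ} → Fm L V n → Fm L V n
  | _, pos p e => neg p (fun i => e (Fin.rev (Fin.cast (Nat.add_comm _ _) i)))
  | _, neg p e => pos p (fun i => e (Fin.rev (Fin.cast (Nat.add_comm _ _) i)))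
  | _, tensor A B => par B.dual A.dual
  | _, par A B => tensor B.dual A.dual
  | _, all A => ex A.dual
  | _, ex A => all A.dual

/-- Capture-avoiding renaming. -/
def rename : {n m : ℕ} → (Slot V n → Slot V m) → Fm L V n → Fm L V m
  | _, _, ρ, pos p e => pos p (fun i => ρ (e i))
  | _, _, ρ, neg p e => neg p (fun i => ρ (e i))
  | _, _, ρ, tensor A B => tensor (A.rename ρ) (B.rename ρ)
  | _, _, ρ, par A B => par (A.rename ρ) (B.rename ρ)
  | _, _, ρ, all A => all (A.rename (Slot.lift ρ))
  | _, _, ρ, ex A => ex (A.rename (Slot.lift ρ))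

/-- For a formula `A` in the scope of a quantifier of `x`, the formula `A[v/x]`. -/
def inst {n : ℕ} (x : V) (A : Fm L V (n + 1)) : Fm L V n := A.rename (Slot.inst x)

/-- The slot `x` occurs in the formula (for `x = .inl y`: the variable `y` occurs freely). -/
def Occurs : {n : ℕ} → Slot V n → Fm L V n → Prop
  | _, x, pos _ e => ∃ i, e i = x
  | _, x, neg _ e => ∃ i, e i = x
  | _, x, tensor A B => A.Occurs x ∨ B.Occurs x
  | _, x, par A B => A.Occurs x ∨ B.Occurs x
  | _, x, all A => A.Occurs x.weaken
  | _, x, ex A => A.Occurs x.weaken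

/-- Atomic formulas, positive or negative. -/
def IsAtomic : Fm L V 0 → Prop
  | pos _ _ => True
  | neg _ _ => True
  | _ => False

variable [DecidableEq V]

/-- The number of left occurrences of a slot: in an atomic formula of valency `(k, m)` the first
`k` argument places are left. -/
def countL : {n : ℕ} → Slot V n → Fm L V n → ℕ
  | _, x, pos p e => (Finset.univ.filter fun i : Fin (L.vl p) => e (Fin.castAdd _ i) = x).card
  | _, x, neg p e => (Finset.univ.filter fun i : Fin (L.vr p) => e (Fin.castAdd _ i) = x).card
  | _, x, tensor A B => A.countL x + B.countL x
  | _, x, par A B => A.countL x + B.countL x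
  | _, x, all A => A.countL x.weaken
  | _, x, ex A => A.countL x.weaken

/-- The number of right occurrences of a slot: in an atomic formula of valency `(k, m)` the last
`m` argument places are right. -/
def countR : {n : ℕ} → Slot V n → Fm L V n → ℕ
  | _, x, pos p e => (Finset.univ.filter fun i : Fin (L.vr p) => e (Fin.natAdd _ i) = x).card
  | _, x, neg p e => (Finset.univ.filter fun i : Fin (L.vl p) => e (Fin.natAdd _ i) = x).card
  | _, x, tensor A B => A.countR x + B.countR x
  | _, x, par A B => A.countR x + B.countR x
  | _, x, all A => A.countR x.weaken
  | _, x, ex A => A.countR x.weaken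

/-- Linguistically marked: every quantifier binds exactly one left and one right occurrence. -/
def Marked : {n : ℕ} → Fm L V n → Prop
  | _, pos _ _ => True
  | _, neg _ _ => True
  | _, tensor A B => A.Marked ∧ B.Marked
  | _, par A B => A.Marked ∧ B.Marked
  | _, all A => A.Marked ∧ A.countL (.inr 0) = 1 ∧ A.countR (.inr 0) = 1
  | _, ex A => A.Marked ∧ A.countL (.inr 0) = 1 ∧ A.countR (.inr 0) = 1

/-- Linguistically well-formed: marked, with at most one left and at most one right occurrence of
any free variable. -/
def LingWF (A : Fm L V 0) : Prop :=
  A.Marked ∧ ∀ x : V, A.countL (.inl x) ≤ 1 ∧ A.countR (.inl x) ≤ 1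

/-- `A[x;y]`: `x` for `l` and `y` for `r`, simultaneously. -/
def subst₂ (l r x y : V) (A : Fm L V 0) : Fm L V 0 :=
  A.rename (Slot.map fun z => if z = l then x else if z = r then y else z)

end Fm

/-- Derivability in the sequent calculus MLL1; contexts are multisets of formulas. -/
inductive MLL1 {L : Language.{u}} {V : Type v} : Multiset (Fm L V 0) → Prop
  | id (A : Fm L V 0) : A.IsAtomic → MLL1 {A.dual, A}
  | cut (Γ Θ : Multiset (Fm L V 0)) (A : Fm L V 0) :
      MLL1 (A ::ₘ Γ) → MLL1 (A.dual ::ₘ Θ) → MLL1 (Γ + Θ)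
  | par (Γ : Multiset (Fm L V 0)) (A B : Fm L V 0) :
      MLL1 (A ::ₘ B ::ₘ Γ) → MLL1 (.par A B ::ₘ Γ)
  | tensor (Γ Θ : Multiset (Fm L V 0)) (A B : Fm L V 0) :
      MLL1 (A ::ₘ Γ) → MLL1 (B ::ₘ Θ) → MLL1 (.tensor A B ::ₘ (Γ + Θ))
  | all (Γ : Multiset (Fm L V 0)) (A : Fm L V 1) (x : V) :
      (∀ B ∈ Fm.all A ::ₘ Γ, ¬ B.Occurs (.inl x)) →
      MLL1 (A.inst x ::ₘ Γ) → MLL1 (.all A ::ₘ Γ)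
  | ex (Γ : Multiset (Fm L V 0)) (A : Fm L V 1) (x : V) :
      MLL1 (A.inst x ::ₘ Γ) → MLL1 (.ex A ::ₘ Γ)

/-- MILL1 formulas: built from positive predicate symbols with quantifiers, tensor and linear
implication `A ⊸ B = Ā ⅋ B`. -/
inductive IsMILL {L : Language.{u}} {V : Type v} : {n : ℕ} → Fm L V n → Prop
  | pos {n : ℕ} (p : L.Pred) (e : Fin (L.vl p + L.vr p) → Slot V n) : IsMILL (.pos p e)
  | tensor {n : ℕ} {A B : Fm L V n} : IsMILL A → IsMILL B → IsMILL (.tensor A B)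
  | lolli {n : ℕ} {A B : Fm L V n} : IsMILL A → IsMILL B → IsMILL (.par A.dual B)
  | all {n : ℕ} {A : Fm L V (n + 1)} : IsMILL A → IsMILL (.all A)
  | ex {n : ℕ} {A : Fm L V (n + 1)} : IsMILL A → IsMILL (.ex A)

/-- Derivability of the two-sided sequent `Γ ⊢ B`. MILL1 is the fragment of MLL1 that consists of
the sequents `⊢ B, Ā₁, …, Āₙ`, written in this way, for MILL1 formulas. -/
def MILL1 {L : Language.{u}} {V : Type v} (Γ : Multiset (Fm L V 0)) (B : Fm L V 0) : Prop :=
  MLL1 (B ::ₘ Γ.map Fm.dual)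

/-- A MILL1 lexical entry: a nonempty word and a MILL1 formula with one free occurrence of `l`,
one free occurrence of `r` and no other free variables. -/
def IsLexEntry {L : Language.{u}} {V : Type v} {T : Type w} [DecidableEq V] (l r : V)
    (e : List T × Fm L V 0) : Prop :=
  e.1 ≠ [] ∧ IsMILL e.2 ∧
    e.2.countL (.inl l) + e.2.countR (.inl l) = 1 ∧
    e.2.countL (.inl r) + e.2.countR (.inl r) = 1 ∧
    ∀ x : V, e.2.Occurs (.inl x) → x = l ∨ x = r

/-- A MILL1 grammar with terminal symbols from `T`. -/
structure MILLGrammar (L : Language.{u}) (V : Type v) (T : Type w) [DecidableEq V] (l r : V) where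
  lex : Set (List T × Fm L V 0)
  lex_finite : lex.Finite
  lex_entry : ∀ e ∈ lex, IsLexEntry l r e
  start : L.Pred
  start_binary : L.vl start + L.vr start = 2

namespace MILLGrammar

variable {L : Language.{u}} {V : Type v} {T : Type w} [DecidableEq V] {l r : V}

/-- The formula `s(x, y)` for the start symbol `s`. -/
def startFm (G : MILLGrammar L V T l r) (x y : V) : Fm L V 0 :=
  .pos G.start (fun i => if i.val = 0 then .inl x else .inl y)

/-- The words `w₁⋯wₙ` with `(wᵢ, Aᵢ)` in the lexicon and
`A₁[c₀;c₁], …, Aₙ[cₙ₋₁;cₙ] ⊢ s(c₀,cₙ)` derivable in MILL1, for distinct variables `c₀,…,cₙ`. -/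
def language (G : MILLGrammar L V T l r) : Set (List T) :=
  {x | ∃ (n : ℕ) (e : Fin n → List T × Fm L V 0) (c : Fin (n + 1) → V),
    (∀ i, e i ∈ G.lex) ∧ Function.Injective c ∧
    x = (List.ofFn fun i => (e i).1).flatten ∧
    MILL1 (Finset.univ.val.map fun i : Fin n => (e i).2.subst₂ l r (c i.castSucc) (c i.succ))
      (G.startFm (c 0) (c (Fin.last n)))}

/-- Well-formed grammars: the formulas of the lexicon are linguistically well-formed, with `l` and
`r` occurring with left and right polarity. The start symbol has valency `(1,1)`. -/
structure WellFormed (G : MILLGrammar L V T l r) : Prop where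
  lex_wf : ∀ e ∈ G.lex, e.2.LingWF ∧ e.2.countL (.inl l) = 1 ∧ e.2.countR (.inl r) = 1
  start_valency : L.vl G.start = 1 ∧ L.vr G.start = 1

end MILLGrammar

/-! ### Tensor formulas

Pseudoformulas are taken up to renaming of bound indices. A binding operator binds one index in
upper and one (different) index in lower position, so an upper occurrence of the de Bruijn index
`k` refers to the upper index bound by the `k`-th operator around it, a lower occurrence to the
lower one. The literals are the predicate symbols, with the same valencies. -/

/-- Tensor pseudoformulas below `n` binding operators; those proper have `n = 0`. In `pos p a b`
the `a`s are the upper and the `b`s the lower indices of the literal `p`; `neg` is for `p̄`. -/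
inductive TFm (L : Language.{u}) (V : Type v) : ℕ → Type (max u v)
  | pos {n : ℕ} (p : L.Pred) (a : Fin (L.vl p) → Slot V n) (b : Fin (L.vr p) → Slot V n) : TFm L V n
  | neg {n : ℕ} (p : L.Pred) (a : Fin (L.vr p) → Slot V n) (b : Fin (L.vl p) → Slot V n) : TFm L V n
  | tensor {n : ℕ} (A B : TFm L V n) : TFm L V n
  | par {n : ℕ} (A B : TFm L V n) : TFm L V n
  | nabla {n : ℕ} (A : TFm L V (n + 1)) : TFm L V n
  | tri {n : ℕ} (A : TFm L V (n + 1)) : TFm L V n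

namespace TFm

variable {L : Language.{u}} {V : Type v}

/-- Duality. -/
def dual : {n : ℕ} → TFm L V n → TFm L V n
  | _, pos p a b => neg p (fun i => b i.rev) (fun i => a i.rev)
  | _, neg p a b => pos p (fun i => b i.rev) (fun i => a i.rev)
  | _, tensor A B => par B.dual A.dual
  | _, par A B => tensor B.dual A.dual
  | _, nabla A => tri A.dual
  | _, tri A => nabla A.dual

/-- Renaming by `ρ` in upper and by `σ` in lower position. -/
def rename : {n m : ℕ} → (Slot V n → Slot V m) → (Slot V n → Slot V m) → TFm L V n → TFm L V m
  | _, _, ρ, σ, pos p a b => pos p (fun i => ρ (a i)) (fun i => σ (b i))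
  | _, _, ρ, σ, neg p a b => neg p (fun i => ρ (a i)) (fun i => σ (b i))
  | _, _, ρ, σ, tensor A B => tensor (A.rename ρ σ) (B.rename ρ σ)
  | _, _, ρ, σ, par A B => par (A.rename ρ σ) (B.rename ρ σ)
  | _, _, ρ, σ, nabla A => nabla (A.rename (Slot.lift ρ) (Slot.lift σ))
  | _, _, ρ, σ, tri A => tri (A.rename (Slot.lift ρ) (Slot.lift σ))

/-- For `A` in the scope of a binding operator: the formula with the index `ν` for the bound upper
index and `μ` for the bound lower one. Thus `∇ A` is `∇^μ_ν (A.inst ν μ)`. -/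
def inst (ν μ : V) (A : TFm L V 1) : TFm L V 0 := A.rename (Slot.inst ν) (Slot.inst μ)

/-- Renaming all free indices. -/
def mapFree (f : V → V) (A : TFm L V 0) : TFm L V 0 := A.rename (Slot.map f) (Slot.map f)

variable [DecidableEq V]

/-- `A^{[j/i]}`: the free upper occurrences of `i` are replaced by `j`. -/
def substUp (i j : V) (A : TFm L V 0) : TFm L V 0 :=
  A.rename (Slot.map fun x => if x = i then j else x) id

/-- `A_{[j/i]}`: the free lower occurrences of `i` are replaced by `j`. -/
def substLo (i j : V) (A : TFm L V 0) : TFm L V 0 :=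
  A.rename id (Slot.map fun x => if x = i then j else x)

/-- The number of upper occurrences of a slot. -/
def countUp : {n : ℕ} → Slot V n → TFm L V n → ℕ
  | _, x, pos _ a _ => (Finset.univ.filter fun i => a i = x).card
  | _, x, neg _ a _ => (Finset.univ.filter fun i => a i = x).card
  | _, x, tensor A B => A.countUp x + B.countUp x
  | _, x, par A B => A.countUp x + B.countUp x
  | _, x, nabla A => A.countUp x.weaken
  | _, x, tri A => A.countUp x.weaken

/-- The number of lower occurrences of a slot. -/
def countLo : {n : ℕ} → Slot V n → TFm L V n → ℕ
  | _, x, pos _ _ b => (Finset.univ.filter fun i => b i = x).card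
  | _, x, neg _ _ b => (Finset.univ.filter fun i => b i = x).card
  | _, x, tensor A B => A.countLo x + B.countLo x
  | _, x, par A B => A.countLo x + B.countLo x
  | _, x, nabla A => A.countLo x.weaken
  | _, x, tri A => A.countLo x.weaken

/-- Every binding operator binds exactly one lower and one upper occurrence. -/
def BindersOK : {n : ℕ} → TFm L V n → Prop
  | _, pos _ _ _ => True
  | _, neg _ _ _ => True
  | _, tensor A B => A.BindersOK ∧ B.BindersOK
  | _, par A B => A.BindersOK ∧ B.BindersOK
  | _, nabla A => A.BindersOK ∧ A.countUp (.inr 0) = 1 ∧ A.countLo (.inr 0) = 1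
  | _, tri A => A.BindersOK ∧ A.countUp (.inr 0) = 1 ∧ A.countLo (.inr 0) = 1

/-- The free upper indices. -/
def FIup (A : TFm L V 0) : Set V := {i | 0 < A.countUp (.inl i)}

/-- The free lower indices. -/
def FIlo (A : TFm L V 0) : Set V := {i | 0 < A.countLo (.inl i)}

/-- Pseudotypes (tensor formulas): well-formed pseudoformulas. -/
def IsPseudotype (A : TFm L V 0) : Prop :=
  A.BindersOK ∧ ∀ i : V, A.countUp (.inl i) ≤ 1 ∧ A.countLo (.inl i) ≤ 1

/-- Tensor types: pseudotypes where no index has both an upper and a lower free occurrence. -/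
def IsType (A : TFm L V 0) : Prop := A.IsPseudotype ∧ Disjoint A.FIup A.FIlo

end TFm

/-! ### Tensor terms of the natural deduction system -/

/-- Tensor variables `x^{i₁…iₘ}_{j₁…jₙ}`. There are countably many variable symbols of every
valency `(m, n)`; they are numbered by `name`. -/
structure TVar (V : Type v) where
  name : ℕ
  up : List V
  lo : List V

/-- The variable symbol: its number and its valency. -/
def TVar.symbol {V : Type v} (X : TVar V) : ℕ × ℕ × ℕ := (X.name, X.up.length, X.lo.length)

/-- Generators of tensor terms: `reg x i j` is `[x]_i^j` (lower `i`, upper `j`), `sing x` is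
`[x]`, and `var X` is a tensor variable. -/
inductive Gen (V : Type v) (T : Type w) : Type (max v w)
  | reg (x : List T) (i j : V) : Gen V T
  | sing (x : List T) : Gen V T
  | var (X : TVar V) : Gen V T

namespace Gen

variable {V : Type v} {T : Type w}

/-- Upper indices. -/
def up : Gen V T → Multiset V
  | reg _ _ j => {j}
  | sing _ => 0
  | var X => X.up

/-- Lower indices. -/
def lo : Gen V T → Multiset V
  | reg _ i _ => {i}
  | sing _ => 0
  | var X => X.lo

/-- Renaming of indices. -/
def map (f : V → V) : Gen V T → Gen V T
  | reg x i j => reg x (f i) (f j)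
  | sing x => sing x
  | var X => var ⟨X.name, X.up.map f, X.lo.map f⟩

/-- `δ^i_j = [ε]^i_j`. -/
def delta (i j : V) : Gen V T := reg [] j i

end Gen

/-- Elements of the free commutative monoid over the generators (written additively). Those that
are n.d. tensor terms are singled out by `Term.IsTerm`. -/
abbrev Term (V : Type v) (T : Type w) : Type (max v w) := Multiset (Gen V T)

namespace Term

variable {V : Type v} {T : Type w}

/-- Upper indices, with multiplicities. -/
def up (t : Term V T) : Multiset V := t.bind Gen.up

/-- Lower indices, with multiplicities. -/
def lo (t : Term V T) : Multiset V := t.bind Gen.lo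

/-- Tensor terms: any index has at most one upper and at most one lower occurrence, and the tensor
variables have no repeated indices. -/
def IsTerm (t : Term V T) : Prop :=
  t.up.Nodup ∧ t.lo.Nodup ∧ ∀ X : TVar V, Gen.var X ∈ t → (X.up ++ X.lo).Nodup

/-- The upper indices that are free, that is, occur exactly once in the term. -/
def FIup (t : Term V T) : Set V := {i | i ∈ t.up ∧ i ∉ t.lo}

/-- The lower indices that are free. -/
def FIlo (t : Term V T) : Set V := {i | i ∈ t.lo ∧ i ∉ t.up}

/-- One step of β-reduction, in a term. -/
inductive BetaStep : Term V T → Term V T → Prop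
  | contract (x y : List T) (i j k : V) (s : Term V T) :
      IsTerm (Gen.reg x i j ::ₘ Gen.reg y j k ::ₘ s) →
      BetaStep (Gen.reg x i j ::ₘ Gen.reg y j k ::ₘ s) (Gen.reg (x ++ y) i k ::ₘ s)
  | loop (x : List T) (i : V) (s : Term V T) :
      IsTerm (Gen.reg x i i ::ₘ s) → BetaStep (Gen.reg x i i ::ₘ s) (Gen.sing x ::ₘ s)
  | empty (s : Term V T) : IsTerm (Gen.sing [] ::ₘ s) → BetaStep (Gen.sing [] ::ₘ s) s
  | rotate (x : List T) (a : T) (s : Term V T) :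
      IsTerm (Gen.sing (x ++ [a]) ::ₘ s) →
      BetaStep (Gen.sing (x ++ [a]) ::ₘ s) (Gen.sing (a :: x) ::ₘ s)

/-- β-equivalence. -/
def BetaEq : Term V T → Term V T → Prop := Relation.EqvGen BetaStep

/-- No index is bound. -/
def IsBetaReduced (t : Term V T) : Prop := t.IsTerm ∧ ∀ i, ¬ (i ∈ t.up ∧ i ∈ t.lo)

/-- Regular terms: β-equivalent to a β-reduced product of elementary regular terms. -/
def IsRegular (t : Term V T) : Prop :=
  ∃ t' : Term V T, t.BetaEq t' ∧ t'.IsBetaReduced ∧ ∀ g ∈ t', ∃ x i j, g = Gen.reg x i j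

/-- Lexical terms: regular, without tensor variables, and not β-equivalent to a term
`δ^i_j · t'` with `(i,j)` free in `t`. -/
def IsLexical (t : Term V T) : Prop :=
  t.IsTerm ∧ t.IsRegular ∧ (∀ X : TVar V, Gen.var X ∉ t) ∧
    ¬ ∃ (i j : V) (t' : Term V T), i ∈ t.FIup ∧ j ∈ t.FIlo ∧ t.BetaEq (Gen.delta i j ::ₘ t')

end Term

/-! ### The natural deduction system of extended tensor type calculus -/

section ND

variable {L : Language.{u}} {V : Type v} {T : Type w} [DecidableEq V]

/-- `t : A` is an n.d. pseudotyping judgement. -/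
def IsPseudotyping (t : Term V T) (A : TFm L V 0) : Prop :=
  t.IsTerm ∧ A.IsPseudotype ∧
    (∀ i ∈ t.up, i ∉ A.FIup) ∧ (∀ i ∈ t.lo, i ∉ A.FIlo) ∧
    t.FIup ∪ A.FIup = t.FIlo ∪ A.FIlo

/-- `t : A` is an n.d. typing judgement. -/
def IsTyping (t : Term V T) (A : TFm L V 0) : Prop := IsPseudotyping t A ∧ A.IsType

/-- n.d. typing contexts: sets of variable declarations `X : A` that have pairwise different
variable symbols and pairwise no common upper and no common lower indices. -/
def IsCtx (T : Type w) (Γ : Multiset (TVar V × TFm L V 0)) : Prop :=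
  (∀ D ∈ Γ, IsTyping ({Gen.var D.1} : Term V T) D.2) ∧
    (Γ.map fun D => D.1.symbol).Nodup ∧
    (Γ.bind fun D => (D.1.up : Multiset V)).Nodup ∧
    (Γ.bind fun D => (D.1.lo : Multiset V)).Nodup

/-- `Γ ⊢ t : A` is an n.d. tensor sequent. -/
def IsSeq (Γ : Multiset (TVar V × TFm L V 0)) (t : Term V T) (A : TFm L V 0) : Prop :=
  IsCtx T Γ ∧ IsPseudotyping t A

/-- Derivability in the natural deduction system, with the nonlogical axioms `⊢ τ : A` for
`(τ, A) ∈ Ax`. All expressions have to be well-formed; in every rule this is required of the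
conclusion, so that it holds for the premises too. -/
inductive ND (Ax : Set (Term V T × TFm L V 0)) :
    Multiset (TVar V × TFm L V 0) → Term V T → TFm L V 0 → Prop
  | ax {t : Term V T} {A : TFm L V 0} : (t, A) ∈ Ax → IsSeq 0 t A → ND Ax 0 t A
  | id {X : TVar V} {A : TFm L V 0} : IsSeq (T := T) {(X, A)} {Gen.var X} A →
      ND Ax {(X, A)} {Gen.var X} A
  | beta {Γ t t' A} : ND Ax Γ t A → t.BetaEq t' → IsSeq Γ t' A → ND Ax Γ t' A
  | etaUpExp {Γ t} {A : TFm L V 0} {i j : V} : i ∈ A.FIup → ND Ax Γ t A →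
      IsSeq Γ (Gen.delta i j ::ₘ t) (A.substUp i j) →
      ND Ax Γ (Gen.delta i j ::ₘ t) (A.substUp i j)
  | etaUpRed {Γ t} {A : TFm L V 0} {i j : V} : i ∈ A.FIup →
      ND Ax Γ (Gen.delta i j ::ₘ t) (A.substUp i j) → IsSeq Γ t A → ND Ax Γ t A
  | etaLoExp {Γ t} {A : TFm L V 0} {i j : V} : j ∈ A.FIlo → ND Ax Γ t A →
      IsSeq Γ (Gen.delta i j ::ₘ t) (A.substLo j i) →
      ND Ax Γ (Gen.delta i j ::ₘ t) (A.substLo j i)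
  | etaLoRed {Γ t} {A : TFm L V 0} {i j : V} : j ∈ A.FIlo →
      ND Ax Γ (Gen.delta i j ::ₘ t) (A.substLo j i) → IsSeq Γ t A → ND Ax Γ t A
  | parIl {Γ t X A B} : ND Ax ((X, A) ::ₘ Γ) (t + {Gen.var X}) B →
      IsSeq Γ t (.par A.dual B) → ND Ax Γ t (.par A.dual B)
  | parEl {Γ Θ t s A B} : ND Ax Γ t A → ND Ax Θ s (.par A.dual B) →
      IsSeq (Γ + Θ) (t + s) B → ND Ax (Γ + Θ) (t + s) B
  | parIr {Γ t X A B} : ND Ax ((X, A) ::ₘ Γ) (t + {Gen.var X}) B →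
      IsSeq Γ t (.par B A.dual) → ND Ax Γ t (.par B A.dual)
  | parEr {Γ Θ t s A B} : ND Ax Γ s (.par B A.dual) → ND Ax Θ t A →
      IsSeq (Γ + Θ) (s + t) B → ND Ax (Γ + Θ) (s + t) B
  | tensorI {Γ Θ t s A B} : ND Ax Γ t A → ND Ax Θ s B →
      IsSeq (Γ + Θ) (t + s) (.tensor A B) → ND Ax (Γ + Θ) (t + s) (.tensor A B)
  | tensorE {Γ Θ t s X Y A B C} : ND Ax Θ s (.tensor A B) →
      ND Ax ((X, A) ::ₘ (Y, B) ::ₘ Γ) (t + {Gen.var X, Gen.var Y}) C →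
      IsSeq (Γ + Θ) (t + s) C → ND Ax (Γ + Θ) (t + s) C
  | nablaI {Γ t} {A : TFm L V 1} {μ ν : V} : μ ≠ ν →
      ND Ax Γ (Gen.delta μ ν ::ₘ t) (A.inst ν μ) →
      IsSeq Γ t (.nabla A) → ND Ax Γ t (.nabla A)
  | nablaE {Γ t} {A : TFm L V 1} {μ ν : V} : μ ≠ ν →
      ND Ax Γ t (.nabla A) → IsSeq Γ (Gen.delta μ ν ::ₘ t) (A.inst ν μ) →
      ND Ax Γ (Gen.delta μ ν ::ₘ t) (A.inst ν μ)
  | triI {Γ t} {A : TFm L V 1} {μ ν : V} : μ ≠ ν →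
      ND Ax Γ t (A.inst ν μ) → IsSeq Γ (Gen.delta ν μ ::ₘ t) (.tri A) →
      ND Ax Γ (Gen.delta ν μ ::ₘ t) (.tri A)
  | triE {Γ Θ t s X C} {A : TFm L V 1} {μ ν : V} : μ ≠ ν →
      ND Ax Γ t (.tri A) →
      ND Ax ((X, A.inst ν μ) ::ₘ Θ) (Gen.delta ν μ ::ₘ (s + {Gen.var X})) C →
      IsSeq (Γ + Θ) (s + t) C → ND Ax (Γ + Θ) (s + t) C

/-- α-equivalence of judgements. Bound indices of formulas carry no names here, so two judgements
are α-equivalent iff a permutation of the indices carries one to the other. -/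
def AlphaEq (J J' : Term V T × TFm L V 0) : Prop :=
  ∃ σ : Equiv.Perm V, J'.1 = J.1.map (Gen.map σ) ∧ J'.2 = J.2.mapFree σ

end ND

/-- Tensor grammars. A lexical entry is an α-equivalence class of β-reduced lexical typing
judgements; `lex` contains representatives of these classes. -/
structure TensorGrammar (L : Language.{u}) (V : Type v) (T : Type w) [DecidableEq V] where
  lex : Set (Term V T × TFm L V 0)
  lex_finite : lex.Finite
  lex_entry : ∀ J ∈ lex, IsTyping J.1 J.2 ∧ J.1.IsBetaReduced ∧ J.1.IsLexical
  start : L.Pred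
  start_valency : L.vl start = 1 ∧ L.vr start = 1

namespace TensorGrammar

variable {L : Language.{u}} {V : Type v} {T : Type w} [DecidableEq V]

/-- `⊢_G t : A`: derivability from the closure of the lexicon under α-equivalence. -/
def Derives (G : TensorGrammar L V T) (t : Term V T) (A : TFm L V 0) : Prop :=
  ND {J | ∃ J₀ ∈ G.lex, AlphaEq J₀ J} 0 t A

/-- The words `x` with `⊢_G [x]^i_j : s^j_i`. -/
def language (G : TensorGrammar L V T) : Set (List T) :=
  {x | ∃ i j : V, G.Derives {Gen.reg x j i} (.pos G.start (fun _ => .inl j) (fun _ => .inl i))}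

end TensorGrammar

/-! ### The translation -/

/-- The η-reduced translation `‖A‖`: left occurrences become upper and right occurrences become
lower indices, and `∀`, `∃` become `∇`, `△`. -/
def Fm.toTensor {L : Language.{u}} {V : Type v} : {n : ℕ} → Fm L V n → TFm L V n
  | _, .pos p e => .pos p (fun i => e (Fin.castAdd _ i)) (fun i => e (Fin.natAdd _ i))
  | _, .neg p e => .neg p (fun i => e (Fin.castAdd _ i)) (fun i => e (Fin.natAdd _ i))
  | _, .tensor A B => .tensor A.toTensor B.toTensor
  | _, .par A B => .par A.toTensor B.toTensor
  | _, .all A => .nabla A.toTensor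
  | _, .ex A => .tri A.toTensor

set_option linter.unusedSectionVars false

section Facts

variable {L : Language.{u}} {V : Type v} {T : Type w} [DecidableEq V]

theorem Fm.countUp_toTensor {n : ℕ} (A : Fm L V n) (x : Slot V n) :
    A.toTensor.countUp x = A.countL x := by
  induction A with
  | pos p e => simp [Fm.toTensor, TFm.countUp, Fm.countL]
  | neg p e => simp [Fm.toTensor, TFm.countUp, Fm.countL]
  | tensor A B hA hB => exact congrArg₂ (· + ·) (hA x) (hB x)
  | par A B hA hB => exact congrArg₂ (· + ·) (hA x) (hB x)
  | all A hA => exact hA _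
  | ex A hA => exact hA _

theorem Fm.countLo_toTensor {n : ℕ} (A : Fm L V n) (x : Slot V n) :
    A.toTensor.countLo x = A.countR x := by
  induction A with
  | pos p e => simp [Fm.toTensor, TFm.countLo, Fm.countR]
  | neg p e => simp [Fm.toTensor, TFm.countLo, Fm.countR]
  | tensor A B hA hB => exact congrArg₂ (· + ·) (hA x) (hB x)
  | par A B hA hB => exact congrArg₂ (· + ·) (hA x) (hB x)
  | all A hA => exact hA _
  | ex A hA => exact hA _

theorem Fm.bindersOK_toTensor {n : ℕ} (A : Fm L V n) (h : A.Marked) : A.toTensor.BindersOK := by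
  induction A <;>
    simp_all [Fm.toTensor, TFm.BindersOK, Fm.Marked, Fm.countUp_toTensor, Fm.countLo_toTensor]

theorem Fm.occurs_of_countL {n : ℕ} (A : Fm L V n) (x : Slot V n) (h : 0 < A.countL x) :
    A.Occurs x := by
  induction A with
  | pos p e => obtain ⟨i, hi⟩ := Finset.card_pos.1 h; exact ⟨_, (Finset.mem_filter.1 hi).2⟩
  | neg p e => obtain ⟨i, hi⟩ := Finset.card_pos.1 h; exact ⟨_, (Finset.mem_filter.1 hi).2⟩
  | tensor A B hA hB => exact (Nat.add_pos_iff_pos_or_pos.1 h).imp (hA x) (hB x)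
  | par A B hA hB => exact (Nat.add_pos_iff_pos_or_pos.1 h).imp (hA x) (hB x)
  | all A hA => exact hA _ h
  | ex A hA => exact hA _ h

theorem Fm.occurs_of_countR {n : ℕ} (A : Fm L V n) (x : Slot V n) (h : 0 < A.countR x) :
    A.Occurs x := by
  induction A with
  | pos p e => obtain ⟨i, hi⟩ := Finset.card_pos.1 h; exact ⟨_, (Finset.mem_filter.1 hi).2⟩
  | neg p e => obtain ⟨i, hi⟩ := Finset.card_pos.1 h; exact ⟨_, (Finset.mem_filter.1 hi).2⟩
  | tensor A B hA hB => exact (Nat.add_pos_iff_pos_or_pos.1 h).imp (hA x) (hB x)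
  | par A B hA hB => exact (Nat.add_pos_iff_pos_or_pos.1 h).imp (hA x) (hB x)
  | all A hA => exact hA _ h
  | ex A hA => exact hA _ h

theorem Term.isTerm_single (x : List T) (i j : V) : IsTerm ({Gen.reg x i j} : Term V T) := by
  refine ⟨by simp [Term.up, Gen.up], by simp [Term.lo, Gen.lo], fun X h => ?_⟩
  simp at h

/-- β-reduction preserves the difference of the numbers of upper and lower occurrences. -/
theorem Term.BetaStep.count {t t' : Term V T} (h : BetaStep t t') (k : V) :
    t.up.count k + t'.lo.count k = t'.up.count k + t.lo.count k := by
  cases h <;> simp [Term.up, Term.lo, Gen.up, Gen.lo, Multiset.count_cons] <;> omega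

theorem Term.BetaEq.count {t t' : Term V T} (h : t.BetaEq t') (k : V) :
    t.up.count k + t'.lo.count k = t'.up.count k + t.lo.count k := by
  induction h with
  | rel _ _ h => exact h.count k
  | refl => rfl
  | symm _ _ _ ih => omega
  | trans _ _ _ _ _ ih₁ ih₂ => omega

/-- Potentials: functions on indices that grow along every edge by the length of its label. -/
def Gen.Fits (f : V → ℤ) : Gen V T → Prop
  | .reg x i j => f j = f i + x.length
  | .sing x => x.length = 0
  | .var _ => True

/-- A potential with prescribed values at `l` and `r`. -/
def Term.Fits (l r : V) (a b : ℤ) (t : Term V T) : Prop :=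
  ∃ f : V → ℤ, f l = a ∧ f r = b ∧ ∀ g ∈ t, g.Fits f

theorem Gen.Fits.congr {f f' : V → ℤ} {g : Gen V T} (h : g.Fits f)
    (hff : ∀ k, k ∈ g.up ∨ k ∈ g.lo → f' k = f k) : g.Fits f' := by
  cases g with
  | reg x i j =>
    have hi := hff i (by simp [Gen.lo])
    have hj := hff j (by simp [Gen.up])
    simp only [Gen.Fits] at h ⊢
    rw [hi, hj, h]
  | sing x => exact h
  | var X => trivial

theorem Term.BetaStep.fits_iff {t t' : Term V T} (h : BetaStep t t') {l r : V} {a b : ℤ}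
    (hl : t.up.count l ≠ t.lo.count l) (hr : t.up.count r ≠ t.lo.count r) :
    t.Fits l r a b ↔ t'.Fits l r a b := by
  cases h with
  | contract x y i j k s hs =>
    have hu := hs.1
    have hw := hs.2.1
    simp only [Term.up, Term.lo, Multiset.cons_bind, Gen.up, Gen.lo, Multiset.singleton_add,
      Multiset.nodup_cons, Multiset.mem_cons] at hu hw hl hr
    have hus : ∀ g ∈ s, j ∉ g.up := fun g hg hj =>
      hu.1 (Or.inr (Multiset.mem_bind.2 ⟨g, hg, hj⟩))
    have hws : ∀ g ∈ s, j ∉ g.lo := fun g hg hj =>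
      hw.2.1 (Multiset.mem_bind.2 ⟨g, hg, hj⟩)
    have hij : i ≠ j := fun h => hw.1 (Or.inl h)
    have hkj : k ≠ j := fun h => hu.1 (Or.inl h.symm)
    have hju : j ∉ s.bind Gen.up := fun h => hu.1 (Or.inr h)
    have hjl : j ∉ s.bind Gen.lo := hw.2.1
    have hlj : l ≠ j := by
      rintro rfl
      apply hl
      rw [Multiset.count_cons_self, Multiset.count_cons_of_ne hkj.symm,
        Multiset.count_cons_of_ne hij.symm, Multiset.count_cons_self,
        Multiset.count_eq_zero_of_notMem hju, Multiset.count_eq_zero_of_notMem hjl]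
    have hrj : r ≠ j := by
      rintro rfl
      apply hr
      rw [Multiset.count_cons_self, Multiset.count_cons_of_ne hkj.symm,
        Multiset.count_cons_of_ne hij.symm, Multiset.count_cons_self,
        Multiset.count_eq_zero_of_notMem hju, Multiset.count_eq_zero_of_notMem hjl]
    constructor
    · rintro ⟨f, h1, h2, h3⟩
      refine ⟨f, h1, h2, ?_⟩
      simp only [Multiset.mem_cons, forall_eq_or_imp, Gen.Fits] at h3 ⊢
      refine ⟨?_, h3.2.2⟩
      rw [h3.2.1, h3.1]
      push_cast [List.length_append]
      ring
    · rintro ⟨f, h1, h2, h3⟩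
      simp only [Multiset.mem_cons, forall_eq_or_imp, Gen.Fits] at h3
      refine ⟨Function.update f j (f i + x.length), ?_, ?_, ?_⟩
      · rw [Function.update_of_ne hlj, h1]
      · rw [Function.update_of_ne hrj, h2]
      · simp only [Multiset.mem_cons, forall_eq_or_imp, Gen.Fits, Function.update_self,
          Function.update_of_ne hij, Function.update_of_ne hkj]
        refine ⟨trivial, ?_, fun g hg => Gen.Fits.congr (h3.2 g hg) fun m hm => ?_⟩
        · rw [h3.1]
          push_cast [List.length_append]
          ring
        · refine Function.update_of_ne ?_ _ _
          rintro rfl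
          exact hm.elim (hus g hg) (hws g hg)
  | loop x i s hs => simp [Term.Fits, Gen.Fits]
  | empty s hs => simp [Term.Fits, Gen.Fits]
  | rotate x a s hs => simp [Term.Fits, Gen.Fits]

theorem Term.BetaEq.fits_iff {t t' : Term V T} (h : t.BetaEq t') {l r : V} {a b : ℤ}
    (hl : t.up.count l ≠ t.lo.count l) (hr : t.up.count r ≠ t.lo.count r) :
    t.Fits l r a b ↔ t'.Fits l r a b := by
  induction h with
  | rel _ _ h => exact h.fits_iff hl hr
  | refl => rfl
  | symm x y h ih =>
    have h1 := Term.BetaEq.count h l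
    have h2 := Term.BetaEq.count h r
    exact (ih (by omega) (by omega)).symm
  | trans x y z h₁ h₂ ih₁ ih₂ =>
    have h1 := Term.BetaEq.count h₁ l
    have h2 := Term.BetaEq.count h₁ r
    exact (ih₁ hl hr).trans (ih₂ (by omega) (by omega))

theorem Term.isBetaReduced_single {x : List T} {l r : V} (hlr : l ≠ r) :
    IsBetaReduced ({Gen.reg x l r} : Term V T) := by
  refine ⟨Term.isTerm_single x l r, ?_⟩
  rintro i ⟨h1, h2⟩
  simp only [Term.up, Term.lo, Multiset.singleton_bind, Gen.up, Gen.lo,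
    Multiset.mem_singleton] at h1 h2
  exact hlr (h2.symm.trans h1)

theorem Term.isLexical_single {x : List T} (hx : x ≠ []) {l r : V} (hlr : l ≠ r) :
    IsLexical ({Gen.reg x l r} : Term V T) := by
  refine ⟨Term.isTerm_single x l r, ⟨_, Relation.EqvGen.refl _, Term.isBetaReduced_single hlr, ?_⟩,
    by simp, ?_⟩
  · intro g hg
    exact ⟨x, l, r, Multiset.mem_singleton.1 hg⟩
  · rintro ⟨i, j, t', hi, hj, h⟩
    have hi' : i = r := by simpa [Term.up, Gen.up] using hi.1
    have hj' : j = l := by simpa [Term.lo, Gen.lo] using hj.1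
    subst hi' hj'
    have key := h.fits_iff (l := j) (r := i) (a := 0) (b := x.length)
      (by simp [Term.up, Term.lo, Gen.up, Gen.lo, hlr])
      (by simp [Term.up, Term.lo, Gen.up, Gen.lo, hlr.symm])
    have h0 : Term.Fits j i 0 x.length ({Gen.reg x j i} : Term V T) :=
      ⟨fun k => if k = j then 0 else x.length, by simp, by simp [hlr.symm], by
        simp [Gen.Fits, hlr.symm]⟩
    obtain ⟨f, h1, h2, h3⟩ := key.1 h0
    have h4 := h3 _ (Multiset.mem_cons_self _ _)
    simp only [Gen.delta, Gen.Fits, List.length_nil] at h4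
    rw [h1, h2] at h4
    have : x.length = 0 := by exact_mod_cast (by simpa using h4 : (x.length : ℤ) = 0)
    exact hx (List.length_eq_zero_iff.1 this)

theorem isTyping_entry {l r : V} {e : List T × Fm L V 0} (he : IsLexEntry l r e)
    (hwf : e.2.LingWF ∧ e.2.countL (.inl l) = 1 ∧ e.2.countR (.inl r) = 1) :
    l ≠ r ∧ IsTyping ({Gen.reg e.1 l r} : Term V T) e.2.toTensor := by
  obtain ⟨-, -, hl, hr, hfree⟩ := he
  obtain ⟨⟨hm, hle⟩, hl1, hr1⟩ := hwf
  have hl0 : e.2.countR (.inl l) = 0 := by omega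
  have hr0 : e.2.countL (.inl r) = 0 := by omega
  have hlr : l ≠ r := by rintro rfl; omega
  have hup : e.2.toTensor.FIup = {l} := by
    ext k
    simp only [TFm.FIup, Fm.countUp_toTensor, Set.mem_ofPred_eq, Set.mem_singleton_iff]
    refine ⟨fun h => ?_, fun h => by subst h; omega⟩
    rcases hfree k (Fm.occurs_of_countL _ _ h) with h' | h'
    · exact h'
    · subst h'; omega
  have hlo : e.2.toTensor.FIlo = {r} := by
    ext k
    simp only [TFm.FIlo, Fm.countLo_toTensor, Set.mem_ofPred_eq, Set.mem_singleton_iff]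
    refine ⟨fun h => ?_, fun h => by subst h; omega⟩
    rcases hfree k (Fm.occurs_of_countR _ _ h) with h' | h'
    · subst h'; omega
    · exact h'
  have hps : e.2.toTensor.IsPseudotype := by
    refine ⟨Fm.bindersOK_toTensor _ hm, fun i => ?_⟩
    rw [Fm.countUp_toTensor, Fm.countLo_toTensor]
    exact hle i
  refine ⟨hlr, ⟨Term.isTerm_single _ _ _, hps, ?_, ?_, ?_⟩, hps, ?_⟩
  · rw [hup]; simp [Term.up, Gen.up, hlr.symm]
  · rw [hlo]; simp [Term.lo, Gen.lo, hlr]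
  · rw [hup, hlo]
    ext k
    simp only [Term.FIup, Term.FIlo, Term.up, Term.lo, Multiset.singleton_bind, Gen.up, Gen.lo,
      Multiset.mem_singleton, Set.mem_union, Set.mem_ofPred_eq, Set.mem_singleton_iff]
    tauto
  · rw [hup, hlo]; simpa using hlr

end Facts

/-- The tensor translation of a well-formed grammar: the lexical entries are
`[x]^r_l : ‖A‖` for the entries `(x, A)` of the given grammar. -/
def MILLGrammar.tensorTranslation {L : Language.{u}} {V : Type v} {T : Type w} [DecidableEq V]
    {l r : V} (G : MILLGrammar L V T l r) (hG : G.WellFormed) : TensorGrammar L V T where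
  lex := (fun e => ({Gen.reg e.1 l r}, e.2.toTensor)) '' G.lex
  lex_finite := G.lex_finite.image _
  lex_entry := by
    rintro _ ⟨e, he, rfl⟩
    obtain ⟨hlr, ht⟩ := isTyping_entry (G.lex_entry e he) (hG.lex_wf e he)
    exact ⟨ht, Term.isBetaReduced_single hlr, Term.isLexical_single (G.lex_entry e he).1 hlr⟩
  start := G.start
  start_valency := hG.start_valency

end LinGram

namespace LinGram

universe u v w

/-! Everything rests on one reading of tensor expressions. An assignment `f` of variables to indices
turns a tensor formula `A` into the first order formula `A.ev f`, upper indices filling left places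
and lower indices right places. A generator `[w]_i^j` is an edge from `i` to `j` labelled `w`; a
Kronecker delta is an edge with empty label and says that its two ends denote the same variable.

From first order logic to tensors: cut elimination for MLL1, proved semantically in the phase space
of cut-free provability, permits induction on cut-free proofs. By `prov_of_cutFree`, each lift of a
cut-free provable sequent to tensor formulas with pairwise different free indices is derivable with
a term that is a product of deltas, pairing the free upper indices of the sequent with the lower
ones and linking only indices of equal value under `f`. The eigenvariable condition forces the two
indices of a universal quantifier to be linked with each other, which is the premise of the `∇`
rule; for an existential quantifier the extra delta of the `△` rule is absorbed by β-reduction. In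
the sequent of a grammar every variable is the value of one upper and one lower index, so the deltas
are known exactly. Substituting the lexical entries gives a chain that β-reduces to the concatenated
word.

From tensors to first order logic: derivations are not normalized. Instead, the invariant `Sound` is
carried through all rules, including β-equivalence. The letters are tagged so as to be pairwise
different, and each gets a source and a target point; an assignment satisfies a term if the word on
each edge is a path between the values of its ends. The invariant says that any satisfying
assignment makes the lexical words used into paths, and the first order sequent provable from their
formulas taken at the end points of these words. Contracting an edge forgets the value of a bound
index and expanding recovers it by splitting a path, so β-equivalence does no harm. In the end a
single edge `[x]` remains. Its letters are laid out along a path without repeated points, and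
`exists_order` reads off from it the order of the entries and the distinct variables between them.
-/

section Basics

variable {L : Language.{u}} {V : Type v} {T : Type w}

/-! ### Slots and their renamings. -/

namespace Slot

theorem cases_weaken {n : ℕ} (x : Slot V (n + 1)) : x = .inr 0 ∨ ∃ y : Slot V n, x = y.weaken := by
  rcases x with x | i
  · exact Or.inr ⟨.inl x, rfl⟩
  · refine Fin.cases (Or.inl rfl) (fun k => Or.inr ⟨.inr k, rfl⟩) i

theorem weaken_injective {n : ℕ} : Function.Injective (Slot.weaken : Slot V n → Slot V (n + 1)) :=
  Sum.map_injective.2 ⟨Function.injective_id, Fin.succ_injective n⟩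

theorem weaken_ne {n : ℕ} (x : Slot V n) : x.weaken ≠ .inr 0 := by
  rcases x with x | i
  · exact Sum.inl_ne_inr
  · exact fun h => Fin.succ_ne_zero i (Sum.inr.inj h)

@[simp] theorem lift_weaken {n m : ℕ} (ρ : Slot V n → Slot V m) (x : Slot V n) :
    Slot.lift ρ x.weaken = (ρ x).weaken := by
  rcases x with x | i <;> rfl

@[simp] theorem lift_zero {n m : ℕ} (ρ : Slot V n → Slot V m) :
    Slot.lift ρ (.inr 0) = .inr 0 := rfl

@[simp] theorem inst_weaken {n : ℕ} (x : V) (y : Slot V n) : Slot.inst x y.weaken = y := by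
  rcases y with y | i <;> rfl

@[simp] theorem inst_zero {n : ℕ} (x : V) : (Slot.inst x (.inr 0) : Slot V n) = .inl x := rfl

@[simp] theorem map_inl {n : ℕ} (f : V → V) (x : V) :
    Slot.map f (.inl x : Slot V n) = .inl (f x) := rfl

@[simp] theorem map_inr {n : ℕ} (f : V → V) (k : Fin n) :
    Slot.map f (.inr k : Slot V n) = .inr k := rfl

theorem map_weaken {n : ℕ} (f : V → V) (x : Slot V n) :
    Slot.map f x.weaken = (Slot.map f x).weaken := by
  rcases x with x | i <;> rfl

theorem lift_id {n : ℕ} : Slot.lift (id : Slot V n → Slot V n) = id := by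
  funext x
  obtain rfl | ⟨y, rfl⟩ := cases_weaken x <;> simp

theorem lift_comp {n m k : ℕ} (τ : Slot V m → Slot V k) (ρ : Slot V n → Slot V m) :
    Slot.lift (τ ∘ ρ) = Slot.lift τ ∘ Slot.lift ρ := by
  funext x
  obtain rfl | ⟨y, rfl⟩ := cases_weaken x <;> simp

theorem lift_map {n : ℕ} (f : V → V) :
    Slot.lift (Slot.map f : Slot V n → Slot V n) = Slot.map f := by
  funext x
  obtain rfl | ⟨y, rfl⟩ := cases_weaken x <;> simp [map_weaken]

/-- Removing the innermost binder. -/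
def lower {n : ℕ} : Slot V (n + 1) → Option (Slot V n)
  | .inl x => some (.inl x)
  | .inr i => Fin.cases none (fun k => some (.inr k)) i

@[simp] theorem lower_weaken {n : ℕ} (x : Slot V n) : x.weaken.lower = some x := by
  rcases x with x | i <;> rfl

@[simp] theorem lower_zero {n : ℕ} : Slot.lower (.inr 0 : Slot V (n + 1)) = none := rfl

/-- The name in a slot that is below no binder. -/
def name : Slot V 0 → V
  | .inl x => x
  | .inr i => i.elim0

@[simp] theorem name_inl (x : V) : Slot.name (.inl x) = x := rfl

@[simp] theorem inl_name (x : Slot V 0) : (.inl x.name : Slot V 0) = x := by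
  rcases x with x | i
  · rfl
  · exact i.elim0

theorem name_injective : Function.Injective (Slot.name : Slot V 0 → V) := fun x y h => by
  rw [← inl_name x, ← inl_name y, h]

end Slot

/-! ### Renaming, duality and fresh variables in first order formulas. -/

namespace Fm

theorem rename_rename {n : ℕ} (A : Fm L V n) : ∀ {m k : ℕ} (ρ : Slot V n → Slot V m)
    (τ : Slot V m → Slot V k), (A.rename ρ).rename τ = A.rename (τ ∘ ρ) := by
  induction A <;> intro m k ρ τ <;> simp_all [rename, Slot.lift_comp]

theorem rename_id {n : ℕ} (A : Fm L V n) : A.rename id = A := by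
  induction A <;> simp_all [rename, Slot.lift_id]

theorem rename_dual {n : ℕ} (A : Fm L V n) : ∀ {m : ℕ} (ρ : Slot V n → Slot V m),
    A.dual.rename ρ = (A.rename ρ).dual := by
  induction A <;> intro m ρ <;> simp_all [rename, dual]

theorem rev_cast_rev_cast {k m : ℕ} (h : k = m) (h' : m = k) (i : Fin k) :
    Fin.rev (Fin.cast h' (Fin.rev (Fin.cast h i))) = i := by
  subst h
  simp

theorem dual_dual {n : ℕ} (A : Fm L V n) : A.dual.dual = A := by
  induction A <;> simp_all [dual, rev_cast_rev_cast]

theorem rename_congr {n : ℕ} (A : Fm L V n) : ∀ {m : ℕ} {ρ ρ' : Slot V n → Slot V m},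
    (∀ x, A.Occurs x → ρ x = ρ' x) → A.rename ρ = A.rename ρ' := by
  have key : ∀ {n m : ℕ} (A : Fm L V (n + 1)) {ρ ρ' : Slot V n → Slot V m},
      (∀ x : Slot V n, A.Occurs x.weaken → ρ x = ρ' x) →
      ∀ x, A.Occurs x → Slot.lift ρ x = Slot.lift ρ' x := by
    intro n m A ρ ρ' h x hx
    obtain rfl | ⟨y, rfl⟩ := Slot.cases_weaken x
    · rfl
    · simp [h y hx]
  induction A with
  | pos p e => intro m ρ ρ' h; exact congrArg _ (funext fun i => h _ ⟨i, rfl⟩)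
  | neg p e => intro m ρ ρ' h; exact congrArg _ (funext fun i => h _ ⟨i, rfl⟩)
  | tensor A B hA hB =>
    intro m ρ ρ' h
    exact congrArg₂ tensor (hA fun x hx => h x (Or.inl hx)) (hB fun x hx => h x (Or.inr hx))
  | par A B hA hB =>
    intro m ρ ρ' h
    exact congrArg₂ par (hA fun x hx => h x (Or.inl hx)) (hB fun x hx => h x (Or.inr hx))
  | all A hA => intro m ρ ρ' h; exact congrArg _ (hA (key A h))
  | ex A hA => intro m ρ ρ' h; exact congrArg _ (hA (key A h))

theorem inst_rename {n m : ℕ} (A : Fm L V (n + 1)) (ρ : Slot V n → Slot V m) (x : V) :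
    (A.rename (Slot.lift ρ)).inst x = A.rename (Slot.inst x ∘ Slot.lift ρ) :=
  rename_rename _ _ _

theorem inst_dual {n : ℕ} (A : Fm L V (n + 1)) (x : V) : A.dual.inst x = (A.inst x).dual :=
  rename_dual _ _

theorem finite_occurs {n : ℕ} (A : Fm L V n) : {x | A.Occurs x}.Finite := by
  induction A with
  | pos p e => exact Set.finite_range e
  | neg p e => exact Set.finite_range e
  | tensor A B hA hB => exact hA.union hB
  | par A B hA hB => exact hA.union hB
  | all A hA => exact hA.preimage Slot.weaken_injective.injOn
  | ex A hA => exact hA.preimage Slot.weaken_injective.injOn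

theorem exists_fresh [Infinite V] (Γ : Multiset (Fm L V 0)) (s : Set V) (hs : s.Finite) :
    ∃ x, x ∉ s ∧ ∀ A ∈ Γ, ¬ A.Occurs (.inl x) := by
  have : (s ∪ ⋃ A ∈ {A | A ∈ Γ}, {x | A.Occurs (.inl x)}).Finite := by
    refine hs.union (Set.Finite.biUnion ?_ fun A _ =>
      A.finite_occurs.preimage Sum.inl_injective.injOn)
    classical
    exact (Multiset.toFinset Γ).finite_toSet.subset fun A hA => by simpa using hA
  obtain ⟨x, hx⟩ := this.exists_notMem
  simp only [Set.mem_union, Set.mem_iUnion, not_or, not_exists] at hx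
  exact ⟨x, hx.1, fun A hA h => hx.2 A hA h⟩

end Fm

/-! ### Tensor formulas: multisets of indices, and evaluation to first order formulas. -/

namespace TFm

theorem rename_rename {n : ℕ} (A : TFm L V n) : ∀ {m k : ℕ} (ρ σ : Slot V n → Slot V m)
    (ρ' σ' : Slot V m → Slot V k),
    (A.rename ρ σ).rename ρ' σ' = A.rename (ρ' ∘ ρ) (σ' ∘ σ) := by
  induction A <;> intro m k ρ σ ρ' σ' <;> simp_all [rename, Slot.lift_comp]

theorem rename_dual {n : ℕ} (A : TFm L V n) : ∀ {m : ℕ} (ρ σ : Slot V n → Slot V m),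
    A.dual.rename ρ σ = (A.rename σ ρ).dual := by
  induction A <;> intro m ρ σ <;> simp_all [rename, dual]

theorem dual_dual {n : ℕ} (A : TFm L V n) : A.dual.dual = A := by
  induction A <;> simp_all [dual]

/-- The slots in upper position, with multiplicities. -/
def slotsUp : {n : ℕ} → TFm L V n → Multiset (Slot V n)
  | _, pos _ a _ => Finset.univ.val.map a
  | _, neg _ a _ => Finset.univ.val.map a
  | _, tensor A B => A.slotsUp + B.slotsUp
  | _, par A B => A.slotsUp + B.slotsUp
  | _, nabla A => A.slotsUp.filterMap Slot.lower
  | _, tri A => A.slotsUp.filterMap Slot.lower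

/-- The slots in lower position, with multiplicities. -/
def slotsLo {n : ℕ} (A : TFm L V n) : Multiset (Slot V n) := A.dual.slotsUp

theorem univ_map_rev {α : Type*} {n : ℕ} (a : Fin n → α) :
    (Finset.univ.val.map fun i : Fin n => a i.rev) = Finset.univ.val.map a := by
  have h : (Finset.univ : Finset (Fin n)).val.map Fin.rev = Finset.univ.val := by
    have := Finset.map_univ_equiv (Fin.revPerm (n := n))
    exact congrArg Finset.val this
  conv_rhs => rw [← h, Multiset.map_map]
  rfl

@[simp] theorem slotsLo_dual {n : ℕ} (A : TFm L V n) : A.dual.slotsLo = A.slotsUp := by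
  rw [slotsLo, dual_dual]

@[simp] theorem slotsLo_tensor {n : ℕ} (A B : TFm L V n) :
    (tensor A B).slotsLo = A.slotsLo + B.slotsLo := add_comm _ _

@[simp] theorem slotsLo_par {n : ℕ} (A B : TFm L V n) :
    (par A B).slotsLo = A.slotsLo + B.slotsLo := add_comm _ _

/-- A lifted renaming fixes the bound slot and commutes with weakening, so it passes through the
removal of the binder. -/
theorem filterMap_lower_map_lift {n m : ℕ} (ρ : Slot V n → Slot V m)
    (S : Multiset (Slot V (n + 1))) :
    (S.map (Slot.lift ρ)).filterMap Slot.lower = (S.filterMap Slot.lower).map ρ := by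
  rw [Multiset.filterMap_map, Multiset.map_filterMap]
  congr 1
  funext x
  obtain rfl | ⟨y, rfl⟩ := Slot.cases_weaken x
  · rfl
  · simp

theorem slotsUp_rename {n : ℕ} (A : TFm L V n) : ∀ {m : ℕ} (ρ σ : Slot V n → Slot V m),
    (A.rename ρ σ).slotsUp = A.slotsUp.map ρ := by
  induction A <;> intro m ρ σ <;> simp_all [rename, slotsUp, filterMap_lower_map_lift] <;> rfl

theorem slotsLo_rename {n : ℕ} (A : TFm L V n) {m : ℕ} (ρ σ : Slot V n → Slot V m) :
    (A.rename ρ σ).slotsLo = A.slotsLo.map σ := by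
  rw [slotsLo, ← rename_dual, slotsUp_rename, slotsLo]

theorem mem_filterMap_lower {n : ℕ} (S : Multiset (Slot V (n + 1))) (y : Slot V n) :
    y ∈ S.filterMap Slot.lower ↔ y.weaken ∈ S := by
  rw [Multiset.mem_filterMap]
  constructor
  · rintro ⟨x, hx, h⟩
    obtain rfl | ⟨z, rfl⟩ := Slot.cases_weaken x
    · exact absurd h (by simp)
    · simp only [Slot.lower_weaken, Option.some.injEq] at h
      exact h ▸ hx
  · exact fun h => ⟨_, h, by simp⟩

/-- Agreement is required only on the slots that occur in the position concerned. This matters where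
the upper and the lower renaming differ but become equal after evaluation. -/
theorem rename_congr {n : ℕ} (A : TFm L V n) : ∀ {m : ℕ} {ρ ρ' σ σ' : Slot V n → Slot V m},
    (∀ x ∈ A.slotsUp, ρ x = ρ' x) → (∀ x ∈ A.slotsLo, σ x = σ' x) →
    A.rename ρ σ = A.rename ρ' σ' := by
  have key : ∀ {n m : ℕ} (S : Multiset (Slot V (n + 1))) {ρ ρ' : Slot V n → Slot V m},
      (∀ x ∈ S.filterMap Slot.lower, ρ x = ρ' x) → ∀ x ∈ S, Slot.lift ρ x = Slot.lift ρ' x := by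
    intro n m S ρ ρ' h x hx
    obtain rfl | ⟨y, rfl⟩ := Slot.cases_weaken x
    · rfl
    · simp [h y ((mem_filterMap_lower _ _).2 hx)]
  induction A with
  | pos p a b =>
    intro m ρ ρ' σ σ' h1 h2
    refine congrArg₂ _ (funext fun i => h1 _ ?_) (funext fun i => h2 _ ?_)
    · exact Multiset.mem_map_of_mem _ (Finset.mem_univ i)
    · rw [slotsLo, dual, slotsUp, univ_map_rev]
      exact Multiset.mem_map_of_mem _ (Finset.mem_univ i)
  | neg p a b =>
    intro m ρ ρ' σ σ' h1 h2
    refine congrArg₂ _ (funext fun i => h1 _ ?_) (funext fun i => h2 _ ?_)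
    · exact Multiset.mem_map_of_mem _ (Finset.mem_univ i)
    · rw [slotsLo, dual, slotsUp, univ_map_rev]
      exact Multiset.mem_map_of_mem _ (Finset.mem_univ i)
  | tensor A B hA hB =>
    intro m ρ ρ' σ σ' h1 h2
    simp only [slotsUp, slotsLo_tensor, Multiset.mem_add] at h1 h2
    exact congrArg₂ _ (hA (fun x hx => h1 x (Or.inl hx)) fun x hx => h2 x (Or.inl hx))
      (hB (fun x hx => h1 x (Or.inr hx)) fun x hx => h2 x (Or.inr hx))
  | par A B hA hB =>
    intro m ρ ρ' σ σ' h1 h2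
    simp only [slotsUp, slotsLo_par, Multiset.mem_add] at h1 h2
    exact congrArg₂ _ (hA (fun x hx => h1 x (Or.inl hx)) fun x hx => h2 x (Or.inl hx))
      (hB (fun x hx => h1 x (Or.inr hx)) fun x hx => h2 x (Or.inr hx))
  | nabla A hA => intro m ρ ρ' σ σ' h1 h2; exact congrArg _ (hA (key _ h1) (key _ h2))
  | tri A hA => intro m ρ ρ' σ σ' h1 h2; exact congrArg _ (hA (key _ h1) (key _ h2))

/-- The free upper indices, with multiplicities. -/
def ups (A : TFm L V 0) : Multiset V := A.slotsUp.map Slot.name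

/-- The free lower indices, with multiplicities. -/
def los (A : TFm L V 0) : Multiset V := A.slotsLo.map Slot.name

@[simp] theorem ups_dual (A : TFm L V 0) : A.dual.ups = A.los := rfl

@[simp] theorem los_dual (A : TFm L V 0) : A.dual.los = A.ups := by simp [los, ups]

@[simp] theorem ups_tensor (A B : TFm L V 0) : (tensor A B).ups = A.ups + B.ups := by
  simp [ups, slotsUp]

@[simp] theorem ups_par (A B : TFm L V 0) : (par A B).ups = A.ups + B.ups := by
  simp [ups, slotsUp]

@[simp] theorem los_tensor (A B : TFm L V 0) : (tensor A B).los = A.los + B.los := by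
  simp [los]

@[simp] theorem los_par (A B : TFm L V 0) : (par A B).los = A.los + B.los := by
  simp [los]

/-- Both operators bind in the same way, so the bookkeeping of indices is stated for `nabla` only
and holds for `tri` by unfolding; the same goes for `BindersOK`. -/
theorem ups_tri (A : TFm L V 1) : (tri A).ups = (nabla A).ups := rfl

theorem los_tri (A : TFm L V 1) : (tri A).los = (nabla A).los := rfl

theorem ups_rename (A : TFm L V 0) (f : V → V) (σ : Slot V 0 → Slot V 0) :
    (A.rename (Slot.map f) σ).ups = A.ups.map f := by
  rw [ups, slotsUp_rename, ups, Multiset.map_map, Multiset.map_map]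
  refine Multiset.map_congr rfl fun x _ => ?_
  rw [← Slot.inl_name x]
  rfl

theorem los_rename (A : TFm L V 0) (f : V → V) (ρ : Slot V 0 → Slot V 0) :
    (A.rename ρ (Slot.map f)).los = A.los.map f := by
  rw [los, slotsLo_rename, los, Multiset.map_map, Multiset.map_map]
  refine Multiset.map_congr rfl fun x _ => ?_
  rw [← Slot.inl_name x]
  rfl

theorem ups_substLo [DecidableEq V] (A : TFm L V 0) (i j : V) : (A.substLo i j).ups = A.ups := by
  rw [substLo, ups, slotsUp_rename, Multiset.map_id, ups]

theorem los_substUp [DecidableEq V] (A : TFm L V 0) (i j : V) : (A.substUp i j).los = A.los := by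
  rw [substUp, los, slotsLo_rename, Multiset.map_id, los]

theorem mem_ups {A : TFm L V 0} {i : V} : i ∈ A.ups ↔ .inl i ∈ A.slotsUp := by
  rw [ups, Multiset.mem_map]
  constructor
  · rintro ⟨x, hx, rfl⟩; simpa using hx
  · exact fun h => ⟨_, h, rfl⟩

theorem mem_los {A : TFm L V 0} {i : V} : i ∈ A.los ↔ .inl i ∈ A.slotsLo := mem_ups (A := A.dual)

theorem mem_ups_quant {A : TFm L V 1} {i : V} : i ∈ (nabla A).ups ↔ .inl i ∈ A.slotsUp :=
  mem_ups.trans (mem_filterMap_lower _ _)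

theorem mem_los_quant {A : TFm L V 1} {i : V} : i ∈ (nabla A).los ↔ .inl i ∈ A.slotsLo :=
  mem_ups_quant (A := A.dual)

section Count

variable [DecidableEq V]

theorem count_filterMap_lower {n : ℕ} (S : Multiset (Slot V (n + 1))) (y : Slot V n) :
    (S.filterMap Slot.lower).count y = S.count y.weaken := by
  induction S using Multiset.induction_on with
  | empty => simp
  | cons x S ih =>
    obtain rfl | ⟨z, rfl⟩ := Slot.cases_weaken x
    · rw [Multiset.filterMap_cons_none _ _ Slot.lower_zero, ih,
        Multiset.count_cons_of_ne (Slot.weaken_ne y)]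
    · rw [Multiset.filterMap_cons_some _ _ _ (Slot.lower_weaken z), Multiset.count_cons, ih,
        Multiset.count_cons]
      simp [Slot.weaken_injective.eq_iff]

theorem count_univ_map {α : Type*} [DecidableEq α] {n : ℕ} (a : Fin n → α) (x : α) :
    (Finset.univ.val.map a).count x = (Finset.univ.filter fun i => a i = x).card := by
  rw [Multiset.count_map]
  simp only [eq_comm]
  rfl

theorem count_slotsUp {n : ℕ} (A : TFm L V n) (x : Slot V n) :
    A.slotsUp.count x = A.countUp x := by
  induction A with
  | pos p a b => exact count_univ_map _ _
  | neg p a b => exact count_univ_map _ _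
  | tensor A B hA hB => simp [slotsUp, countUp, hA, hB]
  | par A B hA hB => simp [slotsUp, countUp, hA, hB]
  | nabla A hA => simp [slotsUp, countUp, count_filterMap_lower, hA]
  | tri A hA => simp [slotsUp, countUp, count_filterMap_lower, hA]

theorem countUp_dual {n : ℕ} (A : TFm L V n) (x : Slot V n) : A.dual.countUp x = A.countLo x := by
  induction A with
  | pos p a b => simp only [dual, countUp, countLo]; rw [← count_univ_map, ← count_univ_map, univ_map_rev]
  | neg p a b => simp only [dual, countUp, countLo]; rw [← count_univ_map, ← count_univ_map, univ_map_rev]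
  | tensor A B hA hB => simp [dual, countUp, countLo, hA, hB, add_comm]
  | par A B hA hB => simp [dual, countUp, countLo, hA, hB, add_comm]
  | nabla A hA => exact hA _
  | tri A hA => exact hA _

theorem countLo_dual {n : ℕ} (A : TFm L V n) (x : Slot V n) : A.dual.countLo x = A.countUp x := by
  rw [← countUp_dual, dual_dual]

theorem count_slotsLo {n : ℕ} (A : TFm L V n) (x : Slot V n) :
    A.slotsLo.count x = A.countLo x := by
  rw [slotsLo, count_slotsUp, countUp_dual]

theorem count_ups (A : TFm L V 0) (i : V) : A.ups.count i = A.countUp (.inl i) := by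
  rw [← count_slotsUp, ups, ← Multiset.count_map_eq_count' _ _ Slot.name_injective]
  rfl

theorem count_los (A : TFm L V 0) (i : V) : A.los.count i = A.countLo (.inl i) := by
  rw [← countUp_dual, ← count_ups, ups_dual]

theorem mem_FIup {A : TFm L V 0} {i : V} : i ∈ A.FIup ↔ i ∈ A.ups := by
  rw [← Multiset.count_pos, count_ups]; rfl

theorem mem_FIlo {A : TFm L V 0} {i : V} : i ∈ A.FIlo ↔ i ∈ A.los := by
  rw [← Multiset.count_pos, count_los]; rfl

theorem bindersOK_dual {n : ℕ} (A : TFm L V n) : A.dual.BindersOK ↔ A.BindersOK := by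
  induction A <;>
    simp_all [dual, BindersOK, countUp_dual, countLo_dual, and_comm]

theorem bindersOK_rename {n : ℕ} (A : TFm L V n) : ∀ {m : ℕ} (ρ σ : Slot V n → Slot V m),
    (A.rename ρ σ).BindersOK ↔ A.BindersOK := by
  have key : ∀ {n m : ℕ} (S : Multiset (Slot V (n + 1))) (ρ : Slot V n → Slot V m),
      (S.map (Slot.lift ρ)).count (.inr 0) = S.count (.inr 0) := by
    intro n m S ρ
    induction S using Multiset.induction_on with
    | empty => simp
    | cons x S ih =>
      obtain rfl | ⟨z, rfl⟩ := Slot.cases_weaken x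
      · simp [ih]
      · rw [Multiset.map_cons, Slot.lift_weaken, Multiset.count_cons_of_ne (Slot.weaken_ne _).symm,
          ih, Multiset.count_cons_of_ne (Slot.weaken_ne _).symm]
  induction A <;> intro m ρ σ <;>
    simp_all [rename, BindersOK, ← count_slotsUp, ← count_slotsLo, slotsUp_rename, slotsLo_rename]

/-- The only occurrence of the bound slot contributes `ν`; the other slots survive the removal of
the binder unchanged. -/
theorem slots_map_inst (S : Multiset (Slot V 1)) (h : S.count (.inr 0) = 1) (ν : V) :
    (S.map (Slot.inst ν)).map Slot.name = ν ::ₘ (S.filterMap Slot.lower).map Slot.name := by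
  -- The condition that the bound slot occurs exactly once is not inherited by smaller multisets, so
  -- the induction is run with an arbitrary number of copies.
  have aux : ∀ S : Multiset (Slot V 1), (S.map (Slot.inst ν)).map Slot.name =
      Multiset.replicate (S.count (.inr 0)) ν + (S.filterMap Slot.lower).map Slot.name := by
    intro S
    induction S using Multiset.induction_on with
    | empty => simp
    | cons x S ih =>
      obtain rfl | ⟨z, rfl⟩ := Slot.cases_weaken x
      · rw [Multiset.filterMap_cons_none _ _ Slot.lower_zero]
        simp [ih, Multiset.replicate_succ]
      · rw [Multiset.map_cons, Multiset.map_cons, ih, Slot.inst_weaken,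
          Multiset.count_cons_of_ne (Slot.weaken_ne _).symm,
          Multiset.filterMap_cons_some _ _ _ (Slot.lower_weaken z), Multiset.map_cons,
          Multiset.add_cons]
  rw [aux, h]
  simp

theorem ups_inst {A : TFm L V 1} (h : (nabla A).BindersOK) (ν μ : V) :
    (A.inst ν μ).ups = ν ::ₘ (nabla A).ups := by
  rw [ups, inst, slotsUp_rename]
  exact slots_map_inst _ (by rw [count_slotsUp]; exact h.2.1) ν

theorem los_inst {A : TFm L V 1} (h : (nabla A).BindersOK) (ν μ : V) :
    (A.inst ν μ).los = μ ::ₘ (nabla A).los := by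
  rw [los, inst, slotsLo_rename]
  exact slots_map_inst _ (by rw [count_slotsLo]; exact h.2.2) μ

theorem bindersOK_inst {A : TFm L V 1} (h : (nabla A).BindersOK) (ν μ : V) :
    (A.inst ν μ).BindersOK := (bindersOK_rename _ _ _).2 h.1

theorem isPseudotype_iff {A : TFm L V 0} :
    A.IsPseudotype ↔ A.BindersOK ∧ A.ups.Nodup ∧ A.los.Nodup := by
  simp only [IsPseudotype, Multiset.nodup_iff_count_le_one, count_ups, count_los, forall_and]

/-- One duplicate-freeness condition encodes linearity in each position together with disjointness
of the two positions. From here on well-formedness is arithmetic of multisets. -/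
theorem isType_iff {A : TFm L V 0} : A.IsType ↔ A.BindersOK ∧ (A.ups + A.los).Nodup := by
  rw [IsType, isPseudotype_iff, Multiset.nodup_add, Set.disjoint_left, Multiset.disjoint_left]
  simp only [mem_FIup, mem_FIlo]
  tauto

end Count

/-- The first order formula with left for upper and right for lower indices. -/
def toFm : {n : ℕ} → TFm L V n → Fm L V n
  | _, pos p a b => .pos p (Fin.append a b)
  | _, neg p a b => .neg p (Fin.append a b)
  | _, tensor A B => .tensor A.toFm B.toFm
  | _, par A B => .par A.toFm B.toFm
  | _, nabla A => .all A.toFm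
  | _, tri A => .ex A.toFm

/-- Reversing two lists and exchanging them amounts to reversing their concatenation. This is why
tensor duality and linear negation agree on literals. -/
theorem append_rev {α : Type*} {k m : ℕ} (a : Fin k → α) (b : Fin m → α) :
    Fin.append (fun i => b i.rev) (fun i => a i.rev) =
      fun i => Fin.append a b (Fin.rev (Fin.cast (Nat.add_comm m k) i)) := by
  funext i
  refine Fin.addCases (fun i => ?_) (fun i => ?_) i
  · rw [Fin.append_left]
    have : Fin.rev (Fin.cast (Nat.add_comm m k) (Fin.castAdd k i)) = Fin.natAdd k i.rev := by
      ext; simp; omega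
    rw [this, Fin.append_right]
  · rw [Fin.append_right]
    have : Fin.rev (Fin.cast (Nat.add_comm m k) (Fin.natAdd m i)) = Fin.castAdd m i.rev := by
      ext; simp; omega
    rw [this, Fin.append_left]

theorem toFm_dual {n : ℕ} (A : TFm L V n) : A.dual.toFm = A.toFm.dual := by
  induction A with
  | pos p a b => simp only [dual, toFm, Fm.dual, append_rev]
  | neg p a b => simp only [dual, toFm, Fm.dual, append_rev]
  | tensor A B hA hB => simp [dual, toFm, Fm.dual, hA, hB]
  | par A B hA hB => simp [dual, toFm, Fm.dual, hA, hB]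
  | nabla A hA => simp [dual, toFm, Fm.dual, hA]
  | tri A hA => simp [dual, toFm, Fm.dual, hA]

theorem append_comp {α β : Type*} {k m : ℕ} (g : α → β) (a : Fin k → α) (b : Fin m → α) :
    Fin.append (fun i => g (a i)) (fun i => g (b i)) = fun i => g (Fin.append a b i) := by
  funext i
  refine Fin.addCases (fun i => ?_) (fun i => ?_) i <;> simp

theorem toFm_rename {n : ℕ} (A : TFm L V n) : ∀ {m : ℕ} (ρ : Slot V n → Slot V m),
    (A.rename ρ ρ).toFm = A.toFm.rename ρ := by
  induction A <;> intro m ρ <;> simp_all [rename, toFm, Fm.rename, append_comp]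

theorem toFm_toTensor {n : ℕ} (A : Fm L V n) : A.toTensor.toFm = A := by
  induction A <;> simp_all [Fm.toTensor, toFm, Fin.append_castAdd_natAdd]

/-- The first order formula in which the free index `i` becomes the variable `f i`. -/
def ev (f : V → V) {n : ℕ} (A : TFm L V n) : Fm L V n := A.toFm.rename (Slot.map f)

theorem ev_eq (f : V → V) {n : ℕ} (A : TFm L V n) :
    A.ev f = (A.rename (Slot.map f) (Slot.map f)).toFm := (toFm_rename _ _).symm

@[simp] theorem ev_par (f : V → V) {n : ℕ} (A B : TFm L V n) :
    (par A B).ev f = .par (A.ev f) (B.ev f) := rfl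

@[simp] theorem ev_nabla (f : V → V) {n : ℕ} (A : TFm L V (n + 1)) :
    (nabla A).ev f = .all (A.ev f) := by
  simp [ev, toFm, Fm.rename, Slot.lift_map]

@[simp] theorem ev_tri (f : V → V) {n : ℕ} (A : TFm L V (n + 1)) :
    (tri A).ev f = .ex (A.ev f) := by
  simp [ev, toFm, Fm.rename, Slot.lift_map]

@[simp] theorem ev_dual (f : V → V) {n : ℕ} (A : TFm L V n) : A.dual.ev f = (A.ev f).dual := by
  rw [ev, toFm_dual, Fm.rename_dual, ev]

/-- Upper and lower indices may be renamed differently, as long as `f` identifies the results;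
evaluation then sees one renaming of the underlying first order formula. -/
theorem ev_rename (f : V → V) {n m : ℕ} (A : TFm L V n) {ρ σ ρ' : Slot V n → Slot V m}
    (hρ : ∀ x ∈ A.slotsUp, Slot.map f (ρ x) = ρ' x)
    (hσ : ∀ x ∈ A.slotsLo, Slot.map f (σ x) = ρ' x) : (A.rename ρ σ).ev f = A.toFm.rename ρ' := by
  rw [ev_eq, rename_rename, ← toFm_rename]
  exact congrArg _ (rename_congr _ hρ hσ)

theorem ev_congr {f f' : V → V} (A : TFm L V 0) (h : ∀ i ∈ A.ups, f i = f' i)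
    (h' : ∀ i ∈ A.los, f i = f' i) : A.ev f = A.ev f' := by
  rw [ev_eq, ev_eq]
  refine congrArg _ (rename_congr _ (fun x hx => ?_) fun x hx => ?_)
  · rw [← Slot.inl_name x] at hx ⊢
    exact congrArg Sum.inl (h _ (mem_ups.2 hx))
  · rw [← Slot.inl_name x] at hx ⊢
    exact congrArg Sum.inl (h' _ (mem_los.2 hx))

/-- The two indices of a binding operator stand for one bound variable, so instantiation in the
tensor formula corresponds to instantiation by `x` exactly when both receive the value `x`. -/
theorem ev_inst {f f' : V → V} {ν μ x : V} (A : TFm L V 1) (hν : f' ν = x) (hμ : f' μ = x)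
    (h : ∀ i ∈ (nabla A).ups, f' i = f i) (h' : ∀ i ∈ (nabla A).los, f' i = f i) :
    (A.inst ν μ).ev f' = (A.ev f).inst x := by
  rw [inst, Fm.inst, ev.eq_def f A, Fm.rename_rename]
  refine ev_rename _ _ (fun y hy => ?_) fun y hy => ?_
  · obtain rfl | ⟨z, rfl⟩ := Slot.cases_weaken y
    · simp [hν]
    · rw [← Slot.inl_name z] at hy ⊢
      exact congrArg Sum.inl (h _ (mem_ups_quant.2 hy))
  · obtain rfl | ⟨z, rfl⟩ := Slot.cases_weaken y
    · simp [hμ]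
    · rw [← Slot.inl_name z] at hy ⊢
      exact congrArg Sum.inl (h' _ (mem_los_quant.2 hy))

/-- This is the first order content of the η rules: a delta expresses that its ends have equal
values, and under such an `f` the replacement is invisible. -/
theorem ev_substUp [DecidableEq V] {f : V → V} {i j : V} (A : TFm L V 0) (h : f j = f i) :
    (A.substUp i j).ev f = A.ev f := by
  rw [ev, substUp]
  refine ev_rename _ _ (fun y _ => ?_) fun y _ => rfl
  rw [← Slot.inl_name y]
  by_cases hy : y.name = i <;> simp only [Slot.map_inl, hy, h, if_true, if_false]

theorem ev_substLo [DecidableEq V] {f : V → V} {i j : V} (A : TFm L V 0) (h : f j = f i) :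
    (A.substLo i j).ev f = A.ev f := by
  rw [ev, substLo]
  refine ev_rename _ _ (fun y _ => rfl) fun y _ => ?_
  rw [← Slot.inl_name y]
  by_cases hy : y.name = i <;> simp only [Slot.map_inl, hy, h, if_true, if_false]

theorem occurs_toFm {n : ℕ} (A : TFm L V n) : ∀ x, A.toFm.Occurs x ↔
    x ∈ A.slotsUp ∨ x ∈ A.slotsLo := by
  have aux : ∀ {k m n : ℕ} (a : Fin k → Slot V n) (b : Fin m → Slot V n) (x : Slot V n),
      (∃ i, Fin.append a b i = x) ↔ (x ∈ Finset.univ.val.map a ∨ x ∈ Finset.univ.val.map b) := by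
    intro k m n a b x
    simp only [Multiset.mem_map, Finset.mem_val, Finset.mem_univ, true_and]
    constructor
    · rintro ⟨i, rfl⟩
      refine Fin.addCases (fun i => ?_) (fun i => ?_) i <;> simp
    · rintro (⟨i, rfl⟩ | ⟨i, rfl⟩)
      · exact ⟨Fin.castAdd _ i, by simp⟩
      · exact ⟨Fin.natAdd _ i, by simp⟩
  induction A with
  | pos p a b => intro x; simp only [toFm, Fm.Occurs, slotsLo, dual, slotsUp, univ_map_rev, aux]
  | neg p a b => intro x; simp only [toFm, Fm.Occurs, slotsLo, dual, slotsUp, univ_map_rev, aux]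
  | tensor A B hA hB =>
    intro x; simp only [toFm, Fm.Occurs, slotsUp, slotsLo_tensor, hA, hB, Multiset.mem_add]; tauto
  | par A B hA hB =>
    intro x; simp only [toFm, Fm.Occurs, slotsUp, slotsLo_par, hA, hB, Multiset.mem_add]; tauto
  | nabla A hA =>
    intro x
    simp only [toFm, Fm.Occurs, hA, slotsLo, dual, slotsUp, mem_filterMap_lower]
  | tri A hA =>
    intro x
    simp only [toFm, Fm.Occurs, hA, slotsLo, dual, slotsUp, mem_filterMap_lower]

theorem occurs_rename_map {f : V → V} {n : ℕ} (A : Fm L V n) : ∀ x : V,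
    (A.rename (Slot.map f)).Occurs (.inl x) ↔ ∃ i, f i = x ∧ A.Occurs (.inl i) := by
  have aux : ∀ {k : ℕ} (s : Slot V k) (x : V),
      Slot.map f s = .inl x ↔ ∃ i, f i = x ∧ s = .inl i := by
    intro k s x
    rcases s with y | i
    · simp [eq_comm]
    · simp
  induction A with
  | pos p e => intro x; simp only [Fm.rename, Fm.Occurs, aux]; tauto
  | neg p e => intro x; simp only [Fm.rename, Fm.Occurs, aux]; tauto
  | tensor A B hA hB =>
    intro x; simp only [Fm.rename, Fm.Occurs, hA, hB, and_or_left, exists_or]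
  | par A B hA hB =>
    intro x; simp only [Fm.rename, Fm.Occurs, hA, hB, and_or_left, exists_or]
  | all A hA => intro x; simp only [Fm.rename, Slot.lift_map]; exact hA x
  | ex A hA => intro x; simp only [Fm.rename, Slot.lift_map]; exact hA x

theorem occurs_ev {f : V → V} (A : TFm L V 0) (x : V) :
    (A.ev f).Occurs (.inl x) ↔ ∃ i, f i = x ∧ (i ∈ A.ups ∨ i ∈ A.los) := by
  simp only [ev, occurs_rename_map, occurs_toFm, mem_ups, mem_los]

end TFm

end Basics

/-! ### Cut elimination for MLL1 by phase semantics. -/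

section CutElimination

open scoped Pointwise

variable {L : Language.{u}} {V : Type v}

/-- Derivability in MLL1 without the cut rule. -/
inductive CutFree : Multiset (Fm L V 0) → Prop
  | id (A : Fm L V 0) : A.IsAtomic → CutFree {A.dual, A}
  | par (Γ : Multiset (Fm L V 0)) (A B : Fm L V 0) :
      CutFree (A ::ₘ B ::ₘ Γ) → CutFree (.par A B ::ₘ Γ)
  | tensor (Γ Θ : Multiset (Fm L V 0)) (A B : Fm L V 0) :
      CutFree (A ::ₘ Γ) → CutFree (B ::ₘ Θ) → CutFree (.tensor A B ::ₘ (Γ + Θ))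
  | all (Γ : Multiset (Fm L V 0)) (A : Fm L V 1) (x : V) :
      (∀ B ∈ Fm.all A ::ₘ Γ, ¬ B.Occurs (.inl x)) →
      CutFree (A.inst x ::ₘ Γ) → CutFree (.all A ::ₘ Γ)
  | ex (Γ : Multiset (Fm L V 0)) (A : Fm L V 1) (x : V) :
      CutFree (A.inst x ::ₘ Γ) → CutFree (.ex A ::ₘ Γ)

namespace Phase

/-- The sequents that complete every sequent of `S` to a cut-free derivable one. -/
def orth (S : Set (Multiset (Fm L V 0))) : Set (Multiset (Fm L V 0)) :=
  {Δ | ∀ Γ ∈ S, CutFree (Γ + Δ)}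

theorem orth_anti {S S' : Set (Multiset (Fm L V 0))} (h : S ⊆ S') : orth S' ⊆ orth S :=
  fun _ hΔ Γ hΓ => hΔ Γ (h hΓ)

theorem subset_orth_orth (S : Set (Multiset (Fm L V 0))) : S ⊆ orth (orth S) :=
  fun Γ hΓ Δ hΔ => by rw [add_comm]; exact hΔ Γ hΓ

theorem orth_orth_orth (S : Set (Multiset (Fm L V 0))) : orth (orth (orth S)) = orth S :=
  (orth_anti (subset_orth_orth S)).antisymm (subset_orth_orth _)

/-- Extending an assignment of names to the slots in the scope of one more binder. -/
def cons {n : ℕ} (x : V) (ρ : Slot V n → V) : Slot V (n + 1) → V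
  | .inl y => ρ (.inl y)
  | .inr i => Fin.cases x (fun k => ρ (.inr k)) i

theorem inl_cons {n : ℕ} (x : V) (ρ : Slot V n → V) :
    (fun s => (.inl (cons x ρ s) : Slot V 0)) =
      Slot.inst x ∘ Slot.lift (fun s => (.inl (ρ s) : Slot V 0)) := by
  funext s
  obtain rfl | ⟨y, rfl⟩ := Slot.cases_weaken s
  · rfl
  · rcases y with y | i <;> rfl

theorem cons_comp_lift {n m : ℕ} (x : V) (ρ : Slot V m → V) (σ : Slot V n → Slot V m) :
    cons x ρ ∘ Slot.lift σ = cons x (ρ ∘ σ) := by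
  have h : ∀ {k : ℕ} (τ : Slot V k → V) (s : Slot V k), cons x τ s.weaken = τ s := by
    intro k τ s; rcases s with s | i <;> rfl
  funext s
  obtain rfl | ⟨y, rfl⟩ := Slot.cases_weaken s
  · rfl
  · simp [h]

/-- The closed formula obtained by an assignment of names to slots. -/
def close {n : ℕ} (ρ : Slot V n → V) (A : Fm L V n) : Fm L V 0 := A.rename fun s => .inl (ρ s)

theorem close_cons {n : ℕ} (x : V) (ρ : Slot V n → V) (A : Fm L V (n + 1)) :
    close (cons x ρ) A = (A.rename (Slot.lift fun s => (.inl (ρ s) : Slot V 0))).inst x := by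
  rw [Fm.inst_rename, close, inl_cons]

/-- The interpretation of formulas as facts of the phase space of cut-free provability. -/
def den : {n : ℕ} → (Slot V n → V) → Fm L V n → Set (Multiset (Fm L V 0))
  | _, ρ, .pos p e => orth {{close ρ (.pos p e)}}
  | _, ρ, .neg p e => orth (orth {{(close ρ (.neg p e)).dual}})
  | _, ρ, .tensor A B => orth (orth (den ρ A + den ρ B))
  | _, ρ, .par A B => orth (orth (den ρ A) + orth (den ρ B))
  | _, ρ, .all A => ⋂ x, den (cons x ρ) A
  | _, ρ, .ex A => orth (orth (⋃ x, den (cons x ρ) A))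

theorem orth_iUnion {ι : Type*} (S : ι → Set (Multiset (Fm L V 0))) :
    orth (⋃ i, S i) = ⋂ i, orth (S i) := by
  ext Δ
  simp only [orth, Set.mem_iUnion, Set.mem_iInter, Set.mem_ofPred_eq]
  exact ⟨fun h i Γ hΓ => h Γ ⟨i, hΓ⟩, fun h Γ ⟨i, hΓ⟩ => h i Γ hΓ⟩

/-- Apart from `∀`, all clauses of `den` are orthogonals by definition. An intersection of facts is
the orthogonal of the union of their orthogonals. -/
theorem orth_orth_den {n : ℕ} (A : Fm L V n) : ∀ ρ : Slot V n → V,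
    orth (orth (den ρ A)) = den ρ A := by
  induction A with
  | all A hA =>
    intro ρ
    have : den ρ (.all A) = orth (⋃ x, orth (den (cons x ρ) A)) := by
      rw [orth_iUnion]; simp only [hA]; rfl
    rw [this, orth_orth_orth]
  | _ => intro ρ; exact orth_orth_orth _

theorem den_dual {n : ℕ} (A : Fm L V n) : ∀ ρ : Slot V n → V,
    den ρ A.dual = orth (den ρ A) := by
  induction A with
  | pos p e =>
    intro ρ
    rw [Fm.dual, den, den, close, Fm.rename, Fm.dual]
    simp only [Fm.rev_cast_rev_cast]
    rfl
  | neg p e =>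
    intro ρ
    rw [Fm.dual, den, den, orth_orth_orth]
    rfl
  | tensor A B hA hB =>
    intro ρ
    rw [Fm.dual, den, den, orth_orth_orth, hA, hB, orth_orth_den, orth_orth_den, add_comm]
  | par A B hA hB =>
    intro ρ
    rw [Fm.dual, den, den, hA, hB, add_comm]
  | all A hA =>
    intro ρ
    rw [Fm.dual, den, den, orth_iUnion]
    simp only [hA, orth_orth_den]
  | ex A hA =>
    intro ρ
    rw [Fm.dual, den, den, orth_orth_orth, orth_iUnion]
    simp only [hA]

theorem den_rename {n : ℕ} (A : Fm L V n) : ∀ {m : ℕ} (σ : Slot V n → Slot V m)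
    (ρ : Slot V m → V), den ρ (A.rename σ) = den (ρ ∘ σ) A := by
  induction A with
  | pos p e => intros; rfl
  | neg p e => intros; rfl
  | tensor A B hA hB => intro m σ ρ; rw [Fm.rename, den, den, hA, hB]
  | par A B hA hB => intro m σ ρ; rw [Fm.rename, den, den, hA, hB]
  | all A hA => intro m σ ρ; rw [Fm.rename, den, den]; simp only [hA, cons_comp_lift]
  | ex A hA => intro m σ ρ; rw [Fm.rename, den, den]; simp only [hA, cons_comp_lift]

/-- The adequacy half of the semantic argument: each cut-free rule shows that a realizer of `A`, put
next to `A` itself, gives a cut-free provable sequent. -/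
theorem den_subset [Infinite V] {n : ℕ} (A : Fm L V n) : ∀ ρ : Slot V n → V,
    den ρ A ⊆ orth {{close ρ A}} := by
  induction A with
  | pos p e => intro ρ; exact subset_rfl
  | neg p e =>
    intro ρ Δ hΔ Γ hΓ
    rw [Set.mem_singleton_iff.1 hΓ]
    -- A double orthogonal is tested on the singleton of the formula, which has to be shown to lie
    -- in the orthogonal of the generating set. The cases `tensor` and `ex` work in the same way.
    refine hΔ _ fun Γ hΓ => ?_
    rw [Set.mem_singleton_iff.1 hΓ]
    exact CutFree.id _ trivial
  | tensor A B hA hB =>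
    intro ρ Δ hΔ Γ hΓ
    rw [Set.mem_singleton_iff.1 hΓ]
    refine hΔ _ fun Γ hΓ => ?_
    obtain ⟨γ, hγ, δ, hδ, rfl⟩ := Set.mem_add.1 hΓ
    rw [add_comm]
    exact CutFree.tensor γ δ _ _ (hA ρ hγ _ rfl) (hB ρ hδ _ rfl)
  | par A B hA hB =>
    intro ρ Δ hΔ Γ hΓ
    rw [Set.mem_singleton_iff.1 hΓ]
    refine CutFree.par _ _ _ ?_
    have h := hΔ ({close ρ A} + {close ρ B}) (Set.add_mem_add ?_ ?_)
    · simpa [Multiset.singleton_add, close] using h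
    · exact orth_anti (hA ρ) (subset_orth_orth _ rfl)
    · exact orth_anti (hB ρ) (subset_orth_orth _ rfl)
  | all A hA =>
    intro ρ Δ hΔ Γ hΓ
    rw [Set.mem_singleton_iff.1 hΓ]
    -- Membership in the intersection over all names is used at a single name, chosen fresh so that
    -- it can serve as eigenvariable.
    obtain ⟨x, -, hx⟩ := Fm.exists_fresh (close ρ (.all A) ::ₘ Δ) ∅ Set.finite_empty
    refine CutFree.all _ _ x hx ?_
    rw [← close_cons]
    exact hA _ (Set.mem_iInter.1 hΔ x) _ rfl
  | ex A hA =>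
    intro ρ Δ hΔ Γ hΓ
    rw [Set.mem_singleton_iff.1 hΓ]
    refine hΔ _ fun Γ hΓ => ?_
    obtain ⟨x, hx⟩ := Set.mem_iUnion.1 hΓ
    rw [add_comm]
    refine CutFree.ex _ _ x ?_
    rw [← close_cons]
    exact hA _ hx _ rfl

/-- The contexts that realize the duals of the formulas of `Γ`. -/
def prod (ρ : Slot V 0 → V) (Γ : Multiset (Fm L V 0)) : Set (Multiset (Fm L V 0)) :=
  (Γ.map fun A => orth (den ρ A)).sum

theorem prod_add (ρ : Slot V 0 → V) (Γ Θ : Multiset (Fm L V 0)) :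
    prod ρ (Γ + Θ) = prod ρ Γ + prod ρ Θ := by
  simp [prod]

/-- Validity of a sequent in the phase space. -/
def Valid (ρ : Slot V 0 → V) (Γ : Multiset (Fm L V 0)) : Prop := ∀ γ ∈ prod ρ Γ, CutFree γ

/-- Since facts are biorthogonally closed, any formula of a valid sequent may be singled out as the
conclusion. -/
theorem valid_cons {ρ : Slot V 0 → V} {A : Fm L V 0} {Γ : Multiset (Fm L V 0)} :
    Valid ρ (A ::ₘ Γ) ↔ prod ρ Γ ⊆ den ρ A := by
  rw [Valid, prod, Multiset.map_cons, Multiset.sum_cons]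
  constructor
  · intro h γ hγ
    rw [← orth_orth_den]
    exact fun δ hδ => h _ (Set.add_mem_add hδ hγ)
  · rintro h _ ⟨δ, hδ, γ, hγ, rfl⟩
    have h1 := h hγ
    rw [← orth_orth_den] at h1
    exact h1 δ hδ

/-- The interpretation depends on the assignment only through the formula obtained by carrying it
out, hence only through its values at the slots that occur. -/
theorem prod_congr {ρ ρ' : Slot V 0 → V} {Γ : Multiset (Fm L V 0)}
    (h : ∀ A ∈ Γ, ∀ s, A.Occurs s → ρ s = ρ' s) : prod ρ Γ = prod ρ' Γ := by
  refine congrArg _ (Multiset.map_congr rfl fun A hA => congrArg orth ?_)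
  have h1 : ∀ τ : Slot V 0 → V, den τ A = den Slot.name (A.rename fun s => .inl (τ s)) := by
    intro τ
    rw [den_rename]
    rfl
  rw [h1 ρ, h1 ρ']
  exact congrArg _ (A.rename_congr fun s hs => congrArg Sum.inl (h A hA s hs))

/-- In the model the cut rule just pairs an element of a fact with an element of its orthogonal. -/
theorem valid_of_mll [DecidableEq V] {Γ : Multiset (Fm L V 0)} (h : MLL1 Γ) :
    ∀ ρ, Valid ρ Γ := by
  induction h with
  | id A _ =>
    intro ρ
    rw [Multiset.insert_eq_cons, valid_cons, prod, Multiset.map_singleton,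
      Multiset.sum_singleton, den_dual]
  | cut Γ Θ A _ _ h1 h2 =>
    intro ρ Δ hΔ
    rw [prod_add] at hΔ
    obtain ⟨γ, hγ, θ, hθ, rfl⟩ := Set.mem_add.1 hΔ
    have h3 := valid_cons.1 (h2 ρ) hθ
    rw [den_dual] at h3
    exact h3 _ (valid_cons.1 (h1 ρ) hγ)
  | par Γ A B _ ih =>
    intro ρ
    rw [valid_cons]
    intro γ hγ δ hδ
    refine ih ρ _ ?_
    rw [prod, Multiset.map_cons, Multiset.sum_cons, Multiset.map_cons, Multiset.sum_cons,
      ← add_assoc]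
    exact Set.add_mem_add hδ hγ
  | tensor Γ Θ A B _ _ h1 h2 =>
    intro ρ
    rw [valid_cons, prod_add]
    exact (Set.add_subset_add (valid_cons.1 (h1 ρ)) (valid_cons.1 (h2 ρ))).trans
      (subset_orth_orth _)
  | all Γ A x hx _ ih =>
    intro ρ
    rw [valid_cons]
    refine Set.subset_iInter fun y => ?_
    -- To reach the member of the intersection at `y`, the eigenvariable is sent to `y`; by
    -- freshness this does not affect the conclusion of the rule.
    let ρ' : Slot V 0 → V := fun s => if s = .inl x then y else ρ s
    have hρ : ∀ B ∈ Fm.all A ::ₘ Γ, ∀ s, B.Occurs s → ρ s = ρ' s := by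
      intro B hB s hs
      have : s ≠ .inl x := fun h => hx B hB (h ▸ hs)
      simp [ρ', this]
    have h1 := valid_cons.1 (ih ρ')
    rw [Fm.inst, den_rename, ← prod_congr fun B hB => hρ B (Multiset.mem_cons_of_mem hB)] at h1
    refine h1.trans (le_of_eq ?_)
    have h2 : ρ' ∘ Slot.inst x = cons y ρ' := by
      funext s
      obtain rfl | ⟨z, rfl⟩ := Slot.cases_weaken s
      · simp [ρ', cons]
      · rcases z with z | i
        · rfl
        · exact i.elim0
    rw [h2]
    have h3 : ∀ τ : Slot V 0 → V, den (cons y τ) A =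
        den (cons y Slot.name) (A.rename (Slot.lift fun s => (.inl (τ s) : Slot V 0))) := by
      intro τ
      rw [den_rename, cons_comp_lift]
      rfl
    rw [h3 ρ', h3 ρ]
    -- Freshness is known for the quantified formula, so the two assignments are compared there and
    -- the quantifier is cancelled afterwards.
    have h4 := (Fm.all A).rename_congr (ρ := fun s => (.inl (ρ' s) : Slot V 0))
      (ρ' := fun s => (.inl (ρ s) : Slot V 0))
      fun s hs => congrArg Sum.inl (hρ _ (Multiset.mem_cons_self _ _) s hs).symm
    exact congrArg _ (Fm.all.inj h4)
  | ex Γ A x _ ih =>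
    intro ρ
    have h1 := valid_cons.1 (ih ρ)
    rw [valid_cons]
    refine (h1.trans ?_).trans (subset_orth_orth _)
    rw [Fm.inst, den_rename]
    have h2 : ρ ∘ Slot.inst x = cons (ρ (.inl x)) ρ := by
      funext s
      obtain rfl | ⟨z, rfl⟩ := Slot.cases_weaken s
      · rfl
      · rcases z with z | i
        · rfl
        · exact i.elim0
    rw [h2]
    exact Set.subset_iUnion (fun x => den (cons x ρ) A) _

end Phase

/-- Cut elimination. -/
theorem cutFree_of_mll [DecidableEq V] [Infinite V] {Γ : Multiset (Fm L V 0)} (h : MLL1 Γ) :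
    CutFree Γ := by
  -- Under the assignment that leaves names alone, `den_subset` puts each singleton `{A}` into the
  -- orthogonal of the interpretation of `A`. So `Γ` is itself one of the contexts that validity
  -- declares cut-free provable.
  refine Phase.valid_of_mll h Slot.name Γ ?_
  clear h
  induction Γ using Multiset.induction_on with
  | empty => simp [Phase.prod]
  | cons A Γ ih =>
    rw [Phase.prod, Multiset.map_cons, Multiset.sum_cons, ← Multiset.singleton_add]
    refine Set.add_mem_add ?_ ih
    refine Phase.orth_anti (Phase.den_subset A Slot.name) (Phase.subset_orth_orth _ ?_)
    have : Phase.close Slot.name A = A := by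
      rw [Phase.close]
      simp only [Slot.inl_name]
      exact A.rename_id
    rw [this]
    rfl

end CutElimination

/-! ### Well-formed tensor sequents as multiset equations, and one-sided sequents. -/

section Sequents

variable {L : Language.{u}} {V : Type v} {T : Type w}

namespace Term

@[simp] theorem up_add (t s : Term V T) : Term.up (t + s) = t.up + s.up := Multiset.add_bind _ _ _

@[simp] theorem lo_add (t s : Term V T) : Term.lo (t + s) = t.lo + s.lo := Multiset.add_bind _ _ _

@[simp] theorem up_cons (g : Gen V T) (t : Term V T) : Term.up (g ::ₘ t) = g.up + t.up :=
  Multiset.cons_bind _ _ _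

@[simp] theorem lo_cons (g : Gen V T) (t : Term V T) : Term.lo (g ::ₘ t) = g.lo + t.lo :=
  Multiset.cons_bind _ _ _

@[simp] theorem up_singleton (g : Gen V T) : Term.up ({g} : Term V T) = g.up :=
  Multiset.singleton_bind _ _

@[simp] theorem lo_singleton (g : Gen V T) : Term.lo ({g} : Term V T) = g.lo :=
  Multiset.singleton_bind _ _

end Term

@[simp] theorem Gen.up_reg (x : List T) (i j : V) : (Gen.reg x i j).up = {j} := rfl
@[simp] theorem Gen.lo_reg (x : List T) (i j : V) : (Gen.reg x i j).lo = {i} := rfl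
@[simp] theorem Gen.up_var (X : TVar V) : (Gen.var X : Gen V T).up = X.up := rfl
@[simp] theorem Gen.lo_var (X : TVar V) : (Gen.var X : Gen V T).lo = X.lo := rfl
@[simp] theorem Gen.up_sing (x : List T) : (Gen.sing x : Gen V T).up = 0 := rfl
@[simp] theorem Gen.lo_sing (x : List T) : (Gen.sing x : Gen V T).lo = 0 := rfl

/-- The product of the variables of a context. -/
def ctxTerm (T : Type w) (Γ : Multiset (TVar V × TFm L V 0)) : Term V T :=
  Γ.map fun D => Gen.var D.1

@[simp] theorem ctxTerm_cons (D : TVar V × TFm L V 0) (Γ : Multiset (TVar V × TFm L V 0)) :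
    ctxTerm T (D ::ₘ Γ) = Gen.var D.1 ::ₘ ctxTerm T Γ := Multiset.map_cons _ _ _

@[simp] theorem ctxTerm_add (Γ Θ : Multiset (TVar V × TFm L V 0)) :
    ctxTerm T (Γ + Θ) = ctxTerm T Γ + ctxTerm T Θ := Multiset.map_add _ _ _

/-- The formulas of the one-sided sequent with the context on the left hand side. -/
def ctxDual (Γ : Multiset (TVar V × TFm L V 0)) : Multiset (TFm L V 0) :=
  Γ.map fun D => D.2.dual

@[simp] theorem ctxDual_cons (D : TVar V × TFm L V 0) (Γ : Multiset (TVar V × TFm L V 0)) :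
    ctxDual (D ::ₘ Γ) = D.2.dual ::ₘ ctxDual Γ := Multiset.map_cons _ _ _

@[simp] theorem ctxDual_add (Γ Θ : Multiset (TVar V × TFm L V 0)) :
    ctxDual (Γ + Θ) = ctxDual Γ + ctxDual Θ := Multiset.map_add _ _ _

theorem add_ctxTerm_cons (t : Term V T) (X : TVar V) (A : TFm L V 0)
    (Γ : Multiset (TVar V × TFm L V 0)) :
    t + ctxTerm T ((X, A) ::ₘ Γ) = t + ctxTerm T Γ + {Gen.var X} := by
  rw [ctxTerm_cons, ← Multiset.singleton_add, add_comm {Gen.var X}, add_assoc]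

/-- Used at a fixed index with `a`, `b` for upper and lower occurrence in a variable, `c`, `d` for
those in its type: if neither carries an index in both positions, balance forces opposite positions
to match. -/
theorem matching_of_balance {a b c d : Prop} (h : a ∨ c ↔ b ∨ d) (h1 : a → ¬ c) (h2 : b → ¬ d)
    (h3 : a → ¬ b) (h4 : c → ¬ d) : (a ↔ d) ∧ (b ↔ c) := by
  tauto

theorem balance_iff {a b c d : Prop} (h1 : a → ¬ c) (h2 : b → ¬ d) :
    (a ∧ ¬ b ∨ c ↔ b ∧ ¬ a ∨ d) ↔ (a ∨ c ↔ b ∨ d) := by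
  by_cases a <;> by_cases b <;> simp_all

section

variable [DecidableEq V]

/-- An index bound in the term appears on both sides of the balance condition, so the free indices
need not be isolated: balance becomes an equation between multisets of all indices, which `abel` can
handle. -/
theorem isPseudotyping_iff {t : Term V T} {A : TFm L V 0} :
    IsPseudotyping t A ↔ A.BindersOK ∧ t.up + A.ups = t.lo + A.los ∧ (t.up + A.ups).Nodup ∧
      ∀ X : TVar V, Gen.var X ∈ t → (X.up ++ X.lo).Nodup := by
  simp only [IsPseudotyping, Term.IsTerm, TFm.isPseudotype_iff, TFm.mem_FIup, TFm.mem_FIlo]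
  constructor
  · rintro ⟨⟨h1, h2, h3⟩, ⟨h4, h5, h6⟩, h7, h8, h9⟩
    have hu : (t.up + A.ups).Nodup := Multiset.nodup_add.2
      ⟨h1, h5, Multiset.disjoint_left.2 fun {i} => h7 i⟩
    have hl : (t.lo + A.los).Nodup := Multiset.nodup_add.2
      ⟨h2, h6, Multiset.disjoint_left.2 fun {i} => h8 i⟩
    refine ⟨h4, (Multiset.Nodup.ext hu hl).2 fun i => ?_, hu, h3⟩
    have h := Set.ext_iff.1 h9 i
    simp only [Term.FIup, Term.FIlo, Set.mem_union, Set.mem_ofPred_eq, TFm.mem_FIup,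
      TFm.mem_FIlo, Multiset.mem_add] at h ⊢
    exact (balance_iff (h7 i) (h8 i)).1 h
  · rintro ⟨h1, h2, h3, h4⟩
    have h3' := h3
    rw [h2] at h3'
    obtain ⟨a1, a2, a3⟩ := Multiset.nodup_add.1 h3
    obtain ⟨b1, b2, b3⟩ := Multiset.nodup_add.1 h3'
    rw [Multiset.disjoint_left] at a3 b3
    refine ⟨⟨a1, b1, h4⟩, ⟨h1, a2, b2⟩, fun i hi => a3 hi, fun i hi => b3 hi, ?_⟩
    ext i
    have h : i ∈ t.up + A.ups ↔ i ∈ t.lo + A.los := by rw [h2]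
    simp only [Term.FIup, Term.FIlo, Set.mem_union, Set.mem_ofPred_eq, TFm.mem_FIup,
      TFm.mem_FIlo, Multiset.mem_add] at h ⊢
    exact (balance_iff (@a3 i) (@b3 i)).2 h

/-- Neither a variable nor a type has an index in both positions, so the upper indices of the
variable have to be the lower ones of the type and conversely. -/
theorem isTyping_var_iff {X : TVar V} {A : TFm L V 0} :
    IsTyping ({Gen.var X} : Term V T) A ↔
      A.BindersOK ∧ (X.up : Multiset V) = A.los ∧ (X.lo : Multiset V) = A.ups ∧
        (A.ups + A.los).Nodup := by
  simp only [IsTyping, isPseudotyping_iff, TFm.isType_iff, Term.up_singleton, Term.lo_singleton,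
    Gen.up_var, Gen.lo_var, Multiset.mem_singleton, Gen.var.injEq, forall_eq]
  constructor
  · rintro ⟨⟨h1, h2, h3, h4⟩, -, h5⟩
    have h3' := h3
    rw [h2] at h3'
    rw [← Multiset.coe_nodup, ← Multiset.coe_add] at h4
    obtain ⟨a1, a2, a3⟩ := Multiset.nodup_add.1 h3
    obtain ⟨b1, b2, b3⟩ := Multiset.nodup_add.1 h3'
    obtain ⟨c1, c2, c3⟩ := Multiset.nodup_add.1 h4
    obtain ⟨d1, d2, d3⟩ := Multiset.nodup_add.1 h5
    rw [Multiset.disjoint_left] at a3 b3 c3 d3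
    have key : ∀ i, (i ∈ (X.up : Multiset V) ↔ i ∈ A.los) ∧ (i ∈ (X.lo : Multiset V) ↔ i ∈ A.ups) :=
      fun i => matching_of_balance (by rw [← Multiset.mem_add, h2, Multiset.mem_add]) (@a3 i)
        (@b3 i) (@c3 i) (@d3 i)
    exact ⟨h1, (Multiset.Nodup.ext a1 b2).2 fun i => (key i).1,
      (Multiset.Nodup.ext b1 a2).2 fun i => (key i).2, h5⟩
  · rintro ⟨h1, h2, h3, h4⟩
    rw [h2, h3]
    refine ⟨⟨h1, add_comm _ _, by rwa [add_comm], ?_⟩, h1, h4⟩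
    rw [← Multiset.coe_nodup, ← Multiset.coe_add, h2, h3, add_comm]
    exact h4

theorem isCtx_iff {Γ : Multiset (TVar V × TFm L V 0)} :
    IsCtx T Γ ↔ (∀ D ∈ Γ, D.2.BindersOK ∧ (D.1.up : Multiset V) = D.2.los ∧
        (D.1.lo : Multiset V) = D.2.ups ∧ (D.2.ups + D.2.los).Nodup) ∧
      (Γ.map fun D => D.1.symbol).Nodup ∧ (Γ.bind fun D => D.2.los).Nodup ∧
        (Γ.bind fun D => D.2.ups).Nodup := by
  simp only [IsCtx, isTyping_var_iff]
  refine and_congr_right fun h => and_congr_right fun _ => ?_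
  rw [Multiset.bind_congr fun D hD => (h D hD).2.1, Multiset.bind_congr fun D hD => (h D hD).2.2.1]

theorem IsCtx.mono {Γ Θ : Multiset (TVar V × TFm L V 0)} (h : IsCtx T Γ) (hle : Θ ≤ Γ) :
    IsCtx T Θ := by
  obtain ⟨h1, h2, h3, h4⟩ := h
  obtain ⟨Ξ, rfl⟩ := Multiset.le_iff_exists_add.1 hle
  rw [Multiset.map_add] at h2
  rw [Multiset.add_bind] at h3 h4
  exact ⟨fun D hD => h1 D (Multiset.mem_add.2 (Or.inl hD)), (Multiset.nodup_add.1 h2).1,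
    (Multiset.nodup_add.1 h3).1, (Multiset.nodup_add.1 h4).1⟩

/-- The variables of a context carry the same indices as the duals of their types; this lets
two-sided sequents be treated as one-sided ones. -/
theorem up_ctxTerm {Γ : Multiset (TVar V × TFm L V 0)} (h : IsCtx T Γ) :
    (ctxTerm T Γ).up = (ctxDual Γ).bind TFm.ups := by
  rw [Term.up, ctxTerm, ctxDual, Multiset.bind_map, Multiset.bind_map]
  exact Multiset.bind_congr fun D hD => ((isCtx_iff.1 h).1 D hD).2.1

theorem lo_ctxTerm {Γ : Multiset (TVar V × TFm L V 0)} (h : IsCtx T Γ) :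
    (ctxTerm T Γ).lo = (ctxDual Γ).bind TFm.los := by
  rw [Term.lo, ctxTerm, ctxDual, Multiset.bind_map, Multiset.bind_map]
  exact Multiset.bind_congr fun D hD => ((isCtx_iff.1 h).1 D hD).2.2.1.trans
    (TFm.los_dual _).symm

theorem isSeq_mk {Γ : Multiset (TVar V × TFm L V 0)} {t : Term V T} {A : TFm L V 0}
    (hΓ : IsCtx T Γ) (hA : A.BindersOK) (hb : t.up + A.ups = t.lo + A.los)
    (hn : (t.up + A.ups).Nodup) (hX : ∀ X, Gen.var X ∈ t → Gen.var X ∈ ctxTerm T Γ) :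
    IsSeq Γ t A := by
  refine ⟨hΓ, isPseudotyping_iff.2 ⟨hA, hb, hn, fun X h => ?_⟩⟩
  obtain ⟨D, hD, h⟩ := Multiset.mem_map.1 (hX X h)
  have h1 := (hΓ.1 D hD).1.1.2.2 D.1 (Multiset.mem_singleton_self _)
  rwa [Gen.var.inj h] at h1

/-- One-sided sequents of formulas with pairwise different free indices. -/
structure Separated (Δ : Multiset (TFm L V 0)) : Prop where
  ok : ∀ A ∈ Δ, A.BindersOK
  nodup : (Δ.bind TFm.ups + Δ.bind TFm.los).Nodup

theorem Separated.mono {Δ Δ' : Multiset (TFm L V 0)} (h : Separated Δ) (hle : Δ' ≤ Δ) :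
    Separated Δ' := by
  obtain ⟨Ξ, rfl⟩ := Multiset.le_iff_exists_add.1 hle
  refine ⟨fun A hA => h.ok A (Multiset.mem_add.2 (Or.inl hA)), ?_⟩
  have := h.nodup
  rw [Multiset.add_bind, Multiset.add_bind, add_add_add_comm] at this
  exact (Multiset.nodup_add.1 this).1

theorem isCtx_of_separated {Γ : Multiset (TVar V × TFm L V 0)} (h : Separated (ctxDual Γ))
    (hs : (Γ.map fun D => D.1.symbol).Nodup)
    (hX : ∀ D ∈ Γ, (D.1.up : Multiset V) = D.2.los ∧ (D.1.lo : Multiset V) = D.2.ups) :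
    IsCtx T Γ := by
  have hn := h.nodup
  rw [ctxDual, Multiset.bind_map, Multiset.bind_map] at hn
  simp only [TFm.ups_dual, TFm.los_dual] at hn
  refine isCtx_iff.2 ⟨fun D hD => ⟨?_, (hX D hD).1, (hX D hD).2, ?_⟩, hs,
    (Multiset.nodup_add.1 hn).1, (Multiset.nodup_add.1 hn).2.1⟩
  · exact (TFm.bindersOK_dual _).1 (h.ok _ (Multiset.mem_map_of_mem _ hD))
  · have := (h.mono (Multiset.singleton_le.2
      (Multiset.mem_map_of_mem (fun D => D.2.dual) hD))).nodup
    simpa [add_comm] using this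

theorem IsCtx.separated_singleton {X : TVar V} {A : TFm L V 0} (h : IsCtx T {(X, A)}) :
    IsSeq (T := T) {(X, A)} {Gen.var X} A :=
  ⟨h, (h.1 _ (Multiset.mem_singleton_self _)).1⟩

/-- The type dictates the indices of the new variable; only its number has to be chosen, different
from those in use. -/
theorem exists_isCtx_cons {Γ : Multiset (TVar V × TFm L V 0)} {A : TFm L V 0} (hΓ : IsCtx T Γ)
    (h : Separated (A.dual ::ₘ ctxDual Γ)) : ∃ X : TVar V, IsCtx T ((X, A) ::ₘ Γ) := by
  obtain ⟨N, hN⟩ : ∃ N, ∀ D ∈ Γ, D.1.name ≠ N := by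
    classical
    obtain ⟨N, hN⟩ := Infinite.exists_notMem_finset (Γ.map fun D => D.1.name).toFinset
    exact ⟨N, fun D hD h => hN (Multiset.mem_toFinset.2 (Multiset.mem_map.2 ⟨D, hD, h⟩))⟩
  refine ⟨⟨N, A.los.toList, A.ups.toList⟩, isCtx_of_separated (by simpa using h) ?_ ?_⟩
  · rw [Multiset.map_cons, Multiset.nodup_cons]
    refine ⟨fun hm => ?_, hΓ.2.1⟩
    obtain ⟨D, hD, h⟩ := Multiset.mem_map.1 hm
    exact hN D hD (congrArg Prod.fst h)
  · intro D hD
    obtain rfl | hD := Multiset.mem_cons.1 hD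
    · exact ⟨Multiset.coe_toList _, Multiset.coe_toList _⟩
    · exact ((isCtx_iff.1 hΓ).1 D hD).2.imp_right And.left

/-- The term `t` is a product of Kronecker deltas that connects every free upper index of the
sequent to a free lower one. -/
structure Matched (Δ : Multiset (TFm L V 0)) (t : Term V T) : Prop where
  sep : Separated Δ
  up : t.up = Δ.bind TFm.los
  lo : t.lo = Δ.bind TFm.ups
  delta : ∀ g ∈ t, ∃ i j, g = Gen.reg [] i j

theorem Matched.var_notMem {Δ : Multiset (TFm L V 0)} {t : Term V T} (h : Matched Δ t)
    (X : TVar V) : Gen.var X ∉ t := fun hX => by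
  obtain ⟨i, j, h⟩ := h.delta _ hX
  exact absurd h (by simp)

theorem Matched.isSeq {Γ : Multiset (TVar V × TFm L V 0)} {t : Term V T} {A : TFm L V 0}
    (h : Matched (A ::ₘ ctxDual Γ) t) (hΓ : IsCtx T Γ) : IsSeq Γ (t + ctxTerm T Γ) A := by
  have hu := h.up
  have hl := h.lo
  have hn := h.sep.nodup
  rw [Multiset.cons_bind] at hu hl
  rw [Multiset.cons_bind, Multiset.cons_bind] at hn
  refine isSeq_mk hΓ (h.sep.ok A (Multiset.mem_cons_self _ _)) ?_ ?_ fun X hX => ?_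
  · rw [Term.up_add, Term.lo_add, up_ctxTerm hΓ, lo_ctxTerm hΓ, hu, hl]
    abel
  · rw [Term.up_add, up_ctxTerm hΓ, hu]
    convert hn using 1
    abel
  · exact (Multiset.mem_add.1 hX).resolve_left (h.var_notMem X)

theorem separated_par {A B : TFm L V 0} {Δ : Multiset (TFm L V 0)} :
    Separated (.par A B ::ₘ Δ) ↔ Separated (A ::ₘ B ::ₘ Δ) := by
  constructor <;> rintro ⟨h1, h2⟩ <;> refine ⟨?_, ?_⟩
  · simpa [TFm.BindersOK, and_assoc] using h1
  · simpa [add_assoc] using h2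
  · simpa [TFm.BindersOK, and_assoc] using h1
  · simpa [add_assoc] using h2

theorem matched_par {A B : TFm L V 0} {Δ : Multiset (TFm L V 0)} {t : Term V T} :
    Matched (.par A B ::ₘ Δ) t ↔ Matched (A ::ₘ B ::ₘ Δ) t := by
  constructor <;> rintro ⟨h1, h2, h3, h4⟩ <;> refine ⟨?_, ?_, ?_, h4⟩
  · exact separated_par.1 h1
  · simpa [add_assoc] using h2
  · simpa [add_assoc] using h3
  · exact separated_par.2 h1
  · simpa [add_assoc] using h2
  · simpa [add_assoc] using h3

/-- Derivability of a one-sided sequent, for any choice of the formula on the right hand side. -/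
def Prov (Ax : Set (Term V T × TFm L V 0)) (Δ : Multiset (TFm L V 0)) (t : Term V T) : Prop :=
  ∀ (A : TFm L V 0) (Γ : Multiset (TVar V × TFm L V 0)), Δ = A ::ₘ ctxDual Γ → IsCtx T Γ →
    ND Ax Γ (t + ctxTerm T Γ) A

variable {Ax : Set (Term V T × TFm L V 0)}

/-- Introduction rules act on the right hand side, while `Prov` asks for every choice of the formula
placed there. A detour through `⅋` moves the principal formula to the right and back, without
changing the term. -/
theorem prov_of_principal {A : TFm L V 0} {Δ : Multiset (TFm L V 0)} {t : Term V T}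
    (hm : Matched (A ::ₘ Δ) t)
    (h : ∀ Γ : Multiset (TVar V × TFm L V 0), ctxDual Γ = Δ → IsCtx T Γ →
      ND Ax Γ (t + ctxTerm T Γ) A) : Prov Ax (A ::ₘ Δ) t := by
  intro B Γ hΔ hΓ
  obtain ⟨rfl, h1⟩ | ⟨-, Ξ, h1, h2⟩ := Multiset.cons_eq_cons.1 hΔ
  · exact h Γ h1.symm hΓ
  obtain ⟨⟨X, A'⟩, hD, h3⟩ := Multiset.mem_map.1 (h2 ▸ Multiset.mem_cons_self A Ξ)
  obtain ⟨Γ, rfl⟩ := Multiset.exists_cons_of_mem hD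
  simp only at h3
  rw [ctxDual_cons] at h2
  simp only [h3] at h2
  have h4 := (Multiset.cons_inj_right A).1 h2
  subst h4
  subst h1
  have hΓ' := hΓ.mono (Multiset.le_cons_self Γ _)
  have hΓX : IsCtx T {(X, A')} := hΓ.mono (by simp)
  -- The principal formula is the dual of the declaration of `X`. The requested conclusion `B` is
  -- parked in the context as `Y : B̄`, which leaves the right hand side free for it.
  obtain ⟨Y, hY⟩ := exists_isCtx_cons (A := B.dual) hΓ'
    (by rw [TFm.dual_dual]; exact hm.sep.mono (Multiset.le_cons_self _ _))
  have k1 := h ((Y, B.dual) ::ₘ Γ) (by simp [TFm.dual_dual]) hY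
  -- Abstracting `Y` yields a `⅋` of `B` with the principal formula; applying this to `X` gives `B`
  -- back.
  have k2 : ND Ax Γ (t + ctxTerm T Γ) (.par B.dual.dual A) := by
    refine ND.parIl (X := Y) ?_ ?_
    · rwa [← add_ctxTerm_cons]
    · rw [TFm.dual_dual]
      refine Matched.isSeq (matched_par.2 ?_) hΓ'
      rwa [Multiset.cons_swap]
  rw [TFm.dual_dual, ← h3] at k2
  have k3 := ND.parEr k2 (ND.id hΓX.separated_singleton) (by
    have := Matched.isSeq (T := T) (Γ := (X, A') ::ₘ Γ) (A := B) (t := t)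
      (by rwa [ctxDual_cons, h3, Multiset.cons_swap]) hΓ
    rwa [← add_ctxTerm_cons, add_comm, Multiset.singleton_add])
  rwa [← add_ctxTerm_cons, add_comm, Multiset.singleton_add] at k3

end

end Sequents

theorem exists_eq_cons_of_map_eq_cons {α β : Type*} {f : α → β} {s : Multiset α} {t : Multiset β}
    {b : β} (h : s.map f = b ::ₘ t) : ∃ a s', s = a ::ₘ s' ∧ f a = b ∧ s'.map f = t := by
  obtain ⟨a, ha, rfl⟩ := Multiset.mem_map.1 (h ▸ Multiset.mem_cons_self b t)
  obtain ⟨s', rfl⟩ := Multiset.exists_cons_of_mem ha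
  rw [Multiset.map_cons] at h
  exact ⟨a, s', rfl, rfl, (Multiset.cons_inj_right _).1 h⟩

theorem exists_eq_add_of_map_eq_add {α β : Type*} {f : α → β} {t u : Multiset β} :
    ∀ {s : Multiset α}, s.map f = t + u → ∃ s₁ s₂, s = s₁ + s₂ ∧ s₁.map f = t ∧ s₂.map f = u := by
  induction t using Multiset.induction_on with
  | empty => exact fun {s} h => ⟨0, s, by simp, rfl, by simpa using h⟩
  | cons b t ih =>
    intro s h
    rw [Multiset.cons_add] at h
    obtain ⟨a, s', rfl, rfl, h'⟩ := exists_eq_cons_of_map_eq_cons h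
    obtain ⟨s₁, s₂, rfl, rfl, rfl⟩ := ih h'
    exact ⟨a ::ₘ s₁, s₂, by rw [Multiset.cons_add], Multiset.map_cons _ _ _, rfl⟩

theorem val_eq_add_compl {k : ℕ} (S : Finset (Fin k)) :
    (Finset.univ : Finset (Fin k)).val = S.val + Sᶜ.val := by
  rw [← Finset.union_compl S, ← Finset.disjUnion_eq_union _ _ disjoint_compl_right]
  rfl

theorem univ_map_ite {α : Type*} {k : ℕ} (S : Finset (Fin k)) (a b : Fin k → α) :
    (Finset.univ.val.map fun m => if m ∈ S then a m else b m) = S.val.map a + Sᶜ.val.map b := by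
  rw [val_eq_add_compl S, Multiset.map_add]
  congr 1
  · exact Multiset.map_congr rfl fun m hm => if_pos hm
  · exact Multiset.map_congr rfl fun m hm => if_neg (Finset.mem_compl.1 hm)

/-! ### Renaming the indices of literals, and the identity axioms. -/

section Completeness

variable {L : Language.{u}} {V : Type v} {T : Type w}

/-- A product of Kronecker deltas. -/
def deltas {k : ℕ} (S : Finset (Fin k)) (x y : Fin k → V) : Term V T :=
  S.val.map fun m => Gen.reg [] (x m) (y m)

theorem up_deltas {k : ℕ} (S : Finset (Fin k)) (x y : Fin k → V) :
    (deltas S x y : Term V T).up = S.val.map y := by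
  rw [Term.up, deltas, Multiset.bind_map]
  exact Multiset.bind_singleton _ _

theorem lo_deltas {k : ℕ} (S : Finset (Fin k)) (x y : Fin k → V) :
    (deltas S x y : Term V T).lo = S.val.map x := by
  rw [Term.lo, deltas, Multiset.bind_map]
  exact Multiset.bind_singleton _ _

theorem TFm.ups_pos (p : L.Pred) (a : Fin (L.vl p) → Slot V 0) (b : Fin (L.vr p) → Slot V 0) :
    (TFm.pos p a b).ups = Finset.univ.val.map fun m => (a m).name := by
  rw [TFm.ups, TFm.slotsUp, Multiset.map_map]; rfl

theorem TFm.los_pos (p : L.Pred) (a : Fin (L.vl p) → Slot V 0) (b : Fin (L.vr p) → Slot V 0) :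
    (TFm.pos p a b).los = Finset.univ.val.map fun m => (b m).name := by
  rw [TFm.los, TFm.slotsLo, TFm.dual, TFm.slotsUp, TFm.univ_map_rev, Multiset.map_map]; rfl

theorem TFm.ups_neg (p : L.Pred) (a : Fin (L.vr p) → Slot V 0) (b : Fin (L.vl p) → Slot V 0) :
    (TFm.neg p a b).ups = Finset.univ.val.map fun m => (a m).name := by
  rw [TFm.ups, TFm.slotsUp, Multiset.map_map]; rfl

theorem TFm.los_neg (p : L.Pred) (a : Fin (L.vr p) → Slot V 0) (b : Fin (L.vl p) → Slot V 0) :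
    (TFm.neg p a b).los = Finset.univ.val.map fun m => (b m).name := by
  rw [TFm.los, TFm.slotsLo, TFm.dual, TFm.slotsUp, TFm.univ_map_rev, Multiset.map_map]; rfl

variable [DecidableEq V] {Ax : Set (Term V T × TFm L V 0)}

theorem ND.isSeq {Γ : Multiset (TVar V × TFm L V 0)} {t : Term V T} {A : TFm L V 0}
    (h : ND Ax Γ t A) : IsSeq Γ t A := by
  cases h <;> assumption

/-- Each upper index is exchanged by one η-expansion, at the cost of one delta; `S` is the set of
places already treated. The freshness of the new names keeps all intermediate sequents well-formed.
-/
theorem nd_relabelUp {Γ : Multiset (TVar V × TFm L V 0)} {t : Term V T} {p : L.Pred}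
    {a a' : Fin (L.vl p) → Slot V 0} {b : Fin (L.vr p) → Slot V 0}
    (h : ND Ax Γ t (.pos p a b))
    (hn : (t.up + (TFm.pos p a b).ups + (TFm.pos p a' b).ups).Nodup) (S : Finset (Fin (L.vl p))) :
    ND Ax Γ (t + deltas S (fun m => (a' m).name) fun m => (a m).name)
      (.pos p (fun m => if m ∈ S then a' m else a m) b) := by
  have hs := h.isSeq
  obtain ⟨-, hb, -, hX⟩ := isPseudotyping_iff.1 hs.2
  have key : ∀ S, IsSeq Γ (t + deltas S (fun m => (a' m).name) fun m => (a m).name)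
      (.pos p (fun m => if m ∈ S then a' m else a m) b) := by
    intro S
    have e : (TFm.pos p (fun m => if m ∈ S then a' m else a m) b).ups =
        S.val.map (fun m => (a' m).name) + Sᶜ.val.map (fun m => (a m).name) := by
      rw [TFm.ups_pos, ← univ_map_ite]
      refine Multiset.map_congr rfl fun m _ => ?_
      split_ifs <;> rfl
    have e' : (TFm.pos p a b).ups =
        S.val.map (fun m => (a m).name) + Sᶜ.val.map (fun m => (a m).name) := by
      rw [TFm.ups_pos, ← Multiset.map_add, ← val_eq_add_compl]
    have e'' : (TFm.pos p a' b).ups =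
        S.val.map (fun m => (a' m).name) + Sᶜ.val.map (fun m => (a' m).name) := by
      rw [TFm.ups_pos, ← Multiset.map_add, ← val_eq_add_compl]
    rw [e'] at hb
    rw [e', e''] at hn
    refine ⟨hs.1, isPseudotyping_iff.2 ⟨trivial, ?_, ?_, fun X h => hX X ?_⟩⟩
    · rw [Term.up_add, Term.lo_add, up_deltas, lo_deltas, e]
      have h2 : (TFm.pos p (fun m => if m ∈ S then a' m else a m) b).los =
        (TFm.pos p a b).los := by rw [TFm.los_pos, TFm.los_pos]
      rw [h2]
      calc _ = (t.up + (S.val.map (fun m => (a m).name) + Sᶜ.val.map (fun m => (a m).name))) +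
            S.val.map (fun m => (a' m).name) := by abel
        _ = _ := by rw [hb]; abel
    · rw [Term.up_add, up_deltas, e]
      refine Multiset.nodup_of_le ?_ hn
      rw [Multiset.le_iff_exists_add]
      exact ⟨Sᶜ.val.map (fun m => (a' m).name), by abel⟩
    · refine (Multiset.mem_add.1 h).resolve_right fun h => ?_
      obtain ⟨m, -, h⟩ := Multiset.mem_map.1 h
      exact absurd h (by simp)
  obtain ⟨h1, -, h3⟩ := Multiset.nodup_add.1 hn
  obtain ⟨-, h1, -⟩ := Multiset.nodup_add.1 h1
  rw [TFm.ups_pos] at h1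
  -- Substitution acts on names, not on places. That the old names are different from each other and
  -- from the new ones ensures that only place `k` is affected.
  have hinj : ∀ m k, (a m).name = (a k).name → m = k := fun m k hmk =>
    Multiset.inj_on_of_nodup_map h1 m (Finset.mem_univ m) k (Finset.mem_univ k) hmk
  have hne : ∀ m k, (a' m).name ≠ (a k).name := by
    intro m k hmk
    rw [TFm.ups_pos, TFm.ups_pos] at h3
    exact Multiset.disjoint_left.1 h3
      (Multiset.mem_add.2 (Or.inr (Multiset.mem_map.2 ⟨k, Finset.mem_univ k, rfl⟩)))
      (Multiset.mem_map.2 ⟨m, Finset.mem_univ m, hmk⟩)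
  induction S using Finset.induction_on with
  | empty => simpa [deltas] using h
  | insert k S hk ih =>
    have e1 : (TFm.pos p (fun m => if m ∈ S then a' m else a m) b).substUp (a k).name (a' k).name =
        .pos p (fun m => if m ∈ insert k S then a' m else a m) b := by
      rw [TFm.substUp, TFm.rename]
      congr 1
      funext m
      by_cases hm : m ∈ S
      · rw [if_pos hm, if_pos (Finset.mem_insert_of_mem hm), ← Slot.inl_name (a' m), Slot.map_inl,
          if_neg (hne m k)]
      · rw [if_neg hm, ← Slot.inl_name (a m), Slot.map_inl]
        by_cases hmk : m = k
        · subst hmk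
          simp
        · rw [if_neg fun h => hmk (hinj m k h), if_neg (by simp [hmk, hm])]
    have e2 : t + deltas (insert k S) (fun m => (a' m).name) (fun m => (a m).name) =
        Gen.delta (a k).name (a' k).name ::ₘ
          (t + deltas S (fun m => (a' m).name) fun m => (a m).name) := by
      rw [deltas, Finset.insert_val_of_notMem hk, Multiset.map_cons, Multiset.add_cons]
      rfl
    have h4 := key (insert k S)
    rw [e2, ← e1] at h4 ⊢
    refine ND.etaUpExp ?_ ih h4
    rw [TFm.mem_FIup, TFm.ups_pos]
    exact Multiset.mem_map.2 ⟨k, Finset.mem_univ k, by rw [if_neg hk]⟩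

theorem nd_relabelLo {Γ : Multiset (TVar V × TFm L V 0)} {t : Term V T} {p : L.Pred}
    {a : Fin (L.vl p) → Slot V 0} {b b' : Fin (L.vr p) → Slot V 0}
    (h : ND Ax Γ t (.pos p a b))
    (hn : (t.lo + (TFm.pos p a b).los + (TFm.pos p a b').los).Nodup) (S : Finset (Fin (L.vr p))) :
    ND Ax Γ (t + deltas S (fun m => (b m).name) fun m => (b' m).name)
      (.pos p a (fun m => if m ∈ S then b' m else b m)) := by
  have hs := h.isSeq
  obtain ⟨-, hb, -, hX⟩ := isPseudotyping_iff.1 hs.2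
  have key : ∀ S, IsSeq Γ (t + deltas S (fun m => (b m).name) fun m => (b' m).name)
      (.pos p a (fun m => if m ∈ S then b' m else b m)) := by
    intro S
    have e : (TFm.pos p a (fun m => if m ∈ S then b' m else b m)).los =
        S.val.map (fun m => (b' m).name) + Sᶜ.val.map (fun m => (b m).name) := by
      rw [TFm.los_pos, ← univ_map_ite]
      refine Multiset.map_congr rfl fun m _ => ?_
      split_ifs <;> rfl
    have e' : (TFm.pos p a b).los =
        S.val.map (fun m => (b m).name) + Sᶜ.val.map (fun m => (b m).name) := by
      rw [TFm.los_pos, ← Multiset.map_add, ← val_eq_add_compl]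
    have e'' : (TFm.pos p a b').los =
        S.val.map (fun m => (b' m).name) + Sᶜ.val.map (fun m => (b' m).name) := by
      rw [TFm.los_pos, ← Multiset.map_add, ← val_eq_add_compl]
    rw [e'] at hb
    rw [e', e''] at hn
    have hbal : (t + deltas S (fun m => (b m).name) fun m => (b' m).name).up +
        (TFm.pos p a (fun m => if m ∈ S then b' m else b m)).ups =
        (t + deltas S (fun m => (b m).name) fun m => (b' m).name).lo +
        (TFm.pos p a (fun m => if m ∈ S then b' m else b m)).los := by
      rw [Term.up_add, Term.lo_add, up_deltas, lo_deltas, e]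
      have h2 : (TFm.pos p a (fun m => if m ∈ S then b' m else b m)).ups =
        (TFm.pos p a b).ups := by rw [TFm.ups_pos, TFm.ups_pos]
      rw [h2]
      calc _ = (t.up + (TFm.pos p a b).ups) + S.val.map (fun m => (b' m).name) := by abel
        _ = _ := by rw [hb]; abel
    refine ⟨hs.1, isPseudotyping_iff.2 ⟨trivial, hbal, ?_, fun X h => hX X ?_⟩⟩
    · rw [hbal, Term.lo_add, lo_deltas, e]
      refine Multiset.nodup_of_le ?_ hn
      rw [Multiset.le_iff_exists_add]
      exact ⟨Sᶜ.val.map (fun m => (b' m).name), by abel⟩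
    · refine (Multiset.mem_add.1 h).resolve_right fun h => ?_
      obtain ⟨m, -, h⟩ := Multiset.mem_map.1 h
      exact absurd h (by simp)
  obtain ⟨h1, -, h3⟩ := Multiset.nodup_add.1 hn
  obtain ⟨-, h1, -⟩ := Multiset.nodup_add.1 h1
  rw [TFm.los_pos] at h1
  have hinj : ∀ m k, (b m).name = (b k).name → m = k := fun m k hmk =>
    Multiset.inj_on_of_nodup_map h1 m (Finset.mem_univ m) k (Finset.mem_univ k) hmk
  have hne : ∀ m k, (b' m).name ≠ (b k).name := by
    intro m k hmk
    rw [TFm.los_pos, TFm.los_pos] at h3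
    exact Multiset.disjoint_left.1 h3
      (Multiset.mem_add.2 (Or.inr (Multiset.mem_map.2 ⟨k, Finset.mem_univ k, rfl⟩)))
      (Multiset.mem_map.2 ⟨m, Finset.mem_univ m, hmk⟩)
  induction S using Finset.induction_on with
  | empty => simpa [deltas] using h
  | insert k S hk ih =>
    have e1 : (TFm.pos p a (fun m => if m ∈ S then b' m else b m)).substLo (b k).name (b' k).name =
        .pos p a (fun m => if m ∈ insert k S then b' m else b m) := by
      rw [TFm.substLo, TFm.rename]
      congr 1
      funext m
      by_cases hm : m ∈ S
      · rw [if_pos hm, if_pos (Finset.mem_insert_of_mem hm), ← Slot.inl_name (b' m), Slot.map_inl,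
          if_neg (hne m k)]
      · rw [if_neg hm, ← Slot.inl_name (b m), Slot.map_inl]
        by_cases hmk : m = k
        · subst hmk
          simp
        · rw [if_neg fun h => hmk (hinj m k h), if_neg (by simp [hmk, hm])]
    have e2 : t + deltas (insert k S) (fun m => (b m).name) (fun m => (b' m).name) =
        Gen.delta (b' k).name (b k).name ::ₘ
          (t + deltas S (fun m => (b m).name) fun m => (b' m).name) := by
      rw [deltas, Finset.insert_val_of_notMem hk, Multiset.map_cons, Multiset.add_cons]
      rfl
    have h4 := key (insert k S)
    rw [e2, ← e1] at h4 ⊢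
    refine ND.etaLoExp ?_ ih h4
    rw [TFm.mem_FIlo, TFm.los_pos]
    exact Multiset.mem_map.2 ⟨k, Finset.mem_univ k, by rw [if_neg hk]⟩

/-- The variable axiom for the dual of the negative literal has the wrong indices on the right;
renaming its upper and then its lower ones produces the positive literal. The reversed positions
come from duality. -/
theorem prov_id {p : L.Pred} {a : Fin (L.vl p) → Slot V 0} {b : Fin (L.vr p) → Slot V 0}
    {a' : Fin (L.vr p) → Slot V 0} {b' : Fin (L.vl p) → Slot V 0}
    (hs : Separated {TFm.pos p a b, TFm.neg p a' b'}) :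
    let t : Term V T := deltas Finset.univ (fun m => (a m).name) (fun m => (b' m.rev).name) +
      deltas Finset.univ (fun m => (a' m.rev).name) (fun m => (b m).name)
    Matched {TFm.pos p a b, TFm.neg p a' b'} t ∧
      Prov Ax {TFm.pos p a b, TFm.neg p a' b'} t := by
  intro t
  have hm : Matched {TFm.pos p a b, TFm.neg p a' b'} t := by
    refine ⟨hs, ?_, ?_, ?_⟩
    · simp only [t, Term.up_add, up_deltas, Multiset.insert_eq_cons, Multiset.cons_bind,
        Multiset.singleton_bind, TFm.los_pos, TFm.los_neg,
        TFm.univ_map_rev fun m => (b' m).name, add_comm]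
    · simp only [t, Term.lo_add, lo_deltas, Multiset.insert_eq_cons, Multiset.cons_bind,
        Multiset.singleton_bind, TFm.ups_pos, TFm.ups_neg,
        TFm.univ_map_rev fun m => (a' m).name]
    · intro g hg
      obtain hg | hg := Multiset.mem_add.1 hg <;> obtain ⟨m, -, rfl⟩ := Multiset.mem_map.1 hg <;>
        exact ⟨_, _, rfl⟩
  refine ⟨hm, prov_of_principal hm fun Γ hΓ hc => ?_⟩
  obtain ⟨⟨X, A⟩, Γ', rfl, h1, h2⟩ := exists_eq_cons_of_map_eq_cons (t := 0) hΓ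
  obtain rfl := Multiset.map_eq_zero.1 h2
  simp only at h1
  have hA : A = .pos p (fun m => b' m.rev) (fun m => a' m.rev) := by
    rw [← TFm.dual_dual A, h1]; rfl
  subst hA
  have hX := (isCtx_iff.1 hc).1 _ (Multiset.mem_cons_self _ _)
  have hXu := hX.2.1
  have hXl := hX.2.2.1
  have k0 : ND Ax {(X, .pos p (fun m => b' m.rev) (fun m => a' m.rev))} {Gen.var X} _ :=
    ND.id (T := T) (IsCtx.separated_singleton hc)
  have hn := hs.nodup
  simp only [Multiset.insert_eq_cons, Multiset.cons_bind, Multiset.singleton_bind] at hn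
  have e1 : (TFm.neg p a' b').ups = (TFm.pos p (fun m => b' m.rev) (fun m => a' m.rev)).los := by
    rw [TFm.ups_neg, TFm.los_pos, TFm.univ_map_rev fun m => (a' m).name]
  have e2 : (TFm.neg p a' b').los = (TFm.pos p (fun m => b' m.rev) (fun m => a' m.rev)).ups := by
    rw [TFm.los_neg, TFm.ups_pos, TFm.univ_map_rev fun m => (b' m).name]
  rw [e1, e2] at hn
  have k1 := nd_relabelUp (a' := a) k0 (by
    rw [Term.up_singleton, Gen.up_var, hXu]
    refine Multiset.nodup_of_le (Multiset.le_iff_exists_add.2 ⟨(TFm.pos p a b).los, ?_⟩) hn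
    rw [TFm.ups_pos p a b, TFm.ups_pos p a fun m => a' m.rev]
    abel) Finset.univ
  simp only [Finset.mem_univ, if_true] at k1
  have k2 := nd_relabelLo (b' := b) k1 (by
    rw [Term.lo_add, Term.lo_singleton, Gen.lo_var, hXl, lo_deltas, ← TFm.ups_pos p a b]
    refine Multiset.nodup_of_le (le_of_eq ?_) hn
    rw [TFm.los_pos p a fun m => a' m.rev, TFm.los_pos p (fun m => b' m.rev) fun m => a' m.rev]
    abel) Finset.univ
  simp only [Finset.mem_univ, if_true] at k2
  convert k2 using 1
  · rfl
  · change t + {Gen.var X} = _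
    rw [add_comm]
    exact (add_assoc _ _ _).symm

end Completeness

/-! ### Cut-free proofs as tensor derivations whose terms are products of deltas. -/

section Completeness

variable {L : Language.{u}} {V : Type v} {T : Type w}

-- The two deltas close up to an empty loop, which disappears.
open Term in
theorem betaEq_trace {ν μ : V} {s : Term V T}
    (h : IsTerm (Gen.delta ν μ ::ₘ (Gen.delta μ ν ::ₘ s))) :
    BetaEq (Gen.delta ν μ ::ₘ (Gen.delta μ ν ::ₘ s)) s := by
  obtain ⟨h1, h2, h3⟩ := h
  have hc := BetaStep.contract [] [] μ ν μ s ⟨h1, h2, h3⟩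
  have hs : IsTerm (Gen.reg [] μ μ ::ₘ s : Term V T) := by
    simp only [Gen.delta, up_cons, lo_cons, Gen.up_reg, Gen.lo_reg, Multiset.singleton_add,
      Multiset.nodup_cons, Multiset.mem_cons, not_or] at h1 h2
    refine ⟨?_, ?_, fun X hX => h3 X ?_⟩
    · simpa using h1.2
    · simpa using ⟨h2.1.2, h2.2.2⟩
    · obtain h | h := Multiset.mem_cons.1 hX
      · exact absurd h (by simp)
      · exact Multiset.mem_cons_of_mem (Multiset.mem_cons_of_mem h)
  refine .trans _ _ _ (.rel _ _ hc) (.trans _ _ _ (.rel _ _ (BetaStep.loop _ _ _ hs))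
    (.rel _ _ (BetaStep.empty _ ?_)))
  obtain ⟨h1, h2, h3⟩ := hs
  simp only [up_cons, lo_cons, Gen.up_reg, Gen.lo_reg, Multiset.singleton_add,
    Multiset.nodup_cons] at h1 h2
  exact ⟨by simpa using h1.2, by simpa using h2.2, fun X hX => h3 X (by simpa using hX)⟩

open Term in
theorem isTerm_of_contract {x y : List T} {i j k : V} {s : Term V T}
    (h : IsTerm (Gen.reg x i j ::ₘ Gen.reg y j k ::ₘ s)) :
    IsTerm (Gen.reg (x ++ y) i k ::ₘ s) := by
  obtain ⟨h1, h2, h3⟩ := h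
  simp only [up_cons, lo_cons, Gen.up_reg, Gen.lo_reg, Multiset.singleton_add,
    Multiset.nodup_cons, Multiset.mem_cons, not_or] at h1 h2
  refine ⟨?_, ?_, fun X hX => h3 X (by simpa using hX)⟩
  · simpa using h1.2
  · simpa using ⟨h2.1.2, h2.2.2⟩

-- The delta bridges the gap between an edge that ends in `μ` and one that starts in `ν`.
open Term in
theorem betaEq_join {ν μ i j : V} {s : Term V T}
    (h : IsTerm (Gen.delta ν μ ::ₘ (Gen.reg [] i μ ::ₘ Gen.reg [] ν j ::ₘ s))) :
    BetaEq (Gen.delta ν μ ::ₘ (Gen.reg [] i μ ::ₘ Gen.reg [] ν j ::ₘ s))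
      (Gen.reg [] i j ::ₘ s) := by
  rw [Multiset.cons_swap, Gen.delta] at h ⊢
  have h2 := isTerm_of_contract h
  exact .trans _ _ _ (.rel _ _ (BetaStep.contract _ _ _ _ _ _ h))
    (.rel _ _ (BetaStep.contract _ _ _ _ _ _ h2))

theorem ev_fresh_congr {f f' : V → V} {Δ : Multiset (TFm L V 0)} {s : Multiset V}
    (hs : ∀ A ∈ Δ, (∀ i ∈ A.ups, i ∈ s) ∧ ∀ i ∈ A.los, i ∈ s) (hf : ∀ i ∈ s, f' i = f i) :
    (Δ.map fun A => A.ev f') = Δ.map fun A => A.ev f :=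
  Multiset.map_congr rfl fun A hA => A.ev_congr (fun i hi => hf i ((hs A hA).1 i hi))
    fun i hi => hf i ((hs A hA).2 i hi)

variable [DecidableEq V] {Ax : Set (Term V T × TFm L V 0)}

theorem prov_par {A B : TFm L V 0} {Δ : Multiset (TFm L V 0)} {t : Term V T}
    (hm : Matched (A ::ₘ B ::ₘ Δ) t) (h : Prov Ax (A ::ₘ B ::ₘ Δ) t) :
    Prov Ax (.par A B ::ₘ Δ) t := by
  have hm' := matched_par.2 hm
  refine prov_of_principal hm' fun Γ hΓ hc => ?_
  subst hΓ
  obtain ⟨Y, hY⟩ := exists_isCtx_cons (A := A.dual) hc (by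
    rw [TFm.dual_dual]
    refine hm.sep.mono ?_
    rw [Multiset.cons_swap]
    exact Multiset.le_cons_self _ _)
  have k1 := h B ((Y, A.dual) ::ₘ Γ) (by rw [ctxDual_cons, TFm.dual_dual, Multiset.cons_swap]) hY
  rw [add_ctxTerm_cons] at k1
  have k2 := ND.parIl k1 (by rw [TFm.dual_dual]; exact hm'.isSeq hc)
  rwa [TFm.dual_dual] at k2

theorem prov_tensor {A B : TFm L V 0} {Δ₁ Δ₂ : Multiset (TFm L V 0)} {t₁ t₂ : Term V T}
    (hm : Matched (.tensor A B ::ₘ (Δ₁ + Δ₂)) (t₁ + t₂)) (h₁ : Prov Ax (A ::ₘ Δ₁) t₁)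
    (h₂ : Prov Ax (B ::ₘ Δ₂) t₂) : Prov Ax (.tensor A B ::ₘ (Δ₁ + Δ₂)) (t₁ + t₂) := by
  refine prov_of_principal hm fun Γ hΓ hc => ?_
  obtain ⟨Γ₁, Γ₂, rfl, rfl, rfl⟩ := exists_eq_add_of_map_eq_add hΓ
  have e : t₁ + t₂ + ctxTerm T (Γ₁ + Γ₂) = t₁ + ctxTerm T Γ₁ + (t₂ + ctxTerm T Γ₂) := by
    rw [ctxTerm_add, add_add_add_comm]
  have hs := Matched.isSeq (Γ := Γ₁ + Γ₂) (by rw [ctxDual_add]; exact hm) hc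
  rw [e] at hs ⊢
  exact ND.tensorI (h₁ A Γ₁ rfl (hc.mono (Multiset.le_add_right _ _)))
    (h₂ B Γ₂ rfl (hc.mono (Multiset.le_add_left _ _))) hs

theorem prov_nabla {A : TFm L V 1} {ν μ : V} {Δ : Multiset (TFm L V 0)} {t : Term V T}
    (hνμ : μ ≠ ν) (hm : Matched (.nabla A ::ₘ Δ) t)
    (h : Prov Ax (A.inst ν μ ::ₘ Δ) (Gen.delta μ ν ::ₘ t)) : Prov Ax (.nabla A ::ₘ Δ) t := by
  refine prov_of_principal hm fun Γ hΓ hc => ?_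
  subst hΓ
  have k := h _ Γ rfl hc
  rw [Multiset.cons_add] at k
  exact ND.nablaI hνμ k (hm.isSeq hc)

/-- The `△` rule leaves the delta of its two indices in the term; `hβ` is the reduction that removes
it together with the two indices. -/
theorem prov_tri {A : TFm L V 1} {ν μ : V} {Δ : Multiset (TFm L V 0)} {t t' : Term V T}
    (hνμ : μ ≠ ν) (hm : Matched (.tri A ::ₘ Δ) t) (hm' : Matched (A.inst ν μ ::ₘ Δ) t')
    (h : Prov Ax (A.inst ν μ ::ₘ Δ) t')
    (hβ : ∀ s : Term V T, Term.IsTerm (Gen.delta ν μ ::ₘ (t' + s)) →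
      Term.BetaEq (Gen.delta ν μ ::ₘ (t' + s)) (t + s)) : Prov Ax (.tri A ::ₘ Δ) t := by
  refine prov_of_principal hm fun Γ hΓ hc => ?_
  subst hΓ
  have k := h _ Γ rfl hc
  have hA : (TFm.nabla A).BindersOK := hm.sep.ok (.tri A) (Multiset.mem_cons_self _ _)
  have hn := hm'.sep.nodup
  have hs : IsSeq Γ (Gen.delta ν μ ::ₘ (t' + ctxTerm T Γ)) (.tri A) := by
    have hu := hm'.up
    have hl := hm'.lo
    rw [Multiset.cons_bind, TFm.los_inst hA] at hu
    rw [Multiset.cons_bind, TFm.ups_inst hA] at hl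
    rw [Multiset.cons_bind, TFm.ups_inst hA, Multiset.cons_bind, TFm.los_inst hA] at hn
    have e2 : ({μ} : Multiset V) + (TFm.nabla A).los = μ ::ₘ (TFm.nabla A).los := rfl
    have e3 : ({ν} : Multiset V) + (TFm.nabla A).ups = ν ::ₘ (TFm.nabla A).ups := rfl
    rw [← e2] at hu hn
    rw [← e3] at hl hn
    refine isSeq_mk hc hA ?_ ?_ fun X hX => ?_
    · rw [Term.up_cons, Term.lo_cons, Term.up_add, Term.lo_add, up_ctxTerm hc, lo_ctxTerm hc, hu,
        hl, Gen.delta, Gen.up_reg, Gen.lo_reg, TFm.ups_tri, TFm.los_tri]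
      abel
    · rw [Term.up_cons, Term.up_add, up_ctxTerm hc, hu, Gen.delta, Gen.up_reg, TFm.ups_tri]
      convert hn using 1
      abel
    · obtain h | h := Multiset.mem_cons.1 hX
      · exact absurd h (by simp [Gen.delta])
      · exact (Multiset.mem_add.1 h).resolve_left (hm'.var_notMem X)
  exact ND.beta (ND.triI hνμ k hs) (hβ _ hs.2.1) (hm.isSeq hc)

/-- Both ends of every elementary term have the same value. -/
def Compat (f : V → V) (t : Term V T) : Prop :=
  ∀ (x : List T) (i j : V), Gen.reg x i j ∈ t → f i = f j

theorem Separated.inst {A : TFm L V 1} {ν μ : V} {Δ : Multiset (TFm L V 0)}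
    (h : Separated (.nabla A ::ₘ Δ)) (hνμ : μ ≠ ν)
    (hν : ν ∉ (TFm.nabla A ::ₘ Δ).bind TFm.ups + (TFm.nabla A ::ₘ Δ).bind TFm.los)
    (hμ : μ ∉ (TFm.nabla A ::ₘ Δ).bind TFm.ups + (TFm.nabla A ::ₘ Δ).bind TFm.los) :
    Separated (A.inst ν μ ::ₘ Δ) := by
  have hA := h.ok _ (Multiset.mem_cons_self _ _)
  refine ⟨fun B hB => ?_, ?_⟩
  · obtain rfl | hB := Multiset.mem_cons.1 hB
    · exact TFm.bindersOK_inst hA _ _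
    · exact h.ok _ (Multiset.mem_cons_of_mem hB)
  · have hn := h.nodup
    have e : (A.inst ν μ ::ₘ Δ).bind TFm.ups + (A.inst ν μ ::ₘ Δ).bind TFm.los =
        ν ::ₘ μ ::ₘ ((TFm.nabla A ::ₘ Δ).bind TFm.ups + (TFm.nabla A ::ₘ Δ).bind TFm.los) := by
      simp only [Multiset.cons_bind, TFm.ups_inst hA, TFm.los_inst hA, Multiset.cons_add,
        Multiset.add_cons]
      exact Multiset.cons_swap _ _ _
    rw [e]
    simp only [Multiset.nodup_cons, Multiset.mem_cons, not_or]
    exact ⟨⟨hνμ.symm, hν⟩, hμ, hn⟩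

/-- The induction generalizes over all lifts, because the premise of a quantifier rule is lifted
with two fresh indices where it has one variable. `Compat` is what lets the eigenvariable condition
speak about the term. -/
theorem prov_of_cutFree [Infinite V] (Ax : Set (Term V T × TFm L V 0))
    {Γ : Multiset (Fm L V 0)} (h : CutFree Γ) :
    ∀ (Δ : Multiset (TFm L V 0)) (f : V → V), (Δ.map fun A => A.ev f) = Γ → Separated Δ →
      ∃ t : Term V T, Matched Δ t ∧ Compat f t ∧ Prov Ax Δ t := by
  induction h with
  | id A hA =>
    intro Δ f hΔ hs
    -- Since the sequent is unordered and negation an involution, an axiom on a negative atom is one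
    -- on a positive atom.
    have key : ∀ (p : L.Pred) (e : Fin (L.vl p + L.vr p) → Slot V 0),
        (Δ.map fun A => A.ev f) = {Fm.pos p e, (Fm.pos p e).dual} →
        ∃ t : Term V T, Matched Δ t ∧ Compat f t ∧ Prov Ax Δ t := by
      intro p e hΔ
      obtain ⟨C, Δ, rfl, hC, hΔ⟩ := exists_eq_cons_of_map_eq_cons hΔ
      obtain ⟨D, Δ, rfl, hD, hΔ⟩ := exists_eq_cons_of_map_eq_cons (t := 0) hΔ
      obtain rfl := Multiset.map_eq_zero.1 hΔ
      obtain ⟨q, a, b, rfl⟩ : ∃ q a b, C = .pos q a b := by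
        cases C with
        | pos q a b => exact ⟨q, a, b, rfl⟩
        | _ => simp [TFm.ev, TFm.toFm, Fm.rename] at hC
      obtain ⟨q', a', b', rfl⟩ : ∃ q a b, D = .neg q a b := by
        cases D with
        | neg q a b => exact ⟨q, a, b, rfl⟩
        | _ => simp [TFm.ev, TFm.toFm, Fm.rename, Fm.dual] at hD
      simp only [TFm.ev, TFm.toFm, Fm.rename, Fm.dual] at hC hD
      injection hC with _ h1 h2
      subst h1
      injection hD with _ h3 h4
      subst h3
      obtain rfl := eq_of_heq h2
      have h4 := eq_of_heq h4
      obtain ⟨hm, hp⟩ := prov_id (Ax := Ax) (a := a) (b := b) (a' := a') (b' := b') hs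
      refine ⟨_, hm, ?_, hp⟩
      have hf : ∀ x y : Slot V 0, Slot.map f x = Slot.map f y → f x.name = f y.name := by
        intro x y hxy
        rw [← Slot.inl_name x, ← Slot.inl_name y] at hxy
        exact Sum.inl.inj hxy
      rintro x i j hg
      obtain hg | hg := Multiset.mem_add.1 hg <;> obtain ⟨m, -, hg⟩ := Multiset.mem_map.1 hg <;>
        injection hg with _ h5 h6 <;> subst h5 <;> subst h6 <;> apply hf
      · have h5 := congrFun h4 (Fin.natAdd _ m.rev)
        rw [Fin.append_right] at h5
        rw [h5]
        have : Fin.rev (Fin.cast (Nat.add_comm _ _) (Fin.natAdd (L.vr q') m.rev)) =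
          Fin.castAdd (L.vr q') m := by ext; simp; omega
        simp only [this, Fin.append_left]
      · have h5 := congrFun h4 (Fin.castAdd _ m.rev)
        rw [Fin.append_left] at h5
        rw [h5]
        have : Fin.rev (Fin.cast (Nat.add_comm _ _) (Fin.castAdd (L.vl q') m.rev)) =
          Fin.natAdd (L.vl q') m := by ext; simp; omega
        simp only [this, Fin.append_right]
    cases A with
    | pos p e => exact key p e (by rw [hΔ, Multiset.pair_comm])
    | neg p e =>
      have h1 : (Fm.neg p e).dual =
        Fm.pos p fun i => e (Fin.rev (Fin.cast (Nat.add_comm _ _) i)) := rfl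
      exact key p _ (by rw [hΔ, ← h1, Fm.dual_dual])
    | _ => exact hA.elim
  | par Γ A B _ ih =>
    intro Δ f hΔ hs
    obtain ⟨C, Δ, rfl, hC, rfl⟩ := exists_eq_cons_of_map_eq_cons hΔ
    cases C <;> simp only [TFm.ev, TFm.toFm, Fm.rename, reduceCtorEq, Fm.par.injEq] at hC
    rename_i A' B'
    obtain ⟨rfl, rfl⟩ := hC
    obtain ⟨t, hm, hc, hp⟩ := ih (A' ::ₘ B' ::ₘ Δ) f (by simp [TFm.ev]) (separated_par.1 hs)
    exact ⟨t, matched_par.2 hm, hc, prov_par hm hp⟩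
  | tensor Γ Θ A B _ _ ih₁ ih₂ =>
    intro Δ f hΔ' hs
    obtain ⟨C, Δ, rfl, hC, hΔ⟩ := exists_eq_cons_of_map_eq_cons hΔ'
    cases C <;> simp only [TFm.ev, TFm.toFm, Fm.rename, reduceCtorEq, Fm.tensor.injEq] at hC
    rename_i A' B'
    obtain ⟨rfl, rfl⟩ := hC
    obtain ⟨Δ₁, Δ₂, rfl, rfl, rfl⟩ := exists_eq_add_of_map_eq_add hΔ
    -- Splitting the tensor formula between the premises only regroups the indices.
    have hs' : Separated ((A' ::ₘ Δ₁) + (B' ::ₘ Δ₂)) := by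
      have hn := hs.nodup
      have ho := hs.ok
      refine ⟨fun C hC => ?_, ?_⟩
      · simp only [Multiset.mem_cons, forall_eq_or_imp, TFm.BindersOK, Multiset.mem_add] at hC ho
        obtain (rfl | h) | (rfl | h) := hC
        exacts [ho.1.1, ho.2 _ (Or.inl h), ho.1.2, ho.2 _ (Or.inr h)]
      · simp only [Multiset.cons_bind, Multiset.add_bind, TFm.ups_tensor, TFm.los_tensor] at hn ⊢
        convert hn using 1
        abel
    obtain ⟨t₁, hm₁, hc₁, hp₁⟩ := ih₁ (A' ::ₘ Δ₁) f (by simp [TFm.ev])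
      (hs'.mono (Multiset.le_add_right _ _))
    obtain ⟨t₂, hm₂, hc₂, hp₂⟩ := ih₂ (B' ::ₘ Δ₂) f (by simp [TFm.ev])
      (hs'.mono (Multiset.le_add_left _ _))
    have hm : Matched (.tensor A' B' ::ₘ (Δ₁ + Δ₂)) (t₁ + t₂) := by
      refine ⟨hs, ?_, ?_, fun g hg => (Multiset.mem_add.1 hg).elim (hm₁.delta g) (hm₂.delta g)⟩
      · rw [Term.up_add, hm₁.up, hm₂.up]
        simp only [Multiset.cons_bind, Multiset.add_bind, TFm.los_tensor]
        abel
      · rw [Term.lo_add, hm₁.lo, hm₂.lo]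
        simp only [Multiset.cons_bind, Multiset.add_bind, TFm.ups_tensor]
        abel
    exact ⟨t₁ + t₂, hm, fun x i j h => (Multiset.mem_add.1 h).elim (hc₁ x i j) (hc₂ x i j),
      prov_tensor hm hp₁ hp₂⟩
  | all Γ A x hx _ ih =>
    intro Δ f hΔ hs
    obtain ⟨C, Δ, rfl, hC, rfl⟩ := exists_eq_cons_of_map_eq_cons hΔ
    cases C <;> simp only [TFm.ev, TFm.toFm, Fm.rename, reduceCtorEq, Fm.all.injEq] at hC
    rename_i A'
    rw [Slot.lift_map] at hC
    change A'.ev f = A at hC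
    subst hC
    set s := (TFm.nabla A' ::ₘ Δ).bind TFm.ups + (TFm.nabla A' ::ₘ Δ).bind TFm.los with hsdef
    obtain ⟨ν, hν⟩ := Infinite.exists_notMem_finset s.toFinset
    obtain ⟨μ, hμ⟩ := Infinite.exists_notMem_finset (insert ν s.toFinset)
    simp only [Multiset.mem_toFinset, Finset.mem_insert, not_or] at hν hμ
    obtain ⟨hμν, hμ⟩ := hμ
    -- Both new indices denote the eigenvariable; the indices of the conclusion keep their values.
    let f' : V → V := fun i => if i = ν ∨ i = μ then x else f i
    have hf' : ∀ i ∈ s, f' i = f i := fun i hi => if_neg (by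
      rintro (rfl | rfl)
      exacts [hν hi, hμ hi])
    have hsub : ∀ A ∈ TFm.nabla A' ::ₘ Δ, (∀ i ∈ A.ups, i ∈ s) ∧ ∀ i ∈ A.los, i ∈ s :=
      fun A hA => ⟨fun i hi => Multiset.mem_add.2 (Or.inl (Multiset.mem_bind.2 ⟨A, hA, hi⟩)),
        fun i hi => Multiset.mem_add.2 (Or.inr (Multiset.mem_bind.2 ⟨A, hA, hi⟩))⟩
    obtain ⟨h1, h2⟩ := hsub _ (Multiset.mem_cons_self _ _)
    have hA := hs.ok _ (Multiset.mem_cons_self _ _)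
    obtain ⟨t, hm, hc, hp⟩ := ih (A'.inst ν μ ::ₘ Δ) f' (by
      rw [Multiset.map_cons, TFm.ev_inst (f := f) (x := x) A' (by simp [f']) (by simp [f'])
        (fun i hi => hf' i (h1 i hi)) fun i hi => hf' i (h2 i hi),
        ev_fresh_congr (fun A hA => hsub A (Multiset.mem_cons_of_mem hA)) hf'])
      (hs.inst hμν hν hμ)
    have hlo := hm.lo
    have hup := hm.up
    rw [Multiset.cons_bind, TFm.ups_inst hA, Multiset.cons_add, ← Multiset.cons_bind] at hlo
    rw [Multiset.cons_bind, TFm.los_inst hA, Multiset.cons_add, ← Multiset.cons_bind] at hup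
    obtain ⟨g, hg, hgν⟩ := Multiset.mem_bind.1 (show ν ∈ t.lo by rw [hlo]; simp)
    obtain ⟨i, j, rfl⟩ := hm.delta g hg
    obtain rfl : ν = i := by simpa using hgν
    have hj : j ∈ t.up := Multiset.mem_bind.2 ⟨_, hg, by simp⟩
    rw [hup, Multiset.mem_cons] at hj
    -- The delta that starts at `ν` ends in an index of value `x`. Any candidate other than `μ` is
    -- an index of the conclusion, so `x` would occur there, against the eigenvariable condition.
    obtain rfl : j = μ := by
      refine hj.resolve_right fun hj => ?_
      have h3 := hc _ _ _ hg
      rw [hf' j (Multiset.mem_add.2 (Or.inr hj))] at h3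
      obtain ⟨B, hB, hj⟩ := Multiset.mem_bind.1 hj
      have h4 : (B.ev f).Occurs (.inl x) :=
        (B.occurs_ev x).2 ⟨j, by rw [← h3]; simp [f'], Or.inr hj⟩
      refine hx _ ?_ h4
      rw [← TFm.ev_nabla, ← Multiset.map_cons (fun A : TFm L V 0 => A.ev f)]
      exact Multiset.mem_map_of_mem _ hB
    obtain ⟨(t : Term V T), rfl⟩ := Multiset.exists_cons_of_mem hg
    simp only [Term.up_cons, Term.lo_cons, Gen.up_reg, Gen.lo_reg, Multiset.singleton_add,
      Multiset.cons_inj_right] at hup hlo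
    have hm' : Matched (.nabla A' ::ₘ Δ) t :=
      ⟨hs, hup, hlo, fun g hg => hm.delta g (Multiset.mem_cons_of_mem hg)⟩
    refine ⟨t, hm', fun y i k hg => ?_, prov_nabla hμν hm' hp⟩
    have h5 := hc y i k (Multiset.mem_cons_of_mem hg)
    have hi : i ∈ t.lo := Multiset.mem_bind.2 ⟨_, hg, by simp⟩
    have hk : k ∈ t.up := Multiset.mem_bind.2 ⟨_, hg, by simp⟩
    rw [hlo] at hi
    rw [hup] at hk
    rwa [hf' i (Multiset.mem_add.2 (Or.inl hi)), hf' k (Multiset.mem_add.2 (Or.inr hk))] at h5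
  | ex Γ A x _ ih =>
    intro Δ f hΔ hs
    obtain ⟨C, Δ, rfl, hC, rfl⟩ := exists_eq_cons_of_map_eq_cons hΔ
    cases C <;> simp only [TFm.ev, TFm.toFm, Fm.rename, reduceCtorEq, Fm.ex.injEq] at hC
    rename_i A'
    rw [Slot.lift_map] at hC
    change A'.ev f = A at hC
    subst hC
    set s := (TFm.nabla A' ::ₘ Δ).bind TFm.ups + (TFm.nabla A' ::ₘ Δ).bind TFm.los with hsdef
    obtain ⟨ν, hν⟩ := Infinite.exists_notMem_finset s.toFinset
    obtain ⟨μ, hμ⟩ := Infinite.exists_notMem_finset (insert ν s.toFinset)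
    simp only [Multiset.mem_toFinset, Finset.mem_insert, not_or] at hν hμ
    obtain ⟨hμν, hμ⟩ := hμ
    let f' : V → V := fun i => if i = ν ∨ i = μ then x else f i
    have hf' : ∀ i ∈ s, f' i = f i := fun i hi => if_neg (by
      rintro (rfl | rfl)
      exacts [hν hi, hμ hi])
    have hsub : ∀ A ∈ TFm.nabla A' ::ₘ Δ, (∀ i ∈ A.ups, i ∈ s) ∧ ∀ i ∈ A.los, i ∈ s :=
      fun A hA => ⟨fun i hi => Multiset.mem_add.2 (Or.inl (Multiset.mem_bind.2 ⟨A, hA, hi⟩)),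
        fun i hi => Multiset.mem_add.2 (Or.inr (Multiset.mem_bind.2 ⟨A, hA, hi⟩))⟩
    obtain ⟨h1, h2⟩ := hsub _ (Multiset.mem_cons_self _ _)
    have hA : (TFm.nabla A').BindersOK := hs.ok (.tri A') (Multiset.mem_cons_self _ _)
    have hs' : Separated (TFm.nabla A' ::ₘ Δ) := by
      refine ⟨fun B hB => ?_, by simpa only [Multiset.cons_bind, TFm.ups_tri, TFm.los_tri] using hs.nodup⟩
      obtain rfl | hB := Multiset.mem_cons.1 hB
      · exact hA
      · exact hs.ok _ (Multiset.mem_cons_of_mem hB)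
    obtain ⟨t, hm, hc, hp⟩ := ih (A'.inst ν μ ::ₘ Δ) f' (by
      rw [Multiset.map_cons, TFm.ev_inst (f := f) (x := x) A' (by simp [f']) (by simp [f'])
        (fun i hi => hf' i (h1 i hi)) fun i hi => hf' i (h2 i hi),
        ev_fresh_congr (fun A hA => hsub A (Multiset.mem_cons_of_mem hA)) hf'])
      (hs'.inst hμν hν hμ)
    have hlo := hm.lo
    have hup := hm.up
    rw [Multiset.cons_bind, TFm.ups_inst hA, Multiset.cons_add, ← Multiset.cons_bind] at hlo
    rw [Multiset.cons_bind, TFm.los_inst hA, Multiset.cons_add, ← Multiset.cons_bind] at hup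
    -- It remains to eliminate `ν` and `μ` from the deltas of the premise, where now `x` may also be
    -- the value of other indices.
    suffices ∃ t' : Term V T, t'.up = (TFm.nabla A' ::ₘ Δ).bind TFm.los ∧
        t'.lo = (TFm.nabla A' ::ₘ Δ).bind TFm.ups ∧ (∀ g ∈ t', ∃ i j, g = Gen.reg [] i j) ∧
        Compat f' t' ∧ ∀ s : Term V T, Term.IsTerm (Gen.delta ν μ ::ₘ (t + s)) →
          Term.BetaEq (Gen.delta ν μ ::ₘ (t + s)) (t' + s) by
      obtain ⟨t', hup', hlo', hd, hc', hβ⟩ := this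
      have hm' : Matched (.tri A' ::ₘ Δ) t' := ⟨hs, by simpa only [Multiset.cons_bind, TFm.los_tri] using hup',
        by simpa only [Multiset.cons_bind, TFm.ups_tri] using hlo', hd⟩
      refine ⟨t', hm', fun y i k hg => ?_, prov_tri hμν hm' hm hp hβ⟩
      have h5 := hc' y i k hg
      have hi : i ∈ t'.lo := Multiset.mem_bind.2 ⟨_, hg, by simp⟩
      have hk : k ∈ t'.up := Multiset.mem_bind.2 ⟨_, hg, by simp⟩
      rw [hlo'] at hi
      rw [hup'] at hk
      rwa [hf' i (Multiset.mem_add.2 (Or.inl hi)), hf' k (Multiset.mem_add.2 (Or.inr hk))] at h5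
    obtain ⟨g, hg, hgν⟩ := Multiset.mem_bind.1 (show ν ∈ t.lo by rw [hlo]; simp)
    obtain ⟨i, j, rfl⟩ := hm.delta g hg
    obtain rfl : ν = i := by simpa using hgν
    obtain ⟨(t : Term V T), rfl⟩ := Multiset.exists_cons_of_mem hg
    simp only [Term.up_cons, Term.lo_cons, Gen.up_reg, Gen.lo_reg, Multiset.singleton_add,
      Multiset.cons_inj_right] at hup hlo
    -- Either the two indices are linked with each other and form a loop with the new delta, or they
    -- belong to two edges which that delta joins into one.
    by_cases hj : j = μ
    · subst hj
      rw [Multiset.cons_inj_right] at hup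
      refine ⟨t, hup, hlo, fun g hg => hm.delta g (Multiset.mem_cons_of_mem hg),
        fun y i k hg => hc y i k (Multiset.mem_cons_of_mem hg), fun r hr => ?_⟩
      rw [Multiset.cons_add] at hr ⊢
      exact betaEq_trace hr
    · obtain ⟨g, hg', hgμ⟩ := Multiset.mem_bind.1 (show μ ∈ t.up by
        have : μ ∈ j ::ₘ t.up := by rw [hup]; simp
        exact (Multiset.mem_cons.1 this).resolve_left (Ne.symm hj))
      obtain ⟨i, k, rfl⟩ := hm.delta g (Multiset.mem_cons_of_mem hg')
      obtain rfl : μ = k := by simpa using hgμ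
      obtain ⟨(t : Term V T), rfl⟩ := Multiset.exists_cons_of_mem hg'
      simp only [Term.up_cons, Term.lo_cons, Gen.up_reg, Gen.lo_reg,
        Multiset.singleton_add] at hup hlo
      rw [Multiset.cons_swap, Multiset.cons_inj_right] at hup
      refine ⟨Gen.reg [] i j ::ₘ t, by simpa using hup, by simpa using hlo, fun g hg => ?_,
        fun y i' k' hg => ?_, fun r hr => ?_⟩
      · obtain rfl | hg := Multiset.mem_cons.1 hg
        · exact ⟨_, _, rfl⟩
        · exact hm.delta g (Multiset.mem_cons_of_mem (Multiset.mem_cons_of_mem hg))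
      · obtain hg | hg := Multiset.mem_cons.1 hg
        · injection hg with _ h6 h7
          subst h6
          subst h7
          have h8 := hc _ _ _ (Multiset.mem_cons_of_mem (Multiset.mem_cons_self _ _))
          have h9 := hc _ _ _ (Multiset.mem_cons_self _ _)
          -- The joined edge is compatible because `ν` and `μ` have the same value `x`.
          rw [h8, ← h9]
          simp [f']
        · exact hc y i' k' (Multiset.mem_cons_of_mem (Multiset.mem_cons_of_mem hg))
      · rw [Multiset.cons_swap, Multiset.cons_add, Multiset.cons_add] at hr
        rw [Multiset.cons_swap (Gen.reg [] ν j), Multiset.cons_add, Multiset.cons_add,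
          Multiset.cons_add]
        exact betaEq_join hr

end Completeness

theorem univ_map_succ {α : Type*} {n : ℕ} (f : Fin (n + 1) → α) :
    Finset.univ.val.map f = f 0 ::ₘ Finset.univ.val.map fun i : Fin n => f i.succ := by
  rw [Fin.univ_succ, Finset.cons_val, Multiset.map_cons, Finset.map_val, Multiset.map_map]
  rfl

theorem univ_map_castSucc {α : Type*} {n : ℕ} (f : Fin (n + 1) → α) :
    Finset.univ.val.map f =
      f (Fin.last n) ::ₘ Finset.univ.val.map fun i : Fin n => f i.castSucc := by
  rw [Fin.univ_castSuccEmb, Finset.cons_val, Multiset.map_cons, Finset.map_val, Multiset.map_map]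
  rfl

/-! ### From first order derivations of a grammar to its tensor translation. -/

section Translation

variable {L : Language.{u}} {V : Type v} {T : Type w}

-- The edge under construction absorbs a word and the delta behind it in each round. The accumulated
-- label `x` and its start `p` are general so that the induction goes through.
open Term in
theorem betaEq_chain : ∀ {n : ℕ} (k : Fin (n + 1) → V) (v : Fin n → V) (w : Fin n → List T)
    (x : List T) (p : V),
    IsTerm (Gen.reg x p (k 0) ::ₘ
      ((Finset.univ.val.map fun i => Gen.reg [] (v i) (k i.succ)) +
        Finset.univ.val.map fun i => Gen.reg (w i) (k i.castSucc) (v i))) →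
    BetaEq (Gen.reg x p (k 0) ::ₘ
      ((Finset.univ.val.map fun i => Gen.reg [] (v i) (k i.succ)) +
        Finset.univ.val.map fun i => Gen.reg (w i) (k i.castSucc) (v i)))
      {Gen.reg (x ++ (List.ofFn w).flatten) p (k (Fin.last n))} := by
  intro n
  induction n with
  | zero =>
    intro k v w x p _
    simpa [BetaEq] using Relation.EqvGen.refl _
  | succ n ih =>
    intro k v w x p h
    rw [univ_map_succ, univ_map_succ, Multiset.cons_add, Multiset.add_cons,
      Multiset.cons_swap (Gen.reg [] _ _)] at h ⊢
    have h1 := isTerm_of_contract h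
    have h2 := isTerm_of_contract h1
    have h3 := ih (fun i => k i.succ) (fun i => v i.succ) (fun i => w i.succ) _ p h2
    refine .trans _ _ _ (.rel _ _ (BetaStep.contract _ _ _ _ _ _ h))
      (.trans _ _ _ (.rel _ _ (BetaStep.contract _ _ _ _ _ _ h1)) ?_)
    have e : x ++ (List.ofFn w).flatten =
        x ++ w 0 ++ [] ++ (List.ofFn fun i => w i.succ).flatten := by simp [List.ofFn_succ]
    rw [e]
    exact h3

theorem eq_map_lo {t : Term V T} {κ : V → V} (h : ∀ g ∈ t, ∃ i, g = Gen.reg [] i (κ i)) :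
    t = t.lo.map fun i => Gen.reg [] i (κ i) := by
  induction t using Multiset.induction_on with
  | empty => rfl
  | cons g t ih =>
    obtain ⟨i, rfl⟩ := h g (Multiset.mem_cons_self _ _)
    rw [Term.lo_cons, Gen.lo_reg, Multiset.singleton_add, Multiset.map_cons,
      ← ih fun g hg => h g (Multiset.mem_cons_of_mem hg)]

theorem ev_start {s : L.Pred} (hs : L.vl s = 1 ∧ L.vr s = 1) (f : V → V) (a b : V) :
    (TFm.pos s (fun _ => .inl a) fun _ => .inl b : TFm L V 0).ev f =
      .pos s fun i => if i.val = 0 then .inl (f a) else .inl (f b) := by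
  rw [TFm.ev, TFm.toFm, Fm.rename]
  congr 1
  funext i
  refine Fin.addCases (fun i => ?_) (fun i => ?_) i
  · have : i.val = 0 := by have := i.isLt; omega
    simp [this]
  · simp [hs.1]

variable [DecidableEq V] {Ax : Set (Term V T × TFm L V 0)}

/-- Substitution for a variable, as an abstraction followed by an application. As `g` has the same
indices as `X`, nothing else in the sequent changes. -/
theorem nd_cut {Γ : Multiset (TVar V × TFm L V 0)} {u : Term V T} {A B : TFm L V 0} {X : TVar V}
    {g : Gen V T} (h : ND Ax ((X, A) ::ₘ Γ) (u + {Gen.var X}) B) (hg : ND Ax 0 {g} A)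
    (hup : g.up = X.up) (hlo : g.lo = X.lo) (hX : ∀ Y, g ≠ Gen.var Y) :
    ND Ax Γ (u + {g}) B := by
  have hs := h.isSeq
  obtain ⟨hc, hp⟩ := hs
  obtain ⟨hB, hb, hn, hv⟩ := isPseudotyping_iff.1 hp
  obtain ⟨hA, hXu, hXl, -⟩ := (isCtx_iff.1 hc).1 _ (Multiset.mem_cons_self _ _)
  simp only at hA hXu hXl
  have hc' := hc.mono (Multiset.le_cons_self _ _)
  simp only [Term.up_add, Term.lo_add, Term.up_singleton, Term.lo_singleton, Gen.up_var,
    Gen.lo_var] at hb hn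
  have k1 := ND.parIl h ⟨hc', isPseudotyping_iff.2 ⟨⟨(TFm.bindersOK_dual A).2 hA, hB⟩,
    by simpa [hXu, hXl, add_assoc] using hb, by simpa [hXu, add_assoc] using hn,
    fun Y hY => hv Y (Multiset.mem_add.2 (Or.inl hY))⟩⟩
  have k2 := ND.parEl hg k1 (by
    rw [zero_add, add_comm]
    refine ⟨hc', isPseudotyping_iff.2 ⟨hB, by simpa [hup, hlo] using hb, by simpa [hup] using hn,
      fun Y hY => hv Y (Multiset.mem_add.2 (Or.inl ?_))⟩⟩
    refine (Multiset.mem_add.1 hY).resolve_right fun h => ?_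
    exact hX Y (Multiset.mem_singleton.1 h).symm)
  rwa [zero_add, add_comm] at k2

theorem nd_cut_ctx {ι : Type*} (D : ι → TVar V × TFm L V 0) (g : ι → Gen V T)
    (hg : ∀ i, ND Ax 0 {g i} (D i).2) (hup : ∀ i, (g i).up = (D i).1.up)
    (hlo : ∀ i, (g i).lo = (D i).1.lo) (hX : ∀ i Y, g i ≠ Gen.var Y) (s : Multiset ι) :
    ∀ {u : Term V T} {B : TFm L V 0}, ND Ax (s.map D) (u + ctxTerm T (s.map D)) B →
      ND Ax 0 (u + s.map g) B := by
  induction s using Multiset.induction_on with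
  | empty => exact fun {u B} h => h
  | cons i s ih =>
    intro u B h
    rw [Multiset.map_cons] at h
    have h1 : ND Ax (((D i).1, (D i).2) ::ₘ s.map D)
        (u + ctxTerm T (s.map D) + {Gen.var (D i).1}) B := by
      rw [← add_ctxTerm_cons]; exact h
    have h2 := nd_cut h1 (hg i) (hup i) (hlo i) (hX i)
    rw [add_right_comm] at h2
    have h3 := ih h2
    rwa [add_assoc, Multiset.singleton_add, ← Multiset.map_cons] at h3

/-- Balance against the edge from `l` to `r` leaves no other possibility, since a type has no index
in both positions. -/
theorem ups_los_entry {l r : V} {e : List T × Fm L V 0} (he : IsLexEntry l r e)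
    (hwf : e.2.LingWF ∧ e.2.countL (.inl l) = 1 ∧ e.2.countR (.inl r) = 1) :
    l ≠ r ∧ e.2.toTensor.BindersOK ∧ e.2.toTensor.ups = {l} ∧ e.2.toTensor.los = {r} := by
  obtain ⟨hlr, h1, h2⟩ := isTyping_entry he hwf
  obtain ⟨hB, hb, -, -⟩ := isPseudotyping_iff.1 h1
  obtain ⟨hu, hl, hd⟩ := Multiset.nodup_add.1 (TFm.isType_iff.1 h2).2
  rw [Multiset.disjoint_left] at hd
  rw [Term.up_singleton, Term.lo_singleton, Gen.up_reg, Gen.lo_reg] at hb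
  have key : ∀ x, x = r ∨ x ∈ e.2.toTensor.ups ↔ x = l ∨ x ∈ e.2.toTensor.los := by
    intro x
    rw [← Multiset.mem_singleton (a := r), ← Multiset.mem_add, hb, Multiset.mem_add,
      Multiset.mem_singleton]
  refine ⟨hlr, hB, (Multiset.Nodup.ext hu (Multiset.nodup_singleton _)).2 fun x => ?_,
    (Multiset.Nodup.ext hl (Multiset.nodup_singleton _)).2 fun x => ?_⟩
  · rw [Multiset.mem_singleton]
    refine ⟨fun hx => ((key x).1 (Or.inr hx)).resolve_right (hd hx), ?_⟩
    rintro rfl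
    exact ((key x).2 (Or.inl rfl)).resolve_left hlr
  · rw [Multiset.mem_singleton]
    refine ⟨fun hx => ((key x).2 (Or.inr hx)).resolve_right fun h => hd h hx, ?_⟩
    rintro rfl
    exact ((key x).1 (Or.inl rfl)).resolve_left (Ne.symm hlr)

theorem exists_perm_of_ne {l r x y : V} (h : l ≠ r) (h' : x ≠ y) :
    ∃ σ : Equiv.Perm V, σ l = x ∧ σ r = y := by
  have h1 : Equiv.swap l x r ≠ x := by
    intro h2
    exact h ((Equiv.swap l x).injective (h2.trans (Equiv.swap_apply_left l x).symm)).symm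
  refine ⟨Equiv.swap (Equiv.swap l x r) y * Equiv.swap l x, ?_, ?_⟩
  · rw [Equiv.Perm.mul_apply, Equiv.swap_apply_left, Equiv.swap_apply_of_ne_of_ne h1.symm h']
  · rw [Equiv.Perm.mul_apply, Equiv.swap_apply_left]

theorem ev_entry {l r : V} {f g : V → V} {A : Fm L V 0} (hu : A.toTensor.ups = {l})
    (hl : A.toTensor.los = {r}) (hlr : l ≠ r) :
    (A.toTensor.mapFree g).ev f = A.subst₂ l r (f (g l)) (f (g r)) := by
  rw [TFm.mapFree, TFm.ev_rename f A.toTensor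
    (ρ' := Slot.map fun z => if z = l then f (g l) else if z = r then f (g r) else z),
    TFm.toFm_toTensor, Fm.subst₂]
  · intro x hx
    rw [← Slot.inl_name x] at hx ⊢
    have h := TFm.mem_ups.2 hx
    rw [hu, Multiset.mem_singleton] at h
    simp only [Slot.map_inl, h, if_true]
  · intro x hx
    rw [← Slot.inl_name x] at hx ⊢
    have h := TFm.mem_los.2 hx
    rw [hl, Multiset.mem_singleton] at h
    simp only [Slot.map_inl, h, if_true, if_neg hlr.symm]

variable [Infinite V]

/-- The first order sequent is lifted so that each variable `c m` comes from two indices, one upper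
and one lower. Injectivity of `c` then determines all deltas. -/
theorem MILLGrammar.language_subset {l r : V} (G : MILLGrammar L V T l r) (hG : G.WellFormed) :
    G.language ⊆ (G.tensorTranslation hG).language := by
  rintro x ⟨n, e, c, he, hc, rfl, hd⟩
  have hen := fun i => ups_los_entry (G.lex_entry _ (he i)) (hG.lex_wf _ (he i))
  -- The indices `k m` and `v m` defined below are `2(n+1)` different ones. In the one-sided sequent
  -- the `v`s are the upper and the `k`s the lower indices; `k m` and `v m` both evaluate to `c m`.
  let ι : Fin (n + 1) × Bool → V := fun p => Infinite.natEmbedding V (Encodable.encode p)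
  have hι : Function.Injective ι := (Infinite.natEmbedding V).injective.comp Encodable.encode_injective
  let f : V → V := Function.extend ι (fun p => c p.1) id
  have hf : ∀ p, f (ι p) = c p.1 := fun p => hι.extend_apply _ _ p
  let k : Fin (n + 1) → V := fun m => ι (m, false)
  let v : Fin (n + 1) → V := fun m => ι (m, true)
  have hkv : ∀ m m', k m ≠ v m' := fun m m' h => by simpa using hι h
  choose σ hσl hσr using fun i : Fin n => exists_perm_of_ne (hen i).1 (hkv i.castSucc i.succ)
  let A : Fin n → TFm L V 0 := fun i => (e i).2.toTensor.mapFree (σ i)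
  have hAu : ∀ i, (A i).ups = {k i.castSucc} := fun i => by
    rw [show A i = (e i).2.toTensor.rename _ _ from rfl, TFm.ups_rename, (hen i).2.2.1, Multiset.map_singleton, hσl]
  have hAl : ∀ i, (A i).los = {v i.succ} := fun i => by
    rw [show A i = (e i).2.toTensor.rename _ _ from rfl, TFm.los_rename, (hen i).2.2.2, Multiset.map_singleton, hσr]
  have hAB : ∀ i, (A i).BindersOK := fun i => (TFm.bindersOK_rename _ _ _).2 (hen i).2.1
  have hAf : ∀ i, (A i).ev f = (e i).2.subst₂ l r (c i.castSucc) (c i.succ) := fun i => by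
    rw [ev_entry (hen i).2.2.1 (hen i).2.2.2 (hen i).1, hσl, hσr]
    simp only [k, v, hf]
  -- The start formula takes the two indices left over by the lexical formulas, which use `k 0, …, k
  -- (n-1)` and `v 1, …, v n`.
  let S : TFm L V 0 := .pos G.start (fun _ => .inl (v 0)) fun _ => .inl (k (Fin.last n))
  have hSu : S.ups = {v 0} := by
    rw [TFm.ups_pos]
    simp [hG.start_valency.1]
  have hSl : S.los = {k (Fin.last n)} := by
    rw [TFm.los_pos]
    simp [hG.start_valency.2]
  let Δ : Multiset (TFm L V 0) := S ::ₘ Finset.univ.val.map fun i => (A i).dual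
  have hΔu : Δ.bind TFm.ups = Finset.univ.val.map v := by
    rw [Multiset.cons_bind, Multiset.bind_map, hSu, univ_map_succ, Multiset.singleton_add]
    simp only [TFm.ups_dual, hAl, Multiset.bind_singleton]
  have hΔl : Δ.bind TFm.los = Finset.univ.val.map k := by
    rw [Multiset.cons_bind, Multiset.bind_map, hSl, univ_map_castSucc, Multiset.singleton_add]
    simp only [TFm.los_dual, hAu, Multiset.bind_singleton]
  have hsep : Separated Δ := by
    refine ⟨fun B hB => ?_, ?_⟩
    · obtain rfl | hB := Multiset.mem_cons.1 hB
      · trivial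
      · obtain ⟨i, -, rfl⟩ := Multiset.mem_map.1 hB
        exact (TFm.bindersOK_dual _).2 (hAB i)
    · rw [hΔu, hΔl]
      refine Multiset.nodup_add.2 ⟨Finset.univ.nodup.map fun m m' h => by simpa using hι h,
        Finset.univ.nodup.map fun m m' h => by simpa using hι h, ?_⟩
      rw [Multiset.disjoint_left]
      intro y h1 h2
      obtain ⟨m, -, rfl⟩ := Multiset.mem_map.1 h1
      obtain ⟨m', -, h⟩ := Multiset.mem_map.1 h2
      exact hkv _ _ h
  have hΔf : (Δ.map fun B => B.ev f) = G.startFm (c 0) (c (Fin.last n)) ::ₘ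
      (Finset.univ.val.map fun i : Fin n =>
        (e i).2.subst₂ l r (c i.castSucc) (c i.succ)).map Fm.dual := by
    rw [Multiset.map_cons, Multiset.map_map, Multiset.map_map, ev_start hG.start_valency]
    simp only [Function.comp_def, TFm.ev_dual, hAf, startFm, k, v, hf]
  obtain ⟨t, hm, hcompat, hp⟩ := prov_of_cutFree
    {J : Term V T × TFm L V 0 | ∃ J₀ ∈ (G.tensorTranslation hG).lex, AlphaEq J₀ J}
    (cutFree_of_mll hd) Δ f hΔf hsep
  -- By compatibility a delta can link `v m` only to some `k m'` with `c m = c m'`, that is, to `k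
  -- m`.
  have ht : t = Finset.univ.val.map fun m => Gen.reg [] (v m) (k m) := by
    let κ : V → V := Function.extend v k id
    have hv : Function.Injective v := fun m m' h => by simpa using hι h
    have hκ : ∀ m, κ (v m) = k m := fun m => hv.extend_apply _ _ m
    rw [eq_map_lo (t := t) (κ := κ), hm.lo, hΔu, Multiset.map_map]
    · simp only [Function.comp_def, hκ]
    · intro g hg
      obtain ⟨i, j, rfl⟩ := hm.delta g hg
      have hi : i ∈ t.lo := Multiset.mem_bind.2 ⟨_, hg, by simp⟩
      have hj : j ∈ t.up := Multiset.mem_bind.2 ⟨_, hg, by simp⟩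
      rw [hm.lo, hΔu] at hi
      rw [hm.up, hΔl] at hj
      obtain ⟨m, -, rfl⟩ := Multiset.mem_map.1 hi
      obtain ⟨m', -, rfl⟩ := Multiset.mem_map.1 hj
      have h1 := hcompat _ _ _ hg
      simp only [k, v, hf] at h1
      exact ⟨_, by rw [hκ, hc h1]⟩
  let D : Fin n → TVar V × TFm L V 0 := fun i => (⟨i, [v i.succ], [k i.castSucc]⟩, A i)
  have hD : ctxDual (Finset.univ.val.map D) = Finset.univ.val.map fun i => (A i).dual := by
    rw [ctxDual, Multiset.map_map]; rfl
  have hctx : IsCtx T (Finset.univ.val.map D) := by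
    refine isCtx_of_separated ?_ ?_ ?_
    · rw [hD]; exact hsep.mono (Multiset.le_cons_self _ _)
    · rw [Multiset.map_map]
      exact Finset.univ.nodup.map fun i j h => Fin.ext (congrArg Prod.fst h)
    · intro E hE
      obtain ⟨i, -, rfl⟩ := Multiset.mem_map.1 hE
      exact ⟨(hAl i).symm, (hAu i).symm⟩
  have h1 := hp S (Finset.univ.val.map D) (by rw [hD]) hctx
  have h2 := nd_cut_ctx D (fun i => Gen.reg (e i).1 (k i.castSucc) (v i.succ)) (fun i => by
      refine ND.ax ⟨_, ⟨e i, he i, rfl⟩, σ i, ?_, rfl⟩ ?_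
      · simp [Gen.map, hσl, hσr]
      · refine isSeq_mk ⟨by simp, by simp, by simp, by simp⟩ (hAB i) ?_ ?_ (by simp)
        · simp only [D, hAu, hAl, Term.up_singleton, Term.lo_singleton, Gen.up_reg, Gen.lo_reg]
          exact add_comm _ _
        · simp only [D, hAu, Term.up_singleton, Gen.up_reg]
          simpa using (hkv _ _).symm) (fun i => rfl) (fun i => rfl) (by simp) _ h1
  refine ⟨k (Fin.last n), v 0, ?_⟩
  -- The delta from `v 0` to `k 0` is split off as the start of the chain, with empty label.
  rw [ht, univ_map_succ, Multiset.cons_add] at h2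
  refine ND.beta h2 (betaEq_chain k _ (fun i => (e i).1) [] (v 0) h2.isSeq.2.1) ?_
  refine isSeq_mk ⟨by simp, by simp, by simp, by simp⟩ trivial ?_ ?_ (by simp)
  · change _ + S.ups = _ + S.los
    simp only [hSu, hSl, Term.up_singleton, Term.lo_singleton, Gen.up_reg, Gen.lo_reg]
    exact add_comm _ _
  · change (_ + S.ups).Nodup
    simp only [hSu, Term.up_singleton, Gen.up_reg]
    simpa using hkv _ _

end Translation

/-! ### Derived rules of MLL1: identity for all formulas, inversion, elimination. -/

section FirstOrder

variable {L : Language.{u}} {V : Type v}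

theorem mll_tensor_pair {A B A' B' : Fm L V 0} (hA : MLL1 (A ::ₘ {A'})) (hB : MLL1 (B ::ₘ {B'})) :
    MLL1 (.tensor A B ::ₘ {A', B'}) := by
  have h := MLL1.tensor _ _ A B hA hB
  rwa [Multiset.singleton_add] at h

/-- Identity is an axiom for atoms only. Quantifying over renamings makes the induction hypothesis
applicable to instances of the body of a quantifier. -/
theorem mll_id_rename [Infinite V] {n : ℕ} (A : Fm L V n) : ∀ ρ : Slot V n → Slot V 0,
    MLL1 ((A.rename ρ).dual ::ₘ {A.rename ρ}) := by
  induction A with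
  | pos p e => exact fun ρ => MLL1.id _ trivial
  | neg p e => exact fun ρ => MLL1.id _ trivial
  | tensor A B hA hB =>
    intro ρ
    refine MLL1.par _ _ _ ?_
    have h := mll_tensor_pair (A' := (A.rename ρ).dual) (B' := (B.rename ρ).dual)
      (by rw [← Multiset.insert_eq_cons, Multiset.pair_comm]; exact hA ρ)
      (by rw [← Multiset.insert_eq_cons, Multiset.pair_comm]; exact hB ρ)
    rw [Multiset.insert_eq_cons, Multiset.cons_swap] at h
    rw [Multiset.cons_swap]
    convert h using 2
    rw [← Multiset.insert_eq_cons, Multiset.pair_comm]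
    rfl
  | par A B hA hB =>
    intro ρ
    rw [← Multiset.insert_eq_cons, Multiset.pair_comm]
    refine MLL1.par _ _ _ ?_
    have h := mll_tensor_pair (hB ρ) (hA ρ)
    rw [Multiset.pair_comm, Multiset.insert_eq_cons, Multiset.cons_swap] at h
    convert h using 2
    rw [← Multiset.insert_eq_cons, Multiset.pair_comm]
    rfl
  | all A hA =>
    intro ρ
    obtain ⟨x, -, hx⟩ := Fm.exists_fresh
      (((Fm.all A).rename ρ) ::ₘ {((Fm.all A).rename ρ).dual}) ∅ Set.finite_empty
    rw [← Multiset.insert_eq_cons, Multiset.pair_comm]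
    refine MLL1.all _ _ x hx ?_
    rw [← Multiset.insert_eq_cons, Multiset.pair_comm]
    refine MLL1.ex _ _ x ?_
    rw [Fm.inst_dual, Fm.inst_rename]
    exact hA _
  | ex A hA =>
    intro ρ
    obtain ⟨x, -, hx⟩ := Fm.exists_fresh
      (((Fm.ex A).rename ρ).dual ::ₘ {(Fm.ex A).rename ρ}) ∅ Set.finite_empty
    refine MLL1.all _ _ x hx ?_
    rw [← Multiset.insert_eq_cons, Multiset.pair_comm]
    refine MLL1.ex _ _ x ?_
    rw [← Multiset.insert_eq_cons, Multiset.pair_comm, Fm.inst_dual, Fm.inst_rename]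
    exact hA _

theorem mll_id [Infinite V] (A : Fm L V 0) : MLL1 (A.dual ::ₘ {A}) := by
  have := mll_id_rename A id
  rwa [Fm.rename_id] at this

theorem mll_id' [Infinite V] (A : Fm L V 0) : MLL1 (A ::ₘ {A.dual}) := by
  have := mll_id A.dual
  rwa [Fm.dual_dual] at this

/-- A cut against the identity expansion of the dual tensor formula; `mll_all_inv` inverts `∀` in
the same way. -/
theorem mll_par_inv [Infinite V] {A B : Fm L V 0} {Γ : Multiset (Fm L V 0)}
    (h : MLL1 (.par A B ::ₘ Γ)) : MLL1 (A ::ₘ B ::ₘ Γ) := by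
  have h1 := MLL1.cut Γ {B, A} (.par A B) h (mll_tensor_pair (mll_id B) (mll_id A))
  convert h1 using 1
  rw [add_comm, Multiset.insert_eq_cons, Multiset.cons_add, Multiset.singleton_add,
    Multiset.cons_swap]

theorem mll_all_inv [Infinite V] {A : Fm L V 1} {Γ : Multiset (Fm L V 0)}
    (h : MLL1 (.all A ::ₘ Γ)) (x : V) : MLL1 (A.inst x ::ₘ Γ) := by
  have h1 : MLL1 (.ex A.dual ::ₘ {A.inst x}) := MLL1.ex _ _ x (by
    rw [Fm.inst_dual]; exact mll_id _)
  have h2 := MLL1.cut Γ {A.inst x} (.all A) h h1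
  rwa [add_comm, Multiset.singleton_add] at h2

theorem mll_mp [Infinite V] {A B : Fm L V 0} {Γ Θ : Multiset (Fm L V 0)} (h₁ : MLL1 (A ::ₘ Γ))
    (h₂ : MLL1 (A.dual ::ₘ B ::ₘ Θ)) : MLL1 (B ::ₘ (Γ + Θ)) := by
  have h := MLL1.cut Γ (B ::ₘ Θ) A h₁ h₂
  rwa [Multiset.add_cons] at h

theorem mll_tensor_elim {A B C : Fm L V 0} {Γ Θ : Multiset (Fm L V 0)}
    (h₁ : MLL1 (.tensor A B ::ₘ Γ)) (h₂ : MLL1 (C ::ₘ A.dual ::ₘ B.dual ::ₘ Θ)) :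
    MLL1 (C ::ₘ (Γ + Θ)) := by
  have h := MLL1.cut Γ (C ::ₘ Θ) (.tensor A B) h₁ (MLL1.par _ _ _ (by
    convert h₂ using 1
    simp only [← Multiset.singleton_add]
    abel))
  rwa [Multiset.add_cons] at h

end FirstOrder

/-! ### Terms over tagged letters, and lifting β-equivalence to them. -/

section Labels

variable {V : Type v} {T K : Type w}

/-- Relabelling of the letters. -/
def Gen.relabel (h : K → T) : Gen V K → Gen V T
  | .reg x i j => .reg (x.map h) i j
  | .sing x => .sing (x.map h)
  | .var X => .var X

/-- The letters of a generator. -/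
def Gen.letters : Gen V K → Multiset K
  | .reg x _ _ => x
  | .sing x => x
  | .var _ => 0

namespace Term

/-- The letters of a term. -/
def letters (t : Term V K) : Multiset K := t.bind Gen.letters

@[simp] theorem letters_add (t s : Term V K) : Term.letters (t + s) = t.letters + s.letters :=
  Multiset.add_bind _ _ _

@[simp] theorem letters_cons (g : Gen V K) (t : Term V K) :
    Term.letters (g ::ₘ t) = g.letters + t.letters := Multiset.cons_bind _ _ _

@[simp] theorem letters_singleton (g : Gen V K) : Term.letters ({g} : Term V K) = g.letters :=
  Multiset.singleton_bind _ _

@[simp] theorem letters_zero : Term.letters (0 : Term V K) = 0 := rfl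

theorem up_relabel (h : K → T) (t : Term V K) : Term.up (t.map (Gen.relabel h)) = t.up := by
  rw [Term.up, Multiset.bind_map]
  exact Multiset.bind_congr fun g _ => by cases g <;> rfl

theorem lo_relabel (h : K → T) (t : Term V K) : Term.lo (t.map (Gen.relabel h)) = t.lo := by
  rw [Term.lo, Multiset.bind_map]
  exact Multiset.bind_congr fun g _ => by cases g <;> rfl

theorem var_mem_relabel (h : K → T) (t : Term V K) (X : TVar V) :
    Gen.var X ∈ t.map (Gen.relabel h) ↔ Gen.var X ∈ t := by
  rw [Multiset.mem_map]
  constructor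
  · rintro ⟨g, hg, hX⟩
    cases g <;> simp only [Gen.relabel, reduceCtorEq, Gen.var.injEq] at hX
    exact hX ▸ hg
  · exact fun hX => ⟨_, hX, rfl⟩

theorem isTerm_relabel (h : K → T) (t : Term V K) :
    IsTerm (t.map (Gen.relabel h)) ↔ t.IsTerm := by
  simp only [IsTerm, up_relabel, lo_relabel, var_mem_relabel]

end Term

theorem Gen.relabel_eq_reg {h : K → T} {g : Gen V K} {x : List T} {i j : V}
    (e : g.relabel h = .reg x i j) : ∃ y, g = .reg y i j ∧ y.map h = x := by
  cases g <;> simp only [Gen.relabel, reduceCtorEq, Gen.reg.injEq] at e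
  obtain ⟨rfl, rfl, rfl⟩ := e
  exact ⟨_, rfl, rfl⟩

theorem Gen.relabel_eq_sing {h : K → T} {g : Gen V K} {x : List T}
    (e : g.relabel h = .sing x) : ∃ y, g = .sing y ∧ y.map h = x := by
  cases g <;> simp only [Gen.relabel, reduceCtorEq, Gen.sing.injEq] at e
  exact ⟨_, rfl, e⟩

/-- A generator without letters leaves no freedom for tags, so it is its only lift. -/
theorem Gen.relabel_inj_of_letters {h : K → T} {g g' : Gen V K} (hg' : g'.letters = 0)
    (e : g.relabel h = g'.relabel h) : g = g' := by
  cases g' with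
  | reg x i j =>
    obtain rfl : x = [] := Multiset.coe_eq_zero _ |>.1 hg'
    obtain ⟨y, rfl, hy⟩ := Gen.relabel_eq_reg e
    rw [List.map_nil, List.map_eq_nil_iff] at hy
    rw [hy]
  | sing x =>
    obtain rfl : x = [] := Multiset.coe_eq_zero _ |>.1 hg'
    obtain ⟨y, rfl, hy⟩ := Gen.relabel_eq_sing e
    rw [List.map_nil, List.map_eq_nil_iff] at hy
    rw [hy]
  | var X => cases g <;> simp_all [Gen.relabel]

theorem Term.exists_of_relabel_eq_add {h : K → T} (N : Term V K) (hN : N.letters = 0) :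
    ∀ {t : Term V K} {s : Term V T}, t.map (Gen.relabel h) = N.map (Gen.relabel h) + s →
      ∃ t', t = N + t' ∧ t'.map (Gen.relabel h) = s := by
  induction N using Multiset.induction_on with
  | empty => exact fun {t s} e => ⟨t, by simp, by simpa using e⟩
  | cons g N ih =>
    intro t s e
    rw [letters_cons, add_eq_zero] at hN
    rw [Multiset.map_cons, Multiset.cons_add] at e
    obtain ⟨g', t, rfl, hg, h1⟩ := exists_eq_cons_of_map_eq_cons e
    obtain rfl := Gen.relabel_inj_of_letters hN.1 hg
    obtain ⟨t', rfl, h2⟩ := ih hN.2 h1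
    exact ⟨t', by rw [Multiset.cons_add], h2⟩

namespace Term

/-- Reduction concatenates and rotates words without inspecting their letters, so the tags are
simply carried along. -/
theorem BetaStep.lift {h : K → T} {t t' : Term V T} (hb : BetaStep t t') {u : Term V K}
    (hu : u.map (Gen.relabel h) = t) :
    ∃ u' : Term V K, u'.map (Gen.relabel h) = t' ∧ BetaStep u u' := by
  cases hb with
  | contract x y i j k s hs =>
    obtain ⟨g, u, rfl, hg, hu'⟩ := exists_eq_cons_of_map_eq_cons hu
    obtain ⟨g', u, rfl, hg', rfl⟩ := exists_eq_cons_of_map_eq_cons hu'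
    obtain ⟨x, rfl, rfl⟩ := Gen.relabel_eq_reg hg
    obtain ⟨y, rfl, rfl⟩ := Gen.relabel_eq_reg hg'
    refine ⟨Gen.reg (x ++ y) i k ::ₘ u, by simp [Gen.relabel], BetaStep.contract _ _ _ _ _ _ ?_⟩
    rwa [← isTerm_relabel h, hu]
  | loop x i s hs =>
    obtain ⟨g, u, rfl, hg, rfl⟩ := exists_eq_cons_of_map_eq_cons hu
    obtain ⟨x, rfl, rfl⟩ := Gen.relabel_eq_reg hg
    refine ⟨Gen.sing x ::ₘ u, by simp [Gen.relabel], BetaStep.loop _ _ _ ?_⟩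
    rwa [← isTerm_relabel h, hu]
  | empty s hs =>
    obtain ⟨g, u, rfl, hg, rfl⟩ := exists_eq_cons_of_map_eq_cons hu
    obtain ⟨x, rfl, hx⟩ := Gen.relabel_eq_sing hg
    obtain rfl := List.map_eq_nil_iff.1 hx
    refine ⟨u, rfl, BetaStep.empty _ ?_⟩
    rwa [← isTerm_relabel h, hu]
  | rotate x a s hs =>
    obtain ⟨g, u, rfl, hg, rfl⟩ := exists_eq_cons_of_map_eq_cons hu
    obtain ⟨y, rfl, hx⟩ := Gen.relabel_eq_sing hg
    obtain ⟨y, z, rfl, rfl, hz⟩ := List.map_eq_append_iff.1 hx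
    obtain ⟨a', z, rfl, rfl, hz'⟩ := List.map_eq_cons_iff.1 hz
    obtain rfl := List.map_eq_nil_iff.1 hz'
    refine ⟨Gen.sing (a' :: y) ::ₘ u, by simp [Gen.relabel], BetaStep.rotate _ _ _ ?_⟩
    rwa [← isTerm_relabel h, hu]

theorem BetaStep.lift_symm {h : K → T} {t t' : Term V T} (hb : BetaStep t t') {u' : Term V K}
    (hu : u'.map (Gen.relabel h) = t') :
    ∃ u : Term V K, u.map (Gen.relabel h) = t ∧ BetaStep u u' := by
  cases hb with
  | contract x y i j k s hs =>
    obtain ⟨g, u, rfl, hg, rfl⟩ := exists_eq_cons_of_map_eq_cons hu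
    obtain ⟨z, rfl, hz⟩ := Gen.relabel_eq_reg hg
    obtain ⟨x, y, rfl, rfl, rfl⟩ := List.map_eq_append_iff.1 hz
    have e : (Gen.reg x i j ::ₘ Gen.reg y j k ::ₘ u : Term V K).map (Gen.relabel h) =
      Gen.reg (x.map h) i j ::ₘ Gen.reg (y.map h) j k ::ₘ u.map (Gen.relabel h) := by
        simp [Gen.relabel]
    refine ⟨_, e, BetaStep.contract _ _ _ _ _ _ ?_⟩
    rwa [← isTerm_relabel h, e]
  | loop x i s hs =>
    obtain ⟨g, u, rfl, hg, rfl⟩ := exists_eq_cons_of_map_eq_cons hu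
    obtain ⟨x, rfl, rfl⟩ := Gen.relabel_eq_sing hg
    have e : (Gen.reg x i i ::ₘ u : Term V K).map (Gen.relabel h) =
      Gen.reg (x.map h) i i ::ₘ u.map (Gen.relabel h) := by simp [Gen.relabel]
    refine ⟨_, e, BetaStep.loop _ _ _ ?_⟩
    rwa [← isTerm_relabel h, e]
  | empty s hs =>
    have e : (Gen.sing [] ::ₘ u' : Term V K).map (Gen.relabel h) = Gen.sing [] ::ₘ t' := by
      simp [Gen.relabel, hu]
    refine ⟨_, e, BetaStep.empty _ ?_⟩
    rwa [← isTerm_relabel h, e]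
  | rotate x a s hs =>
    obtain ⟨g, u, rfl, hg, rfl⟩ := exists_eq_cons_of_map_eq_cons hu
    obtain ⟨y, rfl, hx⟩ := Gen.relabel_eq_sing hg
    obtain ⟨a, x, rfl, rfl, rfl⟩ := List.map_eq_cons_iff.1 hx
    have e : (Gen.sing (x ++ [a]) ::ₘ u : Term V K).map (Gen.relabel h) =
      Gen.sing (x.map h ++ [h a]) ::ₘ u.map (Gen.relabel h) := by simp [Gen.relabel]
    refine ⟨_, e, BetaStep.rotate _ _ _ ?_⟩
    rwa [← isTerm_relabel h, e]

/-- The two directions are proved together because symmetry of β-equivalence exchanges them. -/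
theorem BetaEq.lift {h : K → T} {t t' : Term V T} (hb : BetaEq t t') :
    (∀ u : Term V K, u.map (Gen.relabel h) = t →
      ∃ u' : Term V K, u'.map (Gen.relabel h) = t' ∧ BetaEq u u') ∧
    (∀ u' : Term V K, u'.map (Gen.relabel h) = t' →
      ∃ u : Term V K, u.map (Gen.relabel h) = t ∧ BetaEq u u') := by
  induction hb with
  | rel _ _ hb =>
    refine ⟨fun u hu => ?_, fun u' hu' => ?_⟩
    · obtain ⟨u', hu', h⟩ := hb.lift hu
      exact ⟨u', hu', .rel _ _ h⟩
    · obtain ⟨u, hu, h⟩ := hb.lift_symm hu'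
      exact ⟨u, hu, .rel _ _ h⟩
  | refl t => exact ⟨fun u hu => ⟨u, hu, .refl _⟩, fun u hu => ⟨u, hu, .refl _⟩⟩
  | symm _ _ _ ih =>
    refine ⟨fun u hu => ?_, fun u' hu' => ?_⟩
    · obtain ⟨u', hu', h⟩ := ih.2 u hu
      exact ⟨u', hu', .symm _ _ h⟩
    · obtain ⟨u, hu, h⟩ := ih.1 u' hu'
      exact ⟨u, hu, .symm _ _ h⟩
  | trans _ _ _ _ _ ih₁ ih₂ =>
    refine ⟨fun u hu => ?_, fun u' hu' => ?_⟩
    · obtain ⟨u', hu', h⟩ := ih₁.1 u hu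
      obtain ⟨u'', hu'', h'⟩ := ih₂.1 u' hu'
      exact ⟨u'', hu'', .trans _ _ _ h h'⟩
    · obtain ⟨u, hu, h⟩ := ih₂.2 u' hu'
      obtain ⟨u'', hu'', h'⟩ := ih₁.2 u hu
      exact ⟨u'', hu'', .trans _ _ _ h' h⟩

end Term

end Labels

/-! ### Words as paths, and the decomposition of a simple path into words. -/

section Paths

variable {V : Type v} {K : Type w} (src tgt : K → V)

/-- The letters of the word form a path, with respect to the given end points of the letters. -/
def Path : V → List K → V → Prop
  | p, [], q => p = q
  | p, a :: x, q => src a = p ∧ Path (tgt a) x q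

variable {src tgt}

theorem path_append {x y : List K} : ∀ {p q : V},
    Path src tgt p (x ++ y) q ↔ ∃ m, Path src tgt p x m ∧ Path src tgt m y q := by
  induction x with
  | nil => intro p q; simp [Path]
  | cons a x ih =>
    intro p q
    simp only [List.cons_append, Path, ih]
    tauto

/-- The points visited can be listed by sources or by targets. For a path without repeated points it
follows that no letter ends in its starting point. -/
theorem Path.points {x : List K} : ∀ {p q : V}, Path src tgt p x q →
    p :: x.map tgt = x.map src ++ [q] := by
  induction x with
  | nil => rintro p q rfl; rfl
  | cons a x ih =>
    rintro p q ⟨rfl, h⟩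
    rw [List.map_cons, List.map_cons, ih h, List.cons_append]

theorem Path.congr {src' tgt' : K → V} {x : List K} : ∀ {p q : V}, Path src tgt p x q →
    (∀ a ∈ x, src' a = src a ∧ tgt' a = tgt a) → Path src' tgt' p x q := by
  induction x with
  | nil => exact fun {p q} h _ => h
  | cons a x ih =>
    rintro p q ⟨rfl, h⟩ hc
    obtain ⟨h1, h2⟩ := hc a List.mem_cons_self
    exact ⟨h1, h2 ▸ ih h fun b hb => hc b (List.mem_cons_of_mem _ hb)⟩

/-- Along a path without repeated points a letter is determined by its source, so both words have to
agree letter by letter from their common start. -/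
theorem Path.prefix {q : V} {w : List K} : ∀ {x : List K} {p q' : V}, Path src tgt p w q' →
    Path src tgt p x q → (x.map src ++ [q]).Nodup → w.Nodup → (∀ a ∈ w, a ∈ x) →
    ∃ y, x = w ++ y ∧ Path src tgt q' y q := by
  induction w with
  | nil => rintro x p q' rfl hx - - -; exact ⟨x, rfl, hx⟩
  | cons b w ih =>
    rintro x p q' ⟨hb, hw⟩ hx hn hwn hsub
    cases x with
    | nil => exact absurd (hsub b List.mem_cons_self) (by simp)
    | cons a x =>
      obtain ⟨ha, hx⟩ := hx
      simp only [List.map_cons, List.cons_append, List.nodup_cons, List.mem_append,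
        List.mem_map, not_or, not_exists, not_and] at hn
      have hba : b = a := by
        refine (List.mem_cons.1 (hsub b List.mem_cons_self)).resolve_right fun h => ?_
        exact hn.1.1 b h (hb.trans ha.symm)
      subst hba
      obtain ⟨y, rfl, hy⟩ := ih hw hx hn.2 (List.nodup_cons.1 hwn).2 fun c hc =>
        (List.mem_cons.1 (hsub c (List.mem_cons_of_mem _ hc))).resolve_left fun h =>
          (List.nodup_cons.1 hwn).1 (h ▸ hc)
      exact ⟨y, rfl, hy⟩

/-- The path is built from its end: each letter put in front gets a new starting point. Since the
letters are different, this leaves the rest of the path as it was. -/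
theorem exists_path [Infinite V] {x : List K} (hx : x.Nodup) :
    ∃ (src tgt : K → V) (p q : V), Path src tgt p x q ∧ (x.map src ++ [q]).Nodup := by
  classical
  induction x with
  | nil =>
    obtain ⟨p⟩ := (inferInstance : Nonempty V)
    exact ⟨fun _ => p, fun _ => p, p, p, rfl, by simp⟩
  | cons a x ih =>
    obtain ⟨ha, hx⟩ := List.nodup_cons.1 hx
    obtain ⟨src, tgt, p, q, h1, h2⟩ := ih hx
    obtain ⟨p', hp'⟩ := Infinite.exists_notMem_finset (x.map src ++ [q]).toFinset
    have hne : ∀ b ∈ x, b ≠ a := fun b hb h => ha (h ▸ hb)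
    have hmap : x.map (Function.update src a p') = x.map src :=
      List.map_congr_left fun b hb => Function.update_of_ne (hne b hb) _ _
    refine ⟨Function.update src a p', Function.update tgt a p, p', q, ⟨by simp, ?_⟩, ?_⟩
    · rw [Function.update_self]
      exact h1.congr fun b hb => ⟨Function.update_of_ne (hne b hb) _ _,
        Function.update_of_ne (hne b hb) _ _⟩
    · rw [List.map_cons, List.cons_append, List.nodup_cons, hmap, Function.update_self]
      exact ⟨fun h => hp' (List.mem_toFinset.2 h), h2⟩

/-- The initial point of a word; `d` for the empty word. -/
def firstPt (d : V) (src : K → V) (x : List K) : V := (x.head?.map src).getD d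

/-- The final point of a word; `d` for the empty word. -/
def lastPt (d : V) (tgt : K → V) (x : List K) : V := (x.getLast?.map tgt).getD d

theorem Path.firstPt_eq {d p q : V} {x : List K} (h : Path src tgt p x q) (hx : x ≠ []) :
    firstPt d src x = p := by
  cases x with
  | nil => exact absurd rfl hx
  | cons a x => exact h.1

theorem Path.lastPt_eq {d p q : V} {x : List K} (h : Path src tgt p x q) (hx : x ≠ []) :
    lastPt d tgt x = q := by
  obtain rfl | ⟨y, a, rfl⟩ := List.eq_nil_or_concat x
  · exact absurd rfl hx
  · rw [List.concat_eq_append] at h ⊢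
    obtain ⟨m, -, -, h⟩ := path_append.1 h
    simpa [lastPt, Path] using h

/-- The word that contains the first letter of `x` must begin with it, and then it is a prefix of
`x`; removing it leaves the same situation for a shorter path. Nonemptiness of the words makes the
cut points different. -/
theorem exists_order {β : Type*} {d d' q : V} {n : ℕ} : ∀ {E : Multiset (List K × β)} {p : V}
    {x : List K}, E.card = n → Path src tgt p x q → (x.map src ++ [q]).Nodup →
    (E.bind fun e => (e.1 : Multiset K)) = x →
    (∀ e ∈ E, e.1 ≠ [] ∧ Path src tgt (firstPt d src e.1) e.1 (lastPt d' tgt e.1)) →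
    ∃ (e : Fin n → List K × β) (c : Fin (n + 1) → V), E = Finset.univ.val.map e ∧
      x = (List.ofFn fun i => (e i).1).flatten ∧ c 0 = p ∧ c (Fin.last n) = q ∧
      Function.Injective c ∧ (∀ k, c k ∈ x.map src ++ [q]) ∧
      ∀ i, firstPt d src (e i).1 = c i.castSucc ∧ lastPt d' tgt (e i).1 = c i.succ := by
  induction n with
  | zero =>
    intro E p x hE hx hn hb _
    rw [Multiset.card_eq_zero] at hE
    subst hE
    obtain rfl : x = [] := Multiset.coe_eq_zero _ |>.1 hb.symm
    obtain rfl : p = q := hx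
    refine ⟨Fin.elim0, fun _ => p, rfl, rfl, rfl, rfl, fun i j _ => Subsingleton.elim (α := Fin 1) i j, ?_,
      fun i => i.elim0⟩
    simp
  | succ n ih =>
    intro E p x hE hx hn hb hp
    have hmem : ∀ a, a ∈ x ↔ ∃ e ∈ E, a ∈ e.1 := fun a => by
      rw [← Multiset.mem_coe, ← hb, Multiset.mem_bind]; rfl
    cases x with
    | nil =>
      obtain ⟨e, he⟩ := Multiset.card_pos_iff_exists_mem.1 (by omega : 0 < E.card)
      obtain ⟨a, ha⟩ := List.exists_mem_of_ne_nil _ (hp e he).1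
      exact absurd ((hmem a).2 ⟨e, he, ha⟩) (by simp)
    | cons a y =>
      obtain ⟨e, he, hae⟩ := (hmem a).1 List.mem_cons_self
      obtain ⟨E, rfl⟩ := Multiset.exists_cons_of_mem he
      obtain ⟨hne, hpe⟩ := hp e he
      -- If a letter `b` preceded `a` inside its word, `b` would end in the starting point of the
      -- whole path, which is the target of no letter.
      have hpa : firstPt d src e.1 = p := by
        obtain ⟨u, z, hu⟩ := List.append_of_mem hae
        obtain rfl | ⟨u, b, rfl⟩ := List.eq_nil_or_concat u
        · rw [hu]; exact hx.1
        · exfalso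
          rw [hu, List.concat_eq_append] at hpe
          obtain ⟨m, h1, h2, -⟩ := path_append.1 hpe
          obtain ⟨m', -, -, h4⟩ := path_append.1 h1
          have h5 : tgt b = p := h4.trans (h2.symm.trans hx.1)
          have hn' := hn
          rw [← hx.points, List.nodup_cons] at hn'
          refine hn'.1 (h5 ▸ List.mem_map_of_mem ((hmem b).2 ⟨e, he, ?_⟩))
          rw [hu]; simp
      rw [hpa] at hpe
      have hnx : (a :: y).Nodup := (List.nodup_append.1 hn).1.of_map
      have hbe : (e.1 : Multiset K) + (E.bind fun e => (e.1 : Multiset K)) = ((a :: y : List K)) := by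
        rw [← hb, Multiset.cons_bind]
      have hen : e.1.Nodup := by
        rw [← Multiset.coe_nodup] at hnx ⊢
        rw [← hbe] at hnx
        exact (Multiset.nodup_add.1 hnx).1
      obtain ⟨z, hz, hpz⟩ := hpe.prefix hx hn hen fun b hb => (hmem b).2 ⟨e, he, hb⟩
      rw [hz] at hn hbe ⊢
      rw [← Multiset.coe_add] at hbe
      rw [List.map_append, List.append_assoc] at hn ⊢
      obtain ⟨-, hnz, hdisj⟩ := List.nodup_append.1 hn
      obtain ⟨e', c, rfl, hz', hc0, hcl, hcinj, hcm, hec⟩ := ih (by simpa using hE) hpz hnz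
        (add_left_cancel hbe) fun e' he' => hp e' (Multiset.mem_cons_of_mem he')
      refine ⟨Fin.cons e e', Fin.cons p c, ?_, ?_, rfl, ?_, ?_, ?_, ?_⟩
      · rw [univ_map_succ]; rfl
      · rw [hz']; simp [List.ofFn_succ]
      · rw [← Fin.succ_last, Fin.cons_succ, hcl]
      · rw [Fin.cons_injective_iff]
        -- `p` is the source of the first letter removed, whereas the remaining cut points lie on
        -- the rest of the path.
        refine ⟨?_, hcinj⟩
        rintro ⟨k, hk⟩
        have hp1 : p ∈ e.1.map src := by
          rw [← hpa]
          cases he1 : e.1 with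
          | nil => exact absurd he1 hne
          | cons b w => simp [firstPt]
        exact hdisj p hp1 (c k) (hcm k) hk.symm
      · intro k
        refine Fin.cases ?_ (fun k => ?_) k
        · rw [Fin.cons_zero, ← hpa]
          refine List.mem_append_left _ ?_
          cases he1 : e.1 with
          | nil => exact absurd he1 hne
          | cons b w => simp [firstPt]
        · rw [Fin.cons_succ]; exact List.mem_append_right _ (hcm k)
      · intro i
        refine Fin.cases ⟨hpa, hc0.symm⟩ (fun i => ?_) i
        exact hec i

end Paths

/-! ### Satisfaction of terms by assignments of points, and its invariance under β-equivalence. -/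

section Satisfaction

variable {V : Type v} {K : Type w}

/-- Under the assignment `f` of points to indices the word on an edge is a path between the points
of the end indices of the edge. -/
def Gen.Holds (src tgt : K → V) (f : V → V) : Gen V K → Prop
  | .reg x i j => Path src tgt (f i) x (f j)
  | .sing x => ∃ p, Path src tgt p x p
  | .var _ => True

theorem Gen.Holds.congr {src tgt : K → V} {f f' : V → V} {g : Gen V K} (h : g.Holds src tgt f)
    (hf : ∀ k, k ∈ g.up ∨ k ∈ g.lo → f' k = f k) : g.Holds src tgt f' := by
  cases g with
  | reg x i j =>
    have hi := hf i (by simp)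
    have hj := hf j (by simp)
    simp only [Gen.Holds] at h ⊢
    rwa [hi, hj]
  | sing x => exact h
  | var X => trivial

namespace Term

/-- All edges of the term are paths. -/
def Sat (src tgt : K → V) (f : V → V) (t : Term V K) : Prop := ∀ g ∈ t, g.Holds src tgt f

variable {src tgt : K → V} {f f' : V → V}

theorem Sat.congr {t : Term V K} (h : t.Sat src tgt f)
    (hf : ∀ k, k ∈ t.up ∨ k ∈ t.lo → f' k = f k) : t.Sat src tgt f' := fun g hg =>
  (h g hg).congr fun k hk => hf k (hk.imp (fun h => Multiset.mem_bind.2 ⟨g, hg, h⟩)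
    fun h => Multiset.mem_bind.2 ⟨g, hg, h⟩)

@[simp] theorem sat_add {t s : Term V K} :
    Term.Sat src tgt f (t + s) ↔ t.Sat src tgt f ∧ s.Sat src tgt f := by
  simp only [Sat, Multiset.mem_add, or_imp, forall_and]

@[simp] theorem sat_cons {g : Gen V K} {s : Term V K} :
    Term.Sat src tgt f (g ::ₘ s) ↔ g.Holds src tgt f ∧ s.Sat src tgt f := by
  simp only [Sat, Multiset.mem_cons, forall_eq_or_imp]

@[simp] theorem sat_singleton {g : Gen V K} :
    Term.Sat src tgt f ({g} : Term V K) ↔ g.Holds src tgt f := by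
  simp only [Sat, Multiset.mem_singleton, forall_eq]

@[simp] theorem sat_zero : Term.Sat src tgt f (0 : Term V K) := by
  simp [Sat]

theorem BetaStep.letters_eq {t t' : Term V K} (h : BetaStep t t') : t.letters = t'.letters := by
  cases h with
  | contract x y i j k s hs => simp [Gen.letters, ← add_assoc]
  | loop x i s hs => simp [Gen.letters]
  | empty s hs => simp [Gen.letters]
  | rotate x a s hs =>
    simp only [letters_cons, Gen.letters, ← Multiset.coe_add, ← Multiset.cons_coe]
    rw [Multiset.coe_nil, Multiset.cons_zero, add_comm (x : Multiset K), Multiset.singleton_add]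

theorem BetaStep.var_mem_iff {t t' : Term V K} (h : BetaStep t t') (X : TVar V) :
    Gen.var X ∈ t ↔ Gen.var X ∈ t' := by
  cases h <;> simp

theorem BetaStep.sat {t t' : Term V K} (h : BetaStep t t') (hf : t.Sat src tgt f) :
    t'.Sat src tgt f := by
  cases h with
  | contract x y i j k s hs =>
    simp only [sat_cons, Gen.Holds] at hf ⊢
    exact ⟨path_append.2 ⟨_, hf.1, hf.2.1⟩, hf.2.2⟩
  | loop x i s hs =>
    simp only [sat_cons, Gen.Holds] at hf ⊢
    exact ⟨⟨_, hf.1⟩, hf.2⟩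
  | empty s hs => exact (sat_cons.1 hf).2
  | rotate x a s hs =>
    simp only [sat_cons, Gen.Holds] at hf ⊢
    obtain ⟨⟨p, hp⟩, hs⟩ := hf
    obtain ⟨m, h1, h2, h3⟩ := path_append.1 hp
    exact ⟨⟨m, h2, h3 ▸ h1⟩, hs⟩

variable [DecidableEq V]

/-- The index is free in the term or belongs to a tensor variable of it. -/
def Rigid (t : Term V K) (k : V) : Prop :=
  t.up.count k ≠ t.lo.count k ∨ ∃ X : TVar V, Gen.var X ∈ t ∧ (k ∈ X.up ∨ k ∈ X.lo)

/-- Undoing a contraction brings a bound index back, whose value is the point where the path of the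
contracted edge splits. No rigid index is reassigned. -/
theorem BetaStep.sat_symm [Nonempty V] {t t' : Term V K} (h : BetaStep t t') (hf : t'.Sat src tgt f) :
    ∃ f', (∀ k, t.Rigid k → f' k = f k) ∧ t.Sat src tgt f' := by
  cases h with
  | contract x y i j k s hs =>
    simp only [sat_cons, Gen.Holds] at hf
    obtain ⟨hf, hfs⟩ := hf
    obtain ⟨m, h1, h2⟩ := path_append.1 hf
    obtain ⟨hu, hl, -⟩ := hs
    simp only [up_cons, lo_cons, Gen.up_reg, Gen.lo_reg, Multiset.singleton_add,
      Multiset.nodup_cons, Multiset.mem_cons, not_or] at hu hl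
    refine ⟨Function.update f j m, fun z hz => Function.update_of_ne ?_ _ _, ?_⟩
    · rintro rfl
      rcases hz with hz | ⟨X, hX, hz⟩
      · apply hz
        simp [hu.1.1, Ne.symm hl.1.1,
          Multiset.count_eq_zero_of_notMem hu.1.2, Multiset.count_eq_zero_of_notMem hl.2.1]
      · replace hX : Gen.var X ∈ s := by simpa using hX
        exact hz.elim (fun h => hu.1.2 (Multiset.mem_bind.2 ⟨_, hX, h⟩))
          fun h => hl.2.1 (Multiset.mem_bind.2 ⟨_, hX, h⟩)
    · simp only [sat_cons, Gen.Holds]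
      rw [Function.update_self, Function.update_of_ne hl.1.1,
        Function.update_of_ne (Ne.symm hu.1.1)]
      refine ⟨h1, h2, hfs.congr fun z hz => Function.update_of_ne ?_ _ _⟩
      rintro rfl
      exact hz.elim hu.1.2 hl.2.1
  | loop x i s hs =>
    simp only [sat_cons, Gen.Holds] at hf
    obtain ⟨⟨p, hp⟩, hfs⟩ := hf
    obtain ⟨hu, hl, -⟩ := hs
    simp only [up_cons, lo_cons, Gen.up_reg, Gen.lo_reg, Multiset.singleton_add,
      Multiset.nodup_cons] at hu hl
    refine ⟨Function.update f i p, fun z hz => Function.update_of_ne ?_ _ _, ?_⟩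
    · rintro rfl
      rcases hz with hz | ⟨X, hX, hz⟩
      · apply hz
        simp [Multiset.count_eq_zero_of_notMem hu.1, Multiset.count_eq_zero_of_notMem hl.1]
      · replace hX : Gen.var X ∈ s := by simpa using hX
        exact hz.elim (fun h => hu.1 (Multiset.mem_bind.2 ⟨_, hX, h⟩))
          fun h => hl.1 (Multiset.mem_bind.2 ⟨_, hX, h⟩)
    · simp only [sat_cons, Gen.Holds]
      rw [Function.update_self]
      refine ⟨hp, hfs.congr fun z hz => Function.update_of_ne ?_ _ _⟩
      rintro rfl
      exact hz.elim hu.1 hl.1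
  -- The empty loop is a closed path at any point, so some point has to exist.
  | empty s hs => exact ⟨f, fun _ _ => rfl, sat_cons.2 ⟨⟨Classical.arbitrary V, rfl⟩, hf⟩⟩
  | rotate x a s hs =>
    simp only [sat_cons, Gen.Holds] at hf
    obtain ⟨⟨p, h2, h1⟩, hfs⟩ := hf
    -- Rotating a closed path moves its base point, here to the target of the letter `a`.
    refine ⟨f, fun _ _ => rfl, sat_cons.2 ⟨⟨tgt a, path_append.2 ⟨p, h1, h2, rfl⟩⟩, hfs⟩⟩

/-- Terms that bound letters, tensor variables, and rigid indices cannot distinguish, and that are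
satisfied by the same assignments to rigid indices. -/
structure SatEquiv (t t' : Term V K) : Prop where
  letters_eq : t.letters = t'.letters
  var_mem_iff : ∀ X : TVar V, Gen.var X ∈ t ↔ Gen.var X ∈ t'
  rigid_iff : ∀ k, t.Rigid k ↔ t'.Rigid k
  sat : ∀ {src tgt : K → V} {f : V → V}, t.Sat src tgt f →
    ∃ f', (∀ k, t.Rigid k → f' k = f k) ∧ t'.Sat src tgt f'
  sat_symm : ∀ {src tgt : K → V} {f : V → V}, t'.Sat src tgt f →
    ∃ f', (∀ k, t.Rigid k → f' k = f k) ∧ t.Sat src tgt f'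

/-- Rigidity is invariant because β-steps preserve the surplus of upper over lower occurrences as
well as the tensor variables. Hence the reassignments of single steps can be composed. -/
theorem BetaEq.satEquiv [Nonempty V] {t t' : Term V K} (h : BetaEq t t') : SatEquiv t t' := by
  induction h with
  | rel t t' h =>
    refine ⟨h.letters_eq, h.var_mem_iff, fun k => ?_, fun hf => ⟨_, fun _ _ => rfl, h.sat hf⟩,
      h.sat_symm⟩
    have h1 := h.count k
    simp only [Rigid, h.var_mem_iff]
    exact or_congr_left (by omega)
  | refl t => exact ⟨rfl, fun _ => .rfl, fun _ => .rfl, fun h => ⟨_, fun _ _ => rfl, h⟩,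
      fun h => ⟨_, fun _ _ => rfl, h⟩⟩
  | symm _ _ _ ih =>
    refine ⟨ih.1.symm, fun X => (ih.2 X).symm, fun k => (ih.3 k).symm, fun h => ?_, fun h => ?_⟩
    · obtain ⟨f', h1, h2⟩ := ih.5 h
      exact ⟨f', fun k hk => h1 k ((ih.3 k).2 hk), h2⟩
    · obtain ⟨f', h1, h2⟩ := ih.4 h
      exact ⟨f', fun k hk => h1 k ((ih.3 k).2 hk), h2⟩
  | trans _ _ _ _ _ ih ih' =>
    refine ⟨ih.1.trans ih'.1, fun X => (ih.2 X).trans (ih'.2 X),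
      fun k => (ih.3 k).trans (ih'.3 k), fun h => ?_, fun h => ?_⟩
    · obtain ⟨f', h1, h2⟩ := ih.4 h
      obtain ⟨f'', h3, h4⟩ := ih'.4 h2
      exact ⟨f'', fun k hk => (h3 k ((ih.3 k).1 hk)).trans (h1 k hk), h4⟩
    · obtain ⟨f', h1, h2⟩ := ih'.5 h
      obtain ⟨f'', h3, h4⟩ := ih.5 h2
      exact ⟨f'', fun k hk => (h3 k hk).trans (h1 k ((ih.3 k).1 hk)), h4⟩

end Term

end Satisfaction

/-! ### The soundness invariant, and its general shape for rules with one and two premises. -/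

section Sound

variable {L : Language.{u}} {V : Type v} {T : Type w}

/-- The first order formulas of a context, dualized. -/
def ctxEv (Γ : Multiset (TVar V × TFm L V 0)) (f : V → V) : Multiset (Fm L V 0) :=
  Γ.map fun D => (D.2.ev f).dual

@[simp] theorem ctxEv_zero (f : V → V) : ctxEv (0 : Multiset (TVar V × TFm L V 0)) f = 0 := rfl

@[simp] theorem ctxEv_add (Γ Θ : Multiset (TVar V × TFm L V 0)) (f : V → V) :
    ctxEv (Γ + Θ) f = ctxEv Γ f + ctxEv Θ f := Multiset.map_add _ _ _

@[simp] theorem ctxEv_cons (D : TVar V × TFm L V 0) (Γ : Multiset (TVar V × TFm L V 0))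
    (f : V → V) : ctxEv (D ::ₘ Γ) f = (D.2.ev f).dual ::ₘ ctxEv Γ f := Multiset.map_cons _ _ _

variable [DecidableEq V]

theorem ctxEv_congr {Γ : Multiset (TVar V × TFm L V 0)} (hΓ : IsCtx T Γ) {f f' : V → V}
    (h : ∀ D ∈ Γ, ∀ k, k ∈ D.1.up ∨ k ∈ D.1.lo → f' k = f k) : ctxEv Γ f' = ctxEv Γ f := by
  refine Multiset.map_congr rfl fun D hD => ?_
  obtain ⟨-, h1, h2, -⟩ := (isCtx_iff.1 hΓ).1 D hD
  rw [TFm.ev_congr D.2 (fun i hi => h D hD i (Or.inr ?_)) fun i hi => h D hD i (Or.inl ?_)]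
  · rw [← h2] at hi; exact hi
  · rw [← h1] at hi; exact hi

theorem ctxEv_congr_of_var_mem {K : Type*} {Γ : Multiset (TVar V × TFm L V 0)} (hΓ : IsCtx T Γ)
    {t : Term V K} (ht : ∀ D ∈ Γ, Gen.var D.1 ∈ t) {f f' : V → V}
    (h : ∀ k, k ∈ t.up ∨ k ∈ t.lo → f' k = f k) : ctxEv Γ f' = ctxEv Γ f :=
  ctxEv_congr hΓ fun D hD k hk => h k (hk.imp
    (fun hk => Multiset.mem_bind.2 ⟨_, ht D hD, hk⟩) fun hk => Multiset.mem_bind.2 ⟨_, ht D hD, hk⟩)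

/-- The dualized formulas of lexical entries, between the end points of their words. -/
def entryFms {K : Type*} (l r : V) (src tgt : K → V) (E : Multiset (List K × Fm L V 0)) :
    Multiset (Fm L V 0) :=
  E.map fun e => (e.2.subst₂ l r (firstPt l src e.1) (lastPt l tgt e.1)).dual

@[simp] theorem entryFms_add {K : Type*} (l r : V) (src tgt : K → V)
    (E E' : Multiset (List K × Fm L V 0)) :
    entryFms l r src tgt (E + E') = entryFms l r src tgt E + entryFms l r src tgt E' :=
  Multiset.map_add _ _ _

/-- The letters of the term can be tagged, by numbers outside any given finite set, and distributed
over words of the lexicon, so that any assignment of points to indices which satisfies the term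
makes these words paths, and the first order translation of the sequent derivable from the
formulas of these words. -/
def Sound (l r : V) (lex : Set (List T × Fm L V 0)) (Γ : Multiset (TVar V × TFm L V 0))
    (t : Term V T) (A : TFm L V 0) : Prop :=
  (∀ D ∈ Γ, Gen.var D.1 ∈ t) ∧ ∀ F : Finset ℕ,
    ∃ (u : Term V (T × ℕ)) (E : Multiset (List (T × ℕ) × Fm L V 0)),
      u.map (Gen.relabel Prod.fst) = t ∧ u.letters = E.bind (fun e => (e.1 : Multiset (T × ℕ))) ∧
      u.letters.Nodup ∧ (∀ a ∈ u.letters, a.2 ∉ F) ∧ (∀ e ∈ E, (e.1.map Prod.fst, e.2) ∈ lex) ∧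
      ∀ (src tgt : T × ℕ → V) (f : V → V), u.Sat src tgt f →
        (∀ e ∈ E, Path src tgt (firstPt l src e.1) e.1 (lastPt l tgt e.1)) ∧
        MLL1 (A.ev f ::ₘ (ctxEv Γ f + entryFms l r src tgt E))

variable {l r : V} {lex : Set (List T × Fm L V 0)} {Γ Γ₁ Γ₂ Γ' : Multiset (TVar V × TFm L V 0)}
  {A A₁ A₂ A' : TFm L V 0}

/-- Rules with one premise replace a letter-free factor `N` by another one, `N'`. The same letters
and lexical words then serve for the conclusion, and only the logical step `H` depends on the rule;
it may choose a new assignment for the premise. -/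
theorem sound_unary (t : Term V T) {t₁ t' : Term V T} (N N' : Term V (T × ℕ)) (hN : N.letters = 0)
    (hN' : N'.letters = 0) (ht₁ : t₁ = N.map (Gen.relabel Prod.fst) + t)
    (ht' : t' = N'.map (Gen.relabel Prod.fst) + t) (h : Sound l r lex Γ t₁ A)
    (hΓ' : ∀ D ∈ Γ', Gen.var D.1 ∈ t')
    (H : ∀ (u : Term V (T × ℕ)) (src tgt : T × ℕ → V) (f : V → V) (Δ : Multiset (Fm L V 0)),
      u.map (Gen.relabel Prod.fst) = t → N'.Sat src tgt f → u.Sat src tgt f →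
      ∃ f', N.Sat src tgt f' ∧ u.Sat src tgt f' ∧
        (MLL1 (A.ev f' ::ₘ (ctxEv Γ f' + Δ)) → MLL1 (A'.ev f ::ₘ (ctxEv Γ' f + Δ)))) :
    Sound l r lex Γ' t' A' := by
  subst ht₁ ht'
  refine ⟨hΓ', fun F => ?_⟩
  obtain ⟨u, E, hu, hl, hn, hF, hE, hs⟩ := h.2 F
  obtain ⟨u, rfl, hu'⟩ := Term.exists_of_relabel_eq_add N hN hu
  rw [Term.letters_add, hN, zero_add] at hl hn hF
  refine ⟨N' + u, E, by rw [Multiset.map_add, hu'], ?_, ?_, ?_, hE, fun src tgt f hf => ?_⟩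
  · rwa [Term.letters_add, hN', zero_add]
  · rwa [Term.letters_add, hN', zero_add]
  · rwa [Term.letters_add, hN', zero_add]
  · rw [Term.sat_add] at hf
    obtain ⟨f', h1, h2, h3⟩ := H u src tgt f (entryFms l r src tgt E) hu' hf.1 hf.2
    obtain ⟨h4, h5⟩ := hs src tgt f' (Term.sat_add.2 ⟨h1, h2⟩)
    exact ⟨h4, h3 h5⟩

/-- Multiplying terms combines their letters and lexical words. The assignment may be changed for
the second premise only, where a factor `N` is discharged. -/
theorem sound_binary {t₁ t₂ t₂' t' : Term V T} (N : Term V (T × ℕ)) (hN : N.letters = 0)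
    (ht₂ : t₂' = N.map (Gen.relabel Prod.fst) + t₂) (ht' : t' = t₁ + t₂)
    (h₁ : Sound l r lex Γ₁ t₁ A₁) (h₂ : Sound l r lex Γ₂ t₂' A₂)
    (hΓ' : ∀ D ∈ Γ', Gen.var D.1 ∈ t')
    (H : ∀ (u : Term V (T × ℕ)) (src tgt : T × ℕ → V) (f : V → V)
      (Δ₁ Δ₂ : Multiset (Fm L V 0)), u.map (Gen.relabel Prod.fst) = t₂ → u.Sat src tgt f →
      ∃ f', N.Sat src tgt f' ∧ u.Sat src tgt f' ∧
        (MLL1 (A₁.ev f ::ₘ (ctxEv Γ₁ f + Δ₁)) → MLL1 (A₂.ev f' ::ₘ (ctxEv Γ₂ f' + Δ₂)) →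
          MLL1 (A'.ev f ::ₘ (ctxEv Γ' f + (Δ₁ + Δ₂))))) :
    Sound l r lex Γ' t' A' := by
  subst ht₂ ht'
  refine ⟨hΓ', fun F => ?_⟩
  obtain ⟨u₁, E₁, hu₁, hl₁, hn₁, hF₁, hE₁, hs₁⟩ := h₁.2 F
  -- The tags of the first premise are forbidden to the second one; for this `Sound` quantifies over
  -- `F`.
  obtain ⟨u, E₂, hu, hl₂, hn₂, hF₂, hE₂, hs₂⟩ := h₂.2 (F ∪ (u₁.letters.map Prod.snd).toFinset)
  obtain ⟨u, rfl, hu'⟩ := Term.exists_of_relabel_eq_add N hN hu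
  rw [Term.letters_add, hN, zero_add] at hl₂ hn₂ hF₂
  simp only [Finset.mem_union, Multiset.mem_toFinset, not_or] at hF₂
  refine ⟨u₁ + u, E₁ + E₂, by rw [Multiset.map_add, hu', hu₁], ?_, ?_, ?_, ?_,
    fun src tgt f hf => ?_⟩
  · rw [Term.letters_add, Multiset.add_bind, hl₁, hl₂]
  · rw [Term.letters_add, Multiset.nodup_add]
    exact ⟨hn₁, hn₂, Multiset.disjoint_left.2 fun {a} h1 h2 =>
      (hF₂ a h2).2 (Multiset.mem_map_of_mem _ h1)⟩
  · intro a ha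
    rw [Term.letters_add, Multiset.mem_add] at ha
    exact ha.elim (hF₁ a) fun h => (hF₂ a h).1
  · intro e he
    exact (Multiset.mem_add.1 he).elim (hE₁ e) (hE₂ e)
  · rw [Term.sat_add] at hf
    obtain ⟨f', h1, h2, h3⟩ := H u src tgt f (entryFms l r src tgt E₁) (entryFms l r src tgt E₂)
      hu' hf.2
    obtain ⟨h4, h5⟩ := hs₁ src tgt f hf.1
    obtain ⟨h6, h7⟩ := hs₂ src tgt f' (Term.sat_add.2 ⟨h1, h2⟩)
    refine ⟨fun e he => (Multiset.mem_add.1 he).elim (h4 e) (h6 e), ?_⟩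
    rw [entryFms_add]
    exact h3 h5 h7

end Sound

/-! ### Soundness of the rules of the natural deduction system, and the converse inclusion. -/

section Soundness

variable {L : Language.{u}} {V : Type v} {T : Type w} [DecidableEq V]
  {l r : V} {lex : Set (List T × Fm L V 0)} {Γ Θ : Multiset (TVar V × TFm L V 0)}

theorem ne_of_isCtx_cons {X : TVar V} {A : TFm L V 0} (h : IsCtx T ((X, A) ::ₘ Γ))
    {D : TVar V × TFm L V 0} (hD : D ∈ Γ) : D.1 ≠ X := by
  rintro rfl
  have h1 := h.2.1
  rw [Multiset.map_cons, Multiset.nodup_cons] at h1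
  exact h1.1 (Multiset.mem_map_of_mem (fun D => D.1.symbol) hD)

theorem var_mem_of_sound_cons {t : Term V T} {X : TVar V} {A B : TFm L V 0}
    (hs : IsSeq ((X, A) ::ₘ Γ) (t + {Gen.var X}) B)
    (h : Sound l r lex ((X, A) ::ₘ Γ) (t + {Gen.var X}) B) : ∀ D ∈ Γ, Gen.var D.1 ∈ t := by
  intro D hD
  refine (Multiset.mem_add.1 (h.1 D (Multiset.mem_cons_of_mem hD))).resolve_right fun h1 => ?_
  rw [Multiset.mem_singleton, Gen.var.injEq] at h1
  exact ne_of_isCtx_cons hs.1 hD h1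

/-- Common to both eliminations of `⅋` and the introduction of `⊗`: the terms are multiplied, and
one assignment satisfies both factors. -/
theorem sound_mp {t s : Term V T} {A B C : TFm L V 0}
    (hC : ∀ (f : V → V) (Δ Δ' : Multiset (Fm L V 0)),
      MLL1 (A.ev f ::ₘ Δ) → MLL1 (C.ev f ::ₘ Δ') → MLL1 (B.ev f ::ₘ (Δ + Δ')))
    (h₁ : Sound l r lex Γ t A) (h₂ : Sound l r lex Θ s C) :
    Sound l r lex (Γ + Θ) (t + s) B := by
  refine sound_binary 0 rfl (by simp) rfl h₁ h₂ ?_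
    fun u src tgt f Δ Δ' _ hu => ⟨f, Term.sat_zero, hu, fun h1 h2 => ?_⟩
  · intro D hD
    exact Multiset.mem_add.2 ((Multiset.mem_add.1 hD).imp (h₁.1 D) (h₂.1 D))
  · have h := hC f _ _ h1 h2
    rwa [ctxEv_add, add_add_add_comm]

theorem sound_etaExp {t : Term V T} {A A' : TFm L V 0} {i j : V}
    (hA : ∀ f : V → V, f j = f i → A'.ev f = A.ev f) (h : Sound l r lex Γ t A) :
    Sound l r lex Γ (Gen.delta i j ::ₘ t) A' := by
  refine sound_unary t 0 {Gen.delta i j} rfl (by simp [Gen.letters, Gen.delta]) (by simp)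
    (by simp [Gen.relabel, Gen.delta]) h (fun D hD => Multiset.mem_cons_of_mem (h.1 D hD))
    fun u src tgt f Δ _ hN hu => ⟨f, Term.sat_zero, hu, fun h => ?_⟩
  rw [Term.sat_singleton] at hN
  rwa [hA f hN]

/-- The premise has an additional delta, which must be satisfied too: `f'` adjusts the assignment so
that its ends agree, without touching the indices of the remaining term. -/
theorem sound_etaRed {t : Term V T} {A A' : TFm L V 0} {i j : V} {f' : (V → V) → V → V}
    (hA : ∀ f : V → V, A'.ev (f' f) = A.ev f) (hij : ∀ f, f' f j = f' f i)
    (hs : IsCtx T Γ) (ht : ∀ f k, k ∈ t.up ∨ k ∈ t.lo → f' f k = f k)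
    (h : Sound l r lex Γ (Gen.delta i j ::ₘ t) A') : Sound l r lex Γ t A := by
  have hvar : ∀ D ∈ Γ, Gen.var D.1 ∈ t := fun D hD =>
    (Multiset.mem_cons.1 (h.1 D hD)).resolve_left (by simp [Gen.delta])
  refine sound_unary t {Gen.delta i j} 0 (by simp [Gen.letters, Gen.delta]) rfl
    (by simp [Gen.relabel, Gen.delta]) (by simp) h hvar
    fun u src tgt f Δ htu _ hu => ⟨f' f, Term.sat_singleton.2 (hij f), hu.congr ?_, fun h => ?_⟩
  · rw [← htu, Term.up_relabel, Term.lo_relabel] at ht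
    exact ht f
  · rwa [hA, ctxEv_congr_of_var_mem hs hvar (ht f)] at h

/-- If `j ≠ i`, linearity of the premise keeps `j` out of `t` and of `A`, so it can be given the
value of `i` freely. -/
theorem sound_etaUpRed {t : Term V T} {A : TFm L V 0} {i j : V} (hi : i ∈ A.ups)
    (hs : IsSeq Γ (Gen.delta i j ::ₘ t) (A.substUp i j))
    (h : Sound l r lex Γ (Gen.delta i j ::ₘ t) (A.substUp i j)) : Sound l r lex Γ t A := by
  by_cases hij : j = i
  · subst hij
    exact sound_etaRed (f' := id) (fun f => TFm.ev_substUp A rfl) (fun f => rfl) hs.1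
      (fun _ _ _ => rfl) h
  obtain ⟨-, hb, hn, -⟩ := isPseudotyping_iff.1 hs.2
  have hn' := hn
  rw [hb] at hn'
  rw [TFm.los_substUp, Term.lo_cons, Gen.delta, Gen.lo_reg, Multiset.singleton_add,
    Multiset.cons_add, Multiset.nodup_cons, Multiset.mem_add, not_or] at hn'
  rw [Term.up_cons, Multiset.nodup_add] at hn
  have hj : j ∈ (A.substUp i j).ups := by
    rw [TFm.substUp, TFm.ups_rename]
    exact Multiset.mem_map.2 ⟨i, hi, if_pos rfl⟩
  -- Otherwise `j` would be an upper index twice after the substitution.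
  have hju : j ∉ A.ups := by
    intro hju
    have h2 := hn.2.1
    rw [TFm.substUp, TFm.ups_rename] at h2
    exact hij (Multiset.inj_on_of_nodup_map h2 j hju i hi (by simp [hij]))
  refine sound_etaRed (f' := fun f => Function.update f j (f i)) (fun f => ?_) (fun f => ?_) hs.1
    (fun f k hk => Function.update_of_ne ?_ _ _) h
  · rw [TFm.ev_substUp A (by rw [Function.update_self, Function.update_of_ne (Ne.symm hij)])]
    refine TFm.ev_congr A (fun k hk => Function.update_of_ne ?_ _ _) fun k hk =>
      Function.update_of_ne ?_ _ _ <;> rintro rfl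
    exacts [hju hk, hn'.1.2 hk]
  · rw [Function.update_self, Function.update_of_ne (Ne.symm hij)]
  · rintro rfl
    exact hk.elim (fun hk => Multiset.disjoint_left.1 hn.2.2 (Multiset.mem_add.2 (Or.inr hk)) hj) hn'.1.1

theorem sound_etaLoRed {t : Term V T} {A : TFm L V 0} {i j : V} (hj : j ∈ A.los)
    (hs : IsSeq Γ (Gen.delta i j ::ₘ t) (A.substLo j i))
    (h : Sound l r lex Γ (Gen.delta i j ::ₘ t) (A.substLo j i)) : Sound l r lex Γ t A := by
  by_cases hij : i = j
  · subst hij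
    exact sound_etaRed (f' := id) (fun f => TFm.ev_substLo A rfl) (fun f => rfl) hs.1
      (fun _ _ _ => rfl) h
  obtain ⟨-, hb, hn', -⟩ := isPseudotyping_iff.1 hs.2
  have hn := hn'
  rw [hb] at hn
  rw [TFm.ups_substLo, Term.up_cons, Gen.delta, Gen.up_reg, Multiset.singleton_add,
    Multiset.cons_add, Multiset.nodup_cons, Multiset.mem_add, not_or] at hn'
  rw [Term.lo_cons, Multiset.nodup_add] at hn
  have hi : i ∈ (A.substLo j i).los := by
    rw [TFm.substLo, TFm.los_rename]
    exact Multiset.mem_map.2 ⟨j, hj, if_pos rfl⟩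
  have hil : i ∉ A.los := by
    intro hil
    have h2 := hn.2.1
    rw [TFm.substLo, TFm.los_rename] at h2
    exact hij (Multiset.inj_on_of_nodup_map h2 i hil j hj (by simp [hij]))
  refine sound_etaRed (f' := fun f => Function.update f i (f j)) (fun f => ?_) (fun f => ?_) hs.1
    (fun f k hk => Function.update_of_ne ?_ _ _) h
  · rw [TFm.ev_substLo A (by rw [Function.update_self, Function.update_of_ne (Ne.symm hij)])]
    refine TFm.ev_congr A (fun k hk => Function.update_of_ne ?_ _ _) fun k hk =>
      Function.update_of_ne ?_ _ _ <;> rintro rfl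
    exacts [hn'.1.2 hk, hil hk]
  · rw [Function.update_self, Function.update_of_ne (Ne.symm hij)]
  · rintro rfl
    exact hk.elim hn'.1.1 fun hk => Multiset.disjoint_left.1 hn.2.2 (Multiset.mem_add.2 (Or.inr hk)) hi

theorem sound_parI {t : Term V T} {X : TVar V} {A B C : TFm L V 0}
    (hC : ∀ (f : V → V) (Δ : Multiset (Fm L V 0)),
      MLL1 (B.ev f ::ₘ (A.ev f).dual ::ₘ Δ) → MLL1 (C.ev f ::ₘ Δ))
    (hs : IsSeq ((X, A) ::ₘ Γ) (t + {Gen.var X}) B)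
    (h : Sound l r lex ((X, A) ::ₘ Γ) (t + {Gen.var X}) B) : Sound l r lex Γ t C := by
  refine sound_unary t {Gen.var X} 0 (by simp [Gen.letters]) rfl
    (by simp [Gen.relabel, add_comm]) (by simp) h (var_mem_of_sound_cons hs h)
    fun u src tgt f Δ _ _ hu => ⟨f, Term.sat_singleton.2 trivial, hu, fun h => hC f _ ?_⟩
  rwa [ctxEv_cons, Multiset.cons_add] at h

theorem sound_tensorE {t s : Term V T} {X Y : TVar V} {A B C : TFm L V 0}
    (h₁ : Sound l r lex Θ s (.tensor A B))
    (hs : IsSeq ((X, A) ::ₘ (Y, B) ::ₘ Γ) (t + {Gen.var X, Gen.var Y}) C)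
    (h₂ : Sound l r lex ((X, A) ::ₘ (Y, B) ::ₘ Γ) (t + {Gen.var X, Gen.var Y}) C) :
    Sound l r lex (Γ + Θ) (t + s) C := by
  refine sound_binary {Gen.var X, Gen.var Y} (by simp [Gen.letters])
    (by simp [Gen.relabel, add_comm]) (add_comm _ _) h₁ h₂ ?_
    fun u src tgt f Δ Δ' _ hu => ⟨f, by simp [Gen.Holds], hu, fun h1 h2 => ?_⟩
  · intro D hD
    refine Multiset.mem_add.2 ((Multiset.mem_add.1 hD).imp (fun hD => ?_) (h₁.1 D))
    have h3 := hs.1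
    have hX := ne_of_isCtx_cons h3 (Multiset.mem_cons_of_mem hD)
    rw [Multiset.cons_swap] at h3
    have hY := ne_of_isCtx_cons h3 (Multiset.mem_cons_of_mem hD)
    have h4 := h₂.1 D (by simp [hD])
    simpa [hX, hY] using h4
  · simp only [ctxEv_cons, Multiset.cons_add] at h2
    have h := mll_tensor_elim h1 h2
    rw [ctxEv_add]
    convert h using 2
    abel

theorem sound_triI {t : Term V T} {A : TFm L V 1} {μ ν : V}
    (h : Sound l r lex Γ t (A.inst ν μ)) : Sound l r lex Γ (Gen.delta ν μ ::ₘ t) (.tri A) := by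
  refine sound_unary t 0 {Gen.delta ν μ} rfl (by simp [Gen.letters, Gen.delta]) (by simp)
    (by simp [Gen.relabel, Gen.delta]) h (fun D hD => Multiset.mem_cons_of_mem (h.1 D hD))
    fun u src tgt f Δ _ hN hu => ⟨f, Term.sat_zero, hu, fun h => ?_⟩
  rw [Term.sat_singleton] at hN
  rw [TFm.ev_inst (f := f) A rfl hN (fun _ _ => rfl) fun _ _ => rfl] at h
  rw [TFm.ev_tri]
  exact MLL1.ex _ _ _ h

variable [Infinite V]

/-- Satisfaction of the only edge says that its word is a path between the values of its ends. So
the lexical formula at the end points of the word equals the formula on the right, and the sequent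
is an identity. -/
theorem sound_entry {e : List T × Fm L V 0} (he : e ∈ lex) (hne : e.1 ≠ []) (hlr : l ≠ r)
    (hu : e.2.toTensor.ups = {l}) (hl : e.2.toTensor.los = {r}) (σ : V → V) :
    Sound l r lex 0 {Gen.reg e.1 (σ l) (σ r)} (e.2.toTensor.mapFree σ) := by
  refine ⟨by simp, fun F => ?_⟩
  -- The letters are numbered consecutively, starting above all forbidden tags.
  let x : List (T × ℕ) := e.1.zipIdx (F.sup id + 1)
  have hx : x.map Prod.fst = e.1 := List.zipIdx_map_fst _ _
  have hxne : x ≠ [] := by rintro h; rw [h] at hx; exact hne hx.symm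
  refine ⟨{Gen.reg x (σ l) (σ r)}, {(x, e.2)}, ?_, ?_, ?_, ?_, ?_, fun src tgt f hf => ?_⟩
  · rw [Multiset.map_singleton, Gen.relabel, hx]
  · rw [Term.letters_singleton, Multiset.singleton_bind]; rfl
  · rw [Term.letters_singleton]
    refine Multiset.coe_nodup.2 (List.Nodup.of_map Prod.snd ?_)
    rw [List.zipIdx_map_snd]
    exact List.nodup_range'
  · intro a ha haF
    rw [Term.letters_singleton] at ha
    have h1 : F.sup id + 1 ≤ a.2 := List.le_snd_of_mem_zipIdx (show a ∈ x from ha)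
    have h2 : a.2 ≤ F.sup id := Finset.le_sup (f := id) haF
    omega
  · intro e' he'
    rw [Multiset.mem_singleton] at he'
    subst he'
    rw [hx]
    exact he
  · have hp : Path src tgt (f (σ l)) x (f (σ r)) := Term.sat_singleton.1 hf
    refine ⟨fun e' he' => ?_, ?_⟩
    · rw [Multiset.mem_singleton] at he'
      subst he'
      rw [hp.firstPt_eq hxne, hp.lastPt_eq hxne]
      exact hp
    · rw [ev_entry hu hl hlr, ctxEv_zero, zero_add, entryFms, Multiset.map_singleton]
      dsimp only
      rw [hp.firstPt_eq hxne, hp.lastPt_eq hxne]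
      exact mll_id' _

theorem sound_id {X : TVar V} {A : TFm L V 0} :
    Sound (T := T) l r lex {(X, A)} {Gen.var X} A := by
  refine ⟨by simp, fun F => ⟨{Gen.var X}, 0, rfl, by simp [Gen.letters], by simp [Gen.letters],
    by simp [Gen.letters], by simp, fun src tgt f _ => ⟨by simp, ?_⟩⟩⟩
  rw [ctxEv, Multiset.map_singleton, entryFms, Multiset.map_zero, add_zero]
  exact mll_id' _

/-- The reduction is lifted to tagged terms, and an assignment that satisfies the new term is pulled
back. It changes at most bound indices, which the sequent does not see. -/
theorem sound_beta {t t' : Term V T} {A : TFm L V 0} (h : Sound l r lex Γ t A) (hb : t.BetaEq t')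
    (hs : IsSeq Γ t A) : Sound l r lex Γ t' A := by
  refine ⟨fun D hD => (hb.satEquiv.2 _).1 (h.1 D hD), fun F => ?_⟩
  obtain ⟨u, E, rfl, hl, hn, hF, hE, hsat⟩ := h.2 F
  obtain ⟨u', rfl, hbu⟩ := (Term.BetaEq.lift hb).1 u rfl
  have hq := hbu.satEquiv
  rw [hq.1] at hl hn hF
  refine ⟨u', E, rfl, hl, hn, hF, hE, fun src tgt f hf => ?_⟩
  obtain ⟨f', hff', hf'⟩ := hq.5 hf
  -- Rigidity gives no control over indices that are absent from the term; there the original value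
  -- is restored.
  let g : V → V := fun k => if k ∈ u.up ∨ k ∈ u.lo then f' k else f k
  have hg : ∀ k, u.Rigid k → g k = f k := by
    intro k hk
    simp only [g]
    split_ifs
    exacts [hff' k hk, rfl]
  obtain ⟨h1, h2⟩ := hsat src tgt g (hf'.congr fun k hk => if_pos hk)
  refine ⟨h1, ?_⟩
  obtain ⟨-, hbal, hnd, -⟩ := isPseudotyping_iff.1 hs.2
  rw [Term.up_relabel] at hbal hnd
  rw [Term.lo_relabel] at hbal
  have hnd' := hnd
  rw [hbal] at hnd'
  -- An index of `A` that occurs in the term is free there: with both an upper and a lower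
  -- occurrence in the term it would violate linearity of the judgement.
  have hfree : ∀ k, (k ∈ A.ups ∨ k ∈ A.los) → g k = f k := by
    intro k hk
    by_cases hku : k ∈ u.up ∨ k ∈ u.lo
    · refine hg k (Or.inl fun hc => ?_)
      have h3 : k ∈ u.up ∧ k ∈ u.lo := by
        rw [← Multiset.count_pos, ← Multiset.count_pos] at hku ⊢
        omega
      exact hk.elim (Multiset.disjoint_left.1 (Multiset.nodup_add.1 hnd).2.2 h3.1)
        (Multiset.disjoint_left.1 (Multiset.nodup_add.1 hnd').2.2 h3.2)
    · exact if_neg hku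
  rwa [TFm.ev_congr A (f := g) (f' := f) (fun k hk => hfree k (Or.inl hk))
    fun k hk => hfree k (Or.inr hk), ctxEv_congr hs.1 fun D hD k hk =>
      hg k (Or.inr ⟨_, (Term.var_mem_relabel _ _ _).1 (h.1 D hD), hk⟩)] at h2

/-- The two indices occur nowhere else, so both can be sent to a new eigenvariable. -/
theorem sound_nablaI {t : Term V T} {A : TFm L V 1} {μ ν : V}
    (hs : IsSeq Γ (Gen.delta μ ν ::ₘ t) (A.inst ν μ)) (hs' : IsSeq Γ t (.nabla A))
    (h : Sound l r lex Γ (Gen.delta μ ν ::ₘ t) (A.inst ν μ)) : Sound l r lex Γ t (.nabla A) := by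
  have hvar : ∀ D ∈ Γ, Gen.var D.1 ∈ t := fun D hD =>
    (Multiset.mem_cons.1 (h.1 D hD)).resolve_left (by simp [Gen.delta])
  have hB := (isPseudotyping_iff.1 hs'.2).1
  obtain ⟨-, hb, hn, -⟩ := isPseudotyping_iff.1 hs.2
  have hn' := hn
  rw [hb] at hn'
  simp only [Term.up_cons, Term.lo_cons, Gen.delta, Gen.up_reg, Gen.lo_reg,
    TFm.ups_inst hB, TFm.los_inst hB, Multiset.singleton_add, Multiset.add_cons,
    Multiset.cons_add, Multiset.nodup_cons, Multiset.mem_cons, Multiset.mem_add, not_or] at hn hn'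
  refine sound_unary t {Gen.delta μ ν} 0 (by simp [Gen.letters, Gen.delta]) rfl
    (by simp [Gen.relabel, Gen.delta]) (by simp) h hvar fun u src tgt f Δ htu _ hu => ?_
  -- `x` also avoids the lexical formulas in `Δ`. These refer to the end points of words and not to
  -- indices, so they stay put when the assignment changes.
  obtain ⟨x, -, hx⟩ := Fm.exists_fresh ((TFm.nabla A).ev f ::ₘ (ctxEv Γ f + Δ)) ∅ Set.finite_empty
  let f' : V → V := fun i => if i = ν ∨ i = μ then x else f i
  have hf' : ∀ i, i ≠ ν → i ≠ μ → f' i = f i := fun i h1 h2 => if_neg (by tauto)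
  have ht : ∀ k, k ∈ t.up ∨ k ∈ t.lo → f' k = f k := by
    intro k hk
    refine hf' k ?_ ?_ <;> rintro rfl <;> tauto
  refine ⟨f', Term.sat_singleton.2 ?_, hu.congr ?_, fun h => ?_⟩
  · change f' ν = f' μ
    simp [f']
  · rwa [← htu, Term.up_relabel, Term.lo_relabel] at ht
  · rw [TFm.ev_inst (f := f) (x := x) A (by simp [f']) (by simp [f'])
      (fun i hi => hf' i (by rintro rfl; tauto) (by rintro rfl; tauto))
      (fun i hi => hf' i (by rintro rfl; tauto) (by rintro rfl; tauto)),
      ctxEv_congr_of_var_mem hs'.1 hvar ht] at h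
    rw [TFm.ev_nabla] at hx ⊢
    exact MLL1.all _ _ x hx h

theorem sound_nablaE {t : Term V T} {A : TFm L V 1} {μ ν : V}
    (h : Sound l r lex Γ t (.nabla A)) : Sound l r lex Γ (Gen.delta μ ν ::ₘ t) (A.inst ν μ) := by
  refine sound_unary t 0 {Gen.delta μ ν} rfl (by simp [Gen.letters, Gen.delta]) (by simp)
    (by simp [Gen.relabel, Gen.delta]) h (fun D hD => Multiset.mem_cons_of_mem (h.1 D hD))
    fun u src tgt f Δ _ hN hu => ⟨f, Term.sat_zero, hu, fun h => ?_⟩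
  rw [Term.sat_singleton] at hN
  rw [TFm.ev_nabla] at h
  rw [TFm.ev_inst (f := f) A rfl (Eq.symm hN) (fun _ _ => rfl) fun _ _ => rfl]
  exact mll_all_inv h _

/-- A cut on the existential formula: by linearity of the second premise `ν` and `μ` are available
for an eigenvariable, which turns the hypothesis `X` into the dual universal formula. -/
theorem sound_triE {t s : Term V T} {X : TVar V} {A : TFm L V 1} {C : TFm L V 0} {μ ν : V}
    (hs : IsSeq Γ t (.tri A)) (h₁ : Sound l r lex Γ t (.tri A))
    (hs' : IsSeq ((X, A.inst ν μ) ::ₘ Θ) (Gen.delta ν μ ::ₘ (s + {Gen.var X})) C)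
    (h₂ : Sound l r lex ((X, A.inst ν μ) ::ₘ Θ) (Gen.delta ν μ ::ₘ (s + {Gen.var X})) C) :
    Sound l r lex (Γ + Θ) (s + t) C := by
  have hvar : ∀ D ∈ Θ, Gen.var D.1 ∈ s := by
    intro D hD
    have h1 := h₂.1 D (Multiset.mem_cons_of_mem hD)
    simpa [Gen.delta, ne_of_isCtx_cons hs'.1 hD] using h1
  have hB : (TFm.nabla A).BindersOK := (isPseudotyping_iff.1 hs.2).1
  have hΘ : IsCtx T Θ := hs'.1.mono (Multiset.le_cons_self _ _)
  obtain ⟨-, hX, hX', -⟩ := (isCtx_iff.1 hs'.1).1 _ (Multiset.mem_cons_self _ _)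
  obtain ⟨-, hb, hn, -⟩ := isPseudotyping_iff.1 hs'.2
  have hn' := hn
  rw [hb] at hn'
  dsimp only at hX hX'
  simp only [Term.up_cons, Term.lo_cons, Term.up_add, Term.lo_add, Term.up_singleton,
    Term.lo_singleton, Gen.delta, Gen.up_reg, Gen.lo_reg, Gen.up_var, Gen.lo_var, hX, hX',
    TFm.ups_inst hB, TFm.los_inst hB, Multiset.singleton_add, Multiset.add_cons,
    Multiset.cons_add, Multiset.nodup_cons, Multiset.mem_cons, Multiset.mem_add, not_or] at hn hn'
  refine sound_binary {Gen.delta ν μ, Gen.var X} (by simp [Gen.letters, Gen.delta])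
    (by simp [Gen.relabel, Gen.delta, add_comm]) (add_comm _ _) h₁ h₂ ?_
    fun u src tgt f Δ Δ' htu hu => ?_
  · intro D hD
    exact Multiset.mem_add.2 ((Multiset.mem_add.1 hD).symm.imp (hvar D) (h₁.1 D))
  obtain ⟨x, -, hx⟩ := Fm.exists_fresh
    ((Fm.all (A.ev f).dual) ::ₘ C.ev f ::ₘ (ctxEv Θ f + Δ')) ∅ Set.finite_empty
  let f' : V → V := fun i => if i = ν ∨ i = μ then x else f i
  have hf' : ∀ i, i ≠ ν → i ≠ μ → f' i = f i := fun i h1 h2 => if_neg (by tauto)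
  have ht : ∀ k, k ∈ s.up ∨ k ∈ s.lo → f' k = f k := by
    intro k hk
    refine hf' k ?_ ?_ <;> rintro rfl <;> tauto
  refine ⟨f', ?_, hu.congr ?_, fun h1 h2 => ?_⟩
  · rw [Multiset.insert_eq_cons, Term.sat_cons, Term.sat_singleton]
    refine ⟨?_, trivial⟩
    change f' μ = f' ν
    simp [f']
  · rwa [← htu, Term.up_relabel, Term.lo_relabel] at ht
  · rw [ctxEv_cons, TFm.ev_inst (f := f) (x := x) A (by simp [f']) (by simp [f'])
      (fun i hi => hf' i (by rintro rfl; tauto) (by rintro rfl; tauto))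
      (fun i hi => hf' i (by rintro rfl; tauto) (by rintro rfl; tauto)),
      ctxEv_congr_of_var_mem hΘ hvar ht, TFm.ev_congr (f' := f) C
      (fun i hi => hf' i (by rintro rfl; tauto) (by rintro rfl; tauto))
      (fun i hi => hf' i (by rintro rfl; tauto) (by rintro rfl; tauto)), Multiset.cons_add,
      Multiset.cons_swap, ← Fm.inst_dual] at h2
    rw [TFm.ev_tri] at h1
    have h := mll_mp h1 (MLL1.all _ _ x hx h2)
    rwa [ctxEv_add, add_add_add_comm]

theorem sound_of_nd {Ax : Set (Term V T × TFm L V 0)}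
    (hAx : ∀ t A, (t, A) ∈ Ax → Sound l r lex 0 t A) {t : Term V T} {A : TFm L V 0}
    (h : ND Ax Γ t A) : Sound l r lex Γ t A := by
  induction h with
  | ax h _ => exact hAx _ _ h
  | id _ => exact sound_id
  | beta h hb _ ih => exact sound_beta ih hb h.isSeq
  | etaUpExp _ _ _ ih => exact sound_etaExp (fun f h => TFm.ev_substUp _ h) ih
  | etaUpRed hi h _ ih => exact sound_etaUpRed (TFm.mem_FIup.1 hi) h.isSeq ih
  | etaLoExp _ _ _ ih => exact sound_etaExp (fun f h => TFm.ev_substLo _ h.symm) ih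
  | etaLoRed hj h _ ih => exact sound_etaLoRed (TFm.mem_FIlo.1 hj) h.isSeq ih
  | parIl h _ ih =>
    refine sound_parI (fun f Δ h => ?_) h.isSeq ih
    rw [TFm.ev_par, TFm.ev_dual]
    exact MLL1.par _ _ _ (by rwa [Multiset.cons_swap])
  | parIr h _ ih =>
    refine sound_parI (fun f Δ h => ?_) h.isSeq ih
    rw [TFm.ev_par, TFm.ev_dual]
    exact MLL1.par _ _ _ h
  | parEl _ _ _ ih₁ ih₂ =>
    refine sound_mp (fun f Δ Δ' h₁ h₂ => ?_) ih₁ ih₂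
    rw [TFm.ev_par, TFm.ev_dual] at h₂
    exact mll_mp h₁ (mll_par_inv h₂)
  | parEr _ _ _ ih₁ ih₂ =>
    refine sound_mp (fun f Δ Δ' h₁ h₂ => ?_) ih₁ ih₂
    rw [TFm.ev_par, TFm.ev_dual] at h₁
    rw [add_comm]
    refine mll_mp h₂ ?_
    rw [Multiset.cons_swap]
    exact mll_par_inv h₁
  | tensorI _ _ _ ih₁ ih₂ =>
    exact sound_mp (fun f Δ Δ' h₁ h₂ => MLL1.tensor _ _ _ _ h₁ h₂) ih₁ ih₂
  | tensorE _ h₂ _ ih₁ ih₂ => exact sound_tensorE ih₁ h₂.isSeq ih₂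
  | nablaI _ h hs ih => exact sound_nablaI h.isSeq hs ih
  | nablaE _ _ _ ih => exact sound_nablaE ih
  | triI _ _ _ ih => exact sound_triI ih
  | triE _ h₁ h₂ _ ih₁ ih₂ => exact sound_triE h₁.isSeq ih₁ h₂.isSeq ih₂

/-- `Sound` holds for every choice of end points of the letters. Choosing them along a path without
repeated points makes the first order sequent into the one of the grammar. -/
theorem MILLGrammar.subset_language (G : MILLGrammar L V T l r) (hG : G.WellFormed) :
    (G.tensorTranslation hG).language ⊆ G.language := by
  rintro x ⟨i, j, h⟩
  have hij : j ≠ i := by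
    rintro rfl
    obtain ⟨-, -, hn, -⟩ := isPseudotyping_iff.1 h.isSeq.2
    refine Multiset.disjoint_left.1 (Multiset.nodup_add.1 hn).2.2
      (show j ∈ _ by rw [Term.up_singleton]; exact Multiset.mem_singleton_self j) ?_
    rw [TFm.ups_pos]
    refine Multiset.mem_map.2 ⟨⟨0, ?_⟩, Finset.mem_univ_val _, rfl⟩
    exact (hG.start_valency.1 ▸ Nat.one_pos : 0 < L.vl G.start)
  have hsound : Sound l r G.lex 0 {Gen.reg x j i}
      (.pos G.start (fun _ => .inl j) (fun _ => .inl i)) := by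
    refine sound_of_nd ?_ h
    rintro t A ⟨J, ⟨e, he, rfl⟩, σ, rfl, rfl⟩
    obtain ⟨hlr, -, hu, hl⟩ := ups_los_entry (G.lex_entry e he) (hG.lex_wf e he)
    rw [Multiset.map_singleton]
    exact sound_entry he (G.lex_entry e he).1 hlr hu hl σ
  obtain ⟨u, E, hu, hl, hn, -, hE, hs⟩ := hsound.2 ∅
  obtain ⟨g, u', rfl, hg, hu'⟩ := exists_eq_cons_of_map_eq_cons (t := 0) hu
  obtain rfl := Multiset.map_eq_zero.1 hu'
  obtain ⟨y, rfl, rfl⟩ := Gen.relabel_eq_reg hg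
  rw [Term.letters_cons, Term.letters_zero, add_zero] at hl hn
  obtain ⟨src, tgt, p, q, hp, hpn⟩ := exists_path (V := V) (Multiset.coe_nodup.1 hn)
  -- The lower index of the edge gets the start of the path and the upper one its end, so the single
  -- edge is satisfied.
  obtain ⟨hpe, hd⟩ := hs src tgt (fun k => if k = j then p else q)
    (Term.sat_singleton.2 (by simpa [Gen.Holds, hij.symm] using hp))
  obtain ⟨n, hcard⟩ : ∃ n, E.card = n := ⟨_, rfl⟩
  -- The lexical words exhaust the letters of the path, hence they are its consecutive segments; the
  -- points between them are the variables `c`.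
  obtain ⟨e, c, rfl, rfl, rfl, rfl, hci, -, hec⟩ := exists_order (d := l) (d' := l) hcard hp hpn
    hl.symm fun e he => ⟨fun h => (G.lex_entry _ (hE e he)).1 (by simp [h]), hpe e he⟩
  have hlex : ∀ k, ((e k).1.map Prod.fst, (e k).2) ∈ G.lex := fun k =>
    hE _ (Multiset.mem_map_of_mem _ (Finset.mem_univ_val k))
  refine ⟨n, fun k => ((e k).1.map Prod.fst, (e k).2), c, hlex, hci, ?_, ?_⟩
  · rw [List.map_flatten, List.map_ofFn]; rfl
  · rw [ev_start hG.start_valency, if_pos rfl, if_neg hij.symm, ctxEv_zero, zero_add] at hd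
    rw [entryFms, Multiset.map_map] at hd
    rw [MILL1, Multiset.map_map]
    convert hd using 2
    · rfl
    refine Multiset.map_congr rfl fun k _ => ?_
    simp only [Function.comp_apply, (hec k).1, (hec k).2]

end Soundness

end LinGram

theorem mainTheorem7 {L : LinGram.Language} {V T : Type*} [DecidableEq V] [Infinite V] {l r : V}
    (G : LinGram.MILLGrammar L V T l r) (hG : G.WellFormed) :
    G.language = (G.tensorTranslation hG).language :=
  Set.Subset.antisymm (G.language_subset hG) (G.subset_language hG)
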